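/- Let $R\subset\mathbb R^q$ be compact and let $K:R\times R\to\mathbb C$ have the spectral representation $K(x,y)=\sum_{h\ge1}\lambda_h\varphi_h(x)\overline{\varphi_h(y)}$ for all $x,y\in R$, where $(\varphi_h)_{h\ge1}$ is an orthonormal basis of $L^2(R)$, $\lambda_h\ge0$, $\sum_h\lambda_h<\infty$ and $\lambda_h<1$ for every $h$. Put $$C(x,y)=\sum_{h\ge1}\frac{\lambda_h}{1-\lambda_h}\varphi_h(x)\overline{\varphi_h(y)} .$$ Let $\Phi$ be a determinantal point process (DPP) on $R$ with kernel $K$, that is, a finite simple point process with points in $R$ whose $k$-th factorial moment measure has density $\det[K(x_i,x_j)]_{i,j\le k}$ with respect to Lebesgue measure on $R^k$, for every $k$. Let $H$ be a probability measure on $(0,\infty)$ and $\psi(u)=\int e^{-us}H(ds)$. For a finite point process $\sum_j\delta_{X_j}$ with law $\mathbf P$ and marks $S_j$ that are i.i.d. with law $H$ and independent of the points, write $\mathrm{RM}(\mathbf P,H)$ for the law of the random measure $\sum_jS_j\delta_{X_j}$. Fix $k$, let $M_{\Phi^k}$ be the $k$-th moment measure of $\Phi$ (on $k$-tuples of pairwise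 distinct points), and let $(\mathbf P^{\boldsymbol y}_{\Phi^!})_{\boldsymbol y}$ be a version of the $k$-th reduced Palm kernel of $\Phi$. For $\boldsymbol y^*=(y_1^*,\dots,y_k^*)$ let $\tilde\mu^!_{\boldsymbol y^*}\sim\mathrm{RM}(\mathbf P^{\boldsymbol y^*}_{\Phi^!},H)$, and for $u>0$ let $\tilde\mu'$ be a random finite measure with Laplace functional $$\mathsf E\Big[e^{-\int f\,d\tilde\mu'}\Big]=\frac{\mathsf E\big[\exp\{-\int(f(z)+u)\,\tilde\mu^!_{\boldsymbol y^*}(dz)\}\big]}{\mathsf E\big[\exp\{-\int u\,\tilde\mu^!_{\boldsymbol y^*}(dz)\}\big]}$$ for all bounded measurable $f\ge0$ of bounded support (this is the part of the posterior of $\tilde\mu\sim\mathrm{RM}(\mathbf P_\Phi,H)$, given the observations and $U_n=u$, that does not sit on the distinct observed values $\boldsymbol y^*$). Then for $M_{\Phi^k}$-almost every $\boldsymbol y^*$ and every $u>0$ the matrix $C_{\boldsymbol y^*}=[C(y_i^*,y_j^*)]_{i,j\le k}$ is invertible, the random measure $\tilde\mu'$ exists, and it is equal in distribution to $$\tilde\eta=\sum_jS'_j\delta_{X'_j},$$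 where $\Phi'=\sum_j\delta_{X_j'}$ is a DPP on $R$ with density with respect to the unit intensity Poisson process on $R$ given by $f_{\Phi'}(\nu)\propto\det[C'(x_i,x_j)]$ for $\nu=\sum_i\delta_{x_i}$, with $$C'(x,z)=\psi(u)\Big[C(x,z)-\sum_{i,j=1}^k(C_{\boldsymbol y^*}^{-1})_{ij}\,C(x,y_i^*)\,C(y_j^*,z)\Big],\qquad x,z\in R,$$ and the marks $S_j'$ are i.i.d., independent of $\Phi'$, with distribution $H'(ds)=e^{-su}H(ds)\big/\int e^{-su}H(ds)$. That $\Phi'$ is a DPP means: $C'(x,z)=\sum_h\frac{\lambda_h'}{1-\lambda_h'}\varphi'_h(x)\overline{\varphi'_h(z)}$ on $R\times R$ for an orthonormal basis $(\varphi_h')$ of $L^2(R)$ and numbers $\lambda_h'\in[0,1)$ with $\sum_h\lambda'_h<\infty$, and $\Phi'$ is a DPP with kernel $K'(x,z)=\sum_h\lambda_h'\varphi_h'(x)\overline{\varphi_h'(z)}$. -/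

import Mathlib

open MeasureTheory ProbabilityTheory
open scoped ENNReal ComplexConjugate

noncomputable section

/-- The finite configuration `∑ i, δ_{x i}`, viewed as a counting measure. -/
def config {E : Type*} [MeasurableSpace E] {n : ℕ} (x : Fin n → E) : Measure E :=
  ∑ i, Measure.dirac (x i)

/-- The set of `k`-tuples of pairwise distinct points. -/
def distinctTuples (E : Type*) (k : ℕ) : Set (Fin k → E) := {x | Function.Injective x}

/-- The `k`-th moment measure `E[Φ^k(·)]` of a point process with law `P`, restricted to the tuples
of pairwise distinct points. For a simple point process this is the `k`-th factorial moment
measure. -/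
def momentMeasure {E : Type*} [MeasurableSpace E] (k : ℕ) (P : Measure (Measure E)) :
    Measure (Fin k → E) :=
  P.bind fun ν => (Measure.pi fun _ : Fin k => ν).restrict (distinctTuples E k)

/-- `Pal` is a version of the `k`-th reduced Palm kernel of the point process with law `P` (at tuples
of pairwise distinct points): the laws of `ν + ∑ j, δ_{x j}`, with `ν` distributed according to
`Pal x`, disintegrate the `k`-th Campbell measure of `P` with respect to the `k`-th moment measure.
Here `Pal x` is the law of `Φ^!_x = Φ_x - ∑ j, δ_{x j}`. -/
structure IsReducedPalm {E : Type*} [MeasurableSpace E] (k : ℕ) (P : Measure (Measure E))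
    (Pal : Kernel (Fin k → E) (Measure E)) : Prop where
  markov : IsMarkovKernel Pal
  disintegration : ∀ g : (Fin k → E) → Measure E → ℝ≥0∞, Measurable (Function.uncurry g) →
    ∫⁻ ν, ∫⁻ x in distinctTuples E k, g x ν ∂(Measure.pi fun _ : Fin k => ν) ∂P =
      ∫⁻ x, ∫⁻ ν, g x (ν + config x) ∂(Pal x) ∂(momentMeasure k P)

/-- The law of the Poisson point process with finite intensity measure `ω`: the number of points is
Poisson distributed with mean `ω(E)` and, given their number, the points are i.i.d. with law
`ω / ω(E)`. -/
def poissonLaw {E : Type*} [MeasurableSpace E] (ω : Measure E) : Measure (Measure E) :=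
  Measure.sum fun n : ℕ =>
    ENNReal.ofReal (Real.exp (-ω.real Set.univ) / (n.factorial : ℝ)) •
      (Measure.pi fun _ : Fin n => ω).map config

/-- The matrix `[C (x i) (x j)]`. -/
def kernelMatrix {E : Type*} (C : E → E → ℂ) {n : ℕ} (x : Fin n → E) : Matrix (Fin n) (Fin n) ℂ :=
  Matrix.of fun i j => C (x i) (x j)

/-- The spectral representation `K(x, y) = ∑ h, lam h * φ h x * conj (φ h y)` on `R × R`, with
`(φ h)` an orthonormal basis of `L²(R)`, `lam h ≥ 0` and `∑ h, lam h < ∞`. -/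
structure HasSpectralRepresentation {q : ℕ} (R : Set (EuclideanSpace ℝ (Fin q)))
    (K : EuclideanSpace ℝ (Fin q) → EuclideanSpace ℝ (Fin q) → ℂ)
    (lam : ℕ → ℝ) (φ : ℕ → EuclideanSpace ℝ (Fin q) → ℂ) : Prop where
  measurable : ∀ h, Measurable (φ h)
  memLp : ∀ h, MemLp (φ h) 2 (volume.restrict R)
  orthonormal : Orthonormal ℂ fun h => (memLp h).toLp
  complete : (Submodule.span ℂ (Set.range fun h => (memLp h).toLp)).topologicalClosure = ⊤
  nonneg : ∀ h, 0 ≤ lam h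
  summable : Summable lam
  hasSum : ∀ x ∈ R, ∀ y ∈ R, HasSum (fun h => (lam h : ℂ) * φ h x * conj (φ h y)) (K x y)

/-- `P` is the law of a determinantal point process on `R` with kernel `K`: a finite simple point
process with points in `R` whose `k`-th factorial moment measure has, for every `k`, the density
`det [K (x i) (x j)]` with respect to Lebesgue measure. -/
structure IsDPP {q : ℕ} (R : Set (EuclideanSpace ℝ (Fin q)))
    (K : EuclideanSpace ℝ (Fin q) → EuclideanSpace ℝ (Fin q) → ℂ)
    (P : Measure (Measure (EuclideanSpace ℝ (Fin q)))) : Prop where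
  prob : IsProbabilityMeasure P
  simple : ∀ᵐ ν ∂P, ∃ (n : ℕ) (x : Fin n → EuclideanSpace ℝ (Fin q)),
    Function.Injective x ∧ (∀ i, x i ∈ R) ∧ ν = config x
  moment : ∀ k : ℕ, momentMeasure k P =
    (Measure.pi fun _ : Fin k => volume.restrict R).withDensity fun x =>
      ENNReal.ofReal (kernelMatrix K x).det.re

/-- `P` has a density `f` with respect to the unit intensity Poisson process on `R`, and `f` is
proportional to the determinant of `C`, i.e. `f(∑ i, δ_{x i}) = c * det [C (x i) (x j)]` for all
finite configurations in `R`, the determinants being nonnegative reals. -/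
def HasDetDensity {q : ℕ} (R : Set (EuclideanSpace ℝ (Fin q)))
    (C : EuclideanSpace ℝ (Fin q) → EuclideanSpace ℝ (Fin q) → ℂ)
    (P : Measure (Measure (EuclideanSpace ℝ (Fin q)))) : Prop :=
  ∃ (c : ℝ) (f : Measure (EuclideanSpace ℝ (Fin q)) → ℝ≥0∞), 0 < c ∧ Measurable f ∧
    (∀ (n : ℕ) (x : Fin n → EuclideanSpace ℝ (Fin q)), (∀ i, x i ∈ R) →
      ∃ d : ℝ, 0 ≤ d ∧ (kernelMatrix C x).det = (d : ℂ) ∧ f (config x) = ENNReal.ofReal (c * d)) ∧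
    P = (poissonLaw (volume.restrict R)).withDensity f

/-- The kernel `C(x, y) = ∑ h, lam h / (1 - lam h) * φ h x * conj (φ h y)`. -/
def cKernel {E : Type*} (lam : ℕ → ℝ) (φ : ℕ → E → ℂ) (x y : E) : ℂ :=
  ∑' h, ((lam h / (1 - lam h) : ℝ) : ℂ) * φ h x * conj (φ h y)

/-- The Laplace transform `ψ(u) = E[exp(-u S)]`, `S ∼ H`. -/
def psi (H : Measure ℝ) (u : ℝ) : ℝ := ∫ s, Real.exp (-(u * s)) ∂H

/-- The kernel
`C'(x, z) = ψ(u) * (C(x, z) - ∑ i j, (C_y⁻¹) i j * C(x, y i) * C(y j, z))`. -/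
def cPrime {E : Type*} (H : Measure ℝ) (u : ℝ) (C : E → E → ℂ) {k : ℕ} (y : Fin k → E)
    (x z : E) : ℂ :=
  (psi H u : ℂ) * (C x z - ∑ i, ∑ j, (kernelMatrix C y)⁻¹ i j * C x (y i) * C (y j) z)

/-- The exponential tilting `H'(ds) = exp(-s u) H(ds) / ∫ exp(-s u) H(ds)`. -/
def expTilt (H : Measure ℝ) (u : ℝ) : Measure ℝ := H.tilted fun s => -(u * s)

/-- `Q` is the law `RM(P, H)`: the law of `μ = ∑_{j < N} S j δ_{X j}`, where `∑_{j < N} δ_{X j}` is a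
finite point process with law `P` and the marks `S j` are i.i.d. with law `H`, independent of the
points. -/
def IsRMLaw {E : Type*} [MeasurableSpace E] (P : Measure (Measure E)) (H : Measure ℝ)
    (Q : Measure (Measure E)) : Prop :=
  ∃ (Ω : Type) (_ : MeasurableSpace Ω) (Pr : Measure Ω)
    (N : Ω → ℕ) (X : ℕ → Ω → E) (S : ℕ → Ω → ℝ),
    IsProbabilityMeasure Pr ∧ Measurable N ∧ (∀ j, Measurable (X j)) ∧ (∀ j, Measurable (S j)) ∧
    iIndepFun S Pr ∧ (∀ j, Pr.map (S j) = H) ∧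
    IndepFun (fun ω => (N ω, fun j => X j ω)) (fun ω j => S j ω) Pr ∧
    P = Pr.map (fun ω => ∑ j ∈ Finset.range (N ω), Measure.dirac (X j ω)) ∧
    Q = Pr.map (fun ω => ∑ j ∈ Finset.range (N ω), ENNReal.ofReal (S j ω) • Measure.dirac (X j ω))

/-- The Laplace functional `E[exp(-∫ f dμ)]` of a random measure with law `Q`. -/
def laplaceFunctional {E : Type*} [MeasurableSpace E] (Q : Measure (Measure E)) (f : E → ℝ) : ℝ :=
  ∫ μ, Real.exp (-∫ z, f z ∂μ) ∂Q

/-- `Q` is the law of the random finite measure `μ'` whose Laplace functional is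
`E[exp(-∫ (f + u) dμ^!)] / E[exp(-∫ u dμ^!)]` for all bounded nonnegative measurable `f` of bounded
support, where `μ^!` has law `RM(Ppal, H)`. -/
def IsResidualLaw {E : Type*} [MeasurableSpace E] [Bornology E] (Ppal : Measure (Measure E))
    (H : Measure ℝ) (u : ℝ) (Q : Measure (Measure E)) : Prop :=
  IsProbabilityMeasure Q ∧ (∀ᵐ μ ∂Q, IsFiniteMeasure μ) ∧
  ∃ Qpal : Measure (Measure E), IsRMLaw Ppal H Qpal ∧
    ∀ f : E → ℝ, Measurable f → (∀ z, 0 ≤ f z) → (∃ b, ∀ z, f z ≤ b) →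
      Bornology.IsBounded (Function.support f) →
      laplaceFunctional Q f =
        laplaceFunctional Qpal (fun z => f z + u) / laplaceFunctional Qpal (fun _ => u)

end

/-!
Every process in the statement is a member of one explicit family. For a nonnegative kernel `C` with
summable eigenvalues on `R`, let `detLaw` be the measure on configurations which has, on those with
`n` points, the density `det [C (x i) (x j)] / n!`; its total mass is the Fredholm determinant
`det (1 + C)`, and `detProcess R C` is its normalisation. The argument identifies the given process,
its reduced Palm laws and the process `Φ'` as such normalised laws, and then compares generating
functionals.

* Determinantal identities. `tsum_lintegral_detWeight` says that
  `∑ m, (1 / m!) ∫ det C(y ∪ z) dz = det (1 + C) * det K(y)` if `C` and `K` have the same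
  eigenfunctions and eigenvalues `c` and `c / (1 + c)`. For finitely many eigenvalues the determinant
  is expanded over tuples of eigenfunctions, orthonormality leaves the principal minors of one
  bordered matrix `B`, and these sum up to `det (B + (0 ⊕ 1))`, which a Schur complement evaluates.
  The general case follows by monotone convergence, because the determinants increase with each
  added eigenfunction. Hence `detProcess R C` is a determinantal process with
  kernel `K` (`isDPP_detProcess`), and its density with respect to the Poisson process is
  proportional to `det C` (`hasDetDensity_detProcess`).

* Uniqueness. A finite simple point process whose factorial moment measures `M k` satisfy
  `∑ M k (univ) / k! < ∞` is determined by them: inclusion and exclusion expresses its Laplace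
  functional through the moments (`IsTestSystem.ext_of_momentMeasure`). Therefore the given process
  is `detProcess R C` (`IsDPP.eq_detProcess`). For uniqueness, Laplace functionals are only needed on
  sums of indicators from a countable family of sets; already these determine the law of a finite
  random measure (`IsTestSystem.ext_of_lintegral_laplaceTest`).

* Palm laws. Adding `y` to the configuration, `det C(y ∪ z) = det C(y) * det S(z)`, where
  `S = schurKernel C y` is the Schur complement. So the reduced Palm law at `y` is `detProcess R S`
  (`ae_reducedPalm_eq_detProcess`). That `det C(y) ≠ 0` for almost every `y` holds because the
  density `det K(y)` of the moment measure vanishes otherwise: a null vector of the matrix `C(y)` is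
  orthogonal to the values at `y` of each eigenfunction with positive eigenvalue, hence a null
  vector of `K(y)`.

* Spectral representation of `S`. If `C x z = ⟪v x, v z⟫` in a Hilbert space, `S` is obtained by
  projecting the vectors `v x` onto the orthogonal complement of the `v (y i)`. The projected
  vectors `Θ x` are given by a Hilbert-Schmidt operator `T` on `L²(R)` with `(T* w)(x) = ⟪Θ x, w⟫`.
  Its right singular vectors `f` are eigenfunctions of `S`, and where `T f ≠ 0` their versions
  `⟪Θ ·, T f⟫ / ‖T f‖ ^ 2`, which are defined at every point, make the expansion valid everywhere on
  `R` and not only almost everywhere (`HasSpectralRepresentation.exists_schurComplement`).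

* Marks and tilting. Integrating out the marks, the Laplace functional of a marked process at `f` is
  the generating functional of the points at `ψ(f)` (`IsRMLaw.lintegral_exp_neg`). The Laplace
  transform of the tilted mark law is `ψ(f + u) / ψ(u)`, and the factor `ψ(u)` per point is absorbed
  into the kernel since `∏ ψ(u) * det S = det (ψ(u) S)`. The quotient of Laplace functionals which
  defines the residual law is therefore that of the process with kernel `ψ(u) S` and tilted marks
  (`laplaceFunctional_tilt`).
-/

open scoped ComplexOrder

/-! ### Determinants: expansion over index tuples -/

/-- Every `k`-element subset is the range of exactly `k!` embeddings of `Fin k`. -/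
theorem sum_embedding_map_univ {α X : Type*} [Fintype α] [DecidableEq α] [AddCommMonoid X] (k : ℕ)
    (F : Finset α → X) :
    ∑ i : Fin k ↪ α, F (Finset.univ.map i) =
      k.factorial • ∑ s ∈ Finset.powersetCard k Finset.univ, F s := by
  classical
  have hmaps : ∀ i ∈ (Finset.univ : Finset (Fin k ↪ α)),
      Finset.univ.map i ∈ Finset.powersetCard k (Finset.univ : Finset α) := by
    intro i _
    simp [Finset.mem_powersetCard]
  rw [← Finset.sum_fiberwise_of_maps_to hmaps, Finset.smul_sum]
  refine Finset.sum_congr rfl fun s hs => ?_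
  have hs' : s.card = k := (Finset.mem_powersetCard.1 hs).2
  rw [Finset.sum_congr rfl (g := fun _ => F s)
    (fun i hi => by rw [(Finset.mem_filter.1 hi).2]), Finset.sum_const]
  congr 1
  let e : {i : Fin k ↪ α // Finset.univ.map i = s} ≃ (Fin k ≃ s) :=
    { toFun := fun i => Equiv.ofBijective
        (fun a => ⟨i.1 a, i.2.subset (Finset.mem_map_of_mem _ (Finset.mem_univ a))⟩)
        ⟨fun a b hab => i.1.injective (by simpa using hab), fun b => by
          have hb := i.2.symm.subset b.2
          obtain ⟨a, -, ha⟩ := Finset.mem_map.1 hb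
          exact ⟨a, Subtype.ext ha⟩⟩
      invFun := fun f => ⟨⟨fun a => (f a : α), fun a b hab => f.injective (Subtype.ext hab)⟩, by
        ext x
        constructor
        · intro hx
          obtain ⟨a, -, rfl⟩ := Finset.mem_map.1 hx
          exact (f a).2
        · intro hx
          exact Finset.mem_map.2 ⟨f.symm ⟨x, hx⟩, Finset.mem_univ _,
            congrArg Subtype.val (f.apply_symm_apply ⟨x, hx⟩)⟩⟩
      left_inv := fun i => by ext; rfl
      right_inv := fun f => by ext; rfl }
  rw [← Fintype.card_subtype, Fintype.card_congr e,
    Fintype.card_equiv (Fintype.equivOfCardEq (by simp [hs']))]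
  simp

/-- A sum over tuples which charges only injective tuples is a sum over embeddings. -/
theorem sum_eq_sum_embedding {ι α X : Type*} [Fintype ι] [DecidableEq ι] [Fintype α]
    [DecidableEq α] [AddCommMonoid X] (f : (ι → α) → X)
    (hf : ∀ h, ¬ Function.Injective h → f h = 0) : ∑ h, f h = ∑ i : ι ↪ α, f i := by
  classical
  rw [← Finset.sum_subset (Finset.subset_univ ((Finset.univ : Finset (ι ↪ α)).map
    ⟨fun i : ι ↪ α => (i : ι → α), fun i j h => (DFunLike.coe_injective h : i = j)⟩))
    (fun h _ hh => hf h fun hi => hh ?_),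
    Finset.sum_map]
  · rfl
  · exact Finset.mem_map.2 ⟨⟨h, hi⟩, Finset.mem_univ _, rfl⟩

/-- Multilinear expansion of a determinant some of whose rows are linear combinations. -/
theorem det_sum_elim_sum_rows {R κ ι N : Type*} [CommRing R] [Fintype κ] [DecidableEq κ]
    [Fintype ι] [DecidableEq ι] [Fintype N] (w₀ : κ → κ ⊕ ι → R) (p : ι → N → R)
    (w : N → κ ⊕ ι → R) :
    (Matrix.of (Sum.elim w₀ fun i => ∑ h, p i h • w h)).det =
      ∑ h : ι → N, (∏ i, p i (h i)) * (Matrix.of (Sum.elim w₀ fun i => w (h i))).det := by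
  classical
  let f := ((Matrix.detRowAlternating (R := R) (n := κ ⊕ ι)).toMultilinearMap).currySum w₀
  have h1 : ∀ v : ι → κ ⊕ ι → R, f v = (Matrix.of (Sum.elim w₀ v)).det := fun v => rfl
  rw [← h1, f.map_sum]
  refine Finset.sum_congr rfl fun h _ => ?_
  rw [f.map_smul_univ (fun i => p i (h i)) (fun i => w (h i)), h1, smul_eq_mul]

/-- Adding `1` to the diagonal of the lower right block expands the determinant over the principal
minors containing the upper left block, organised here by tuples instead of subsets. -/
theorem sum_tuples_det_submatrix_eq {κ N : Type*} [Fintype κ] [DecidableEq κ]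
    [Fintype N] [DecidableEq N] (M : Matrix (κ ⊕ N) (κ ⊕ N) ℂ) :
    (∀ m, Fintype.card N < m → ∑ h : Fin m → N,
      (M.submatrix (Sum.map id h) (Sum.map id h)).det = 0) ∧
    ∑ m ∈ Finset.range (Fintype.card N + 1), ((m.factorial : ℂ)⁻¹ * ∑ h : Fin m → N,
      (M.submatrix (Sum.map id h) (Sum.map id h)).det) =
      (M + Matrix.fromBlocks 0 0 0 1).det := by
  classical
  let F : Finset N → ℂ := fun S =>
    (M.submatrix (fun a : ↥((Finset.univ : Finset κ).disjSum S) => (a : κ ⊕ N))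
      (fun a : ↥((Finset.univ : Finset κ).disjSum S) => (a : κ ⊕ N))).det
  -- Tuples with a repetition contribute nothing.
  have hinj : ∀ m, ∑ h : Fin m → N, (M.submatrix (Sum.map id h) (Sum.map id h)).det =
      ∑ i : Fin m ↪ N, (M.submatrix (Sum.map id i) (Sum.map id i)).det := by
    intro m
    refine sum_eq_sum_embedding _ fun h hh => ?_
    simp only [Function.Injective, not_forall] at hh
    obtain ⟨a, b, hab, hne⟩ := hh
    exact Matrix.det_zero_of_row_eq (i := Sum.inr a) (j := Sum.inr b) (by simpa using hne)
      (by ext j; simp [hab])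
  have hF : ∀ m (i : Fin m ↪ N),
      (M.submatrix (Sum.map id i) (Sum.map id i)).det = F (Finset.univ.map i) := by
    intro m i
    let e : κ ⊕ Fin m ≃ ↥((Finset.univ : Finset κ).disjSum (Finset.univ.map i)) :=
      Equiv.ofBijective (fun a => ⟨Sum.map id i a, by cases a <;> simp⟩) ⟨by
        intro a b hab
        have := Subtype.ext_iff.1 hab
        exact (Sum.map_injective.2 ⟨Function.injective_id, i.injective⟩) this, by
        rintro ⟨a | a, ha⟩
        · exact ⟨Sum.inl a, rfl⟩
        · simp only [Finset.inr_mem_disjSum, Finset.mem_map, Finset.mem_univ, true_and] at ha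
          obtain ⟨b, rfl⟩ := ha
          exact ⟨Sum.inr b, rfl⟩⟩
    exact Matrix.det_submatrix_equiv_self e
      (M.submatrix (fun a : ↥((Finset.univ : Finset κ).disjSum (Finset.univ.map i)) => (a : κ ⊕ N))
        (fun a : ↥((Finset.univ : Finset κ).disjSum (Finset.univ.map i)) => (a : κ ⊕ N)))
  have hsum : ∀ m, ∑ h : Fin m → N, (M.submatrix (Sum.map id h) (Sum.map id h)).det =
      m.factorial • ∑ s ∈ Finset.powersetCard m Finset.univ, F s := by
    intro m
    rw [hinj, Finset.sum_congr rfl fun i _ => hF m i, sum_embedding_map_univ]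
  refine ⟨fun m hm => ?_, ?_⟩
  · rw [hsum, Finset.powersetCard_eq_empty.2 (by simpa using hm)]
    simp
  have hdet : (M + Matrix.fromBlocks 0 0 0 1).det = ∑ S : Finset N, F S := by
    let D : Matrix (κ ⊕ N) (κ ⊕ N) ℂ := Matrix.fromBlocks 0 0 0 1
    have h1 : (M + D).det = ∑ T : Finset (κ ⊕ N),
        Matrix.det (Matrix.of (T.piecewise (fun i => M.row i) (fun i => D.row i))) :=
      (Matrix.detRowAlternating (R := ℂ) (n := κ ⊕ N)).toMultilinearMap.map_add_univ M D
    change (M + D).det = _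
    rw [h1]
    have h2 : ∀ T ∉ (Finset.univ : Finset (Finset N)).map
        ⟨fun S => (Finset.univ : Finset κ).disjSum S,
          fun S S' h => by simpa using congrArg Finset.toRight h⟩,
        Matrix.det (Matrix.of (T.piecewise (fun i => M.row i) (fun i => D.row i))) = 0 := by
      intro T hT
      by_cases hκ : ∀ a : κ, Sum.inl a ∈ T
      · refine absurd (Finset.mem_map.2 ⟨T.toRight, Finset.mem_univ _, ?_⟩) hT
        refine Finset.ext fun a => ?_
        change a ∈ (Finset.univ : Finset κ).disjSum T.toRight ↔ a ∈ T
        rcases a with a | a <;> simp [hκ]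
      · push Not at hκ
        obtain ⟨a, ha⟩ := hκ
        refine Matrix.det_eq_zero_of_row_eq_zero (Sum.inl a) fun j => ?_
        simp only [Matrix.of_apply, Finset.piecewise, if_neg ha]
        cases j <;> simp [D, Matrix.row]
    rw [← Finset.sum_subset (Finset.subset_univ _) fun T _ hT => h2 T hT, Finset.sum_map]
    refine Finset.sum_congr rfl fun S _ => ?_
    change Matrix.det (Matrix.of (((Finset.univ : Finset κ).disjSum S).piecewise
      (fun i => M.row i) (fun i => D.row i))) = F S
    refine Eq.trans ?_ (Matrix.det_piecewise_one_eq_submatrix_det M _)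
    congr 1
    ext i j
    have hD : ∀ i : N, D.row (Sum.inr i) = (1 : Matrix (κ ⊕ N) (κ ⊕ N) ℂ).row (Sum.inr i) := by
      intro i
      ext j
      cases j <;> simp [D, Matrix.row, Matrix.one_apply]
    rcases i with i | i
    · simp only [Matrix.of_apply, Finset.piecewise, Finset.inl_mem_disjSum, Finset.mem_univ,
        if_true]
    · simp only [Matrix.of_apply, Finset.piecewise, hD]
  rw [hdet, ← Finset.sum_fiberwise_of_maps_to (s := (Finset.univ : Finset (Finset N)))
    (t := Finset.range (Fintype.card N + 1)) (g := Finset.card)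
    (fun S _ => by simpa [Nat.lt_succ_iff] using S.card_le_univ)]
  refine Finset.sum_congr rfl fun m _ => ?_
  have hm : (Finset.univ.filter fun S : Finset N => S.card = m) =
      Finset.powersetCard m Finset.univ := by
    ext S; simp [Finset.mem_powersetCard]
  rw [hsum, nsmul_eq_mul, inv_mul_cancel_left₀ (Nat.cast_ne_zero.2 m.factorial_ne_zero), hm]

/-- Expansion of the determinant of `(1 ⊕ p) M (1 ⊕ r)`, where `p` and `r` are rectangular. -/
theorem det_fromBlocks_mul_mul_eq_sum {κ ι N : Type*} [Fintype κ] [DecidableEq κ]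
    [Fintype ι] [DecidableEq ι] [Fintype N] [DecidableEq N] (M : Matrix (κ ⊕ N) (κ ⊕ N) ℂ)
    (p : Matrix ι N ℂ) (r : Matrix N ι ℂ) :
    (Matrix.fromBlocks (1 : Matrix κ κ ℂ) 0 0 p * M *
      Matrix.fromBlocks (1 : Matrix κ κ ℂ) 0 0 r).det =
      ∑ h : ι → N, ∑ l : ι → N, (∏ i, p i (h i) * r (l i) i) *
        (M.submatrix (Sum.map id h) (Sum.map id l)).det := by
  have hrow : ∀ A : Matrix (κ ⊕ N) (κ ⊕ ι) ℂ,
      (Matrix.fromBlocks (1 : Matrix κ κ ℂ) 0 0 p * A).det =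
        ∑ h : ι → N, (∏ i, p i (h i)) * (A.submatrix (Sum.map id h) id).det := by
    intro A
    have h1 : (Matrix.fromBlocks (1 : Matrix κ κ ℂ) 0 0 p * A) =
        Matrix.of (Sum.elim (fun a => fun b => A (Sum.inl a) b)
          fun i => ∑ h, p i h • fun b => A (Sum.inr h) b) := by
      ext i j
      rcases i with i | i
      · simp [Matrix.mul_apply, Fintype.sum_sum_type, Matrix.one_apply]
      · simp [Matrix.mul_apply, Fintype.sum_sum_type]
    rw [h1]
    refine (det_sum_elim_sum_rows (fun a b => A (Sum.inl a) b) p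
      (fun h b => A (Sum.inr h) b)).trans ?_
    refine Finset.sum_congr rfl fun h _ => ?_
    congr 2
    ext i j
    rcases i with i | i <;> rfl
  have hcol : ∀ A : Matrix (κ ⊕ ι) (κ ⊕ N) ℂ,
      (A * Matrix.fromBlocks (1 : Matrix κ κ ℂ) 0 0 r).det =
        ∑ l : ι → N, (∏ i, r (l i) i) * (A.submatrix id (Sum.map id l)).det := by
    intro A
    have h1 : ∀ l : ι → N, (A.submatrix id (Sum.map id l)).det =
        (Matrix.of (Sum.elim (fun a => fun b => A b (Sum.inl a))
          fun i => fun b => A b (Sum.inr (l i)))).det := by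
      intro l
      rw [← Matrix.det_transpose]
      congr 1
      ext i j
      rcases i with i | i <;> rfl
    rw [← Matrix.det_transpose]
    have h2 : ((A * Matrix.fromBlocks (1 : Matrix κ κ ℂ) 0 0 r).transpose) =
        Matrix.of (Sum.elim (fun a => fun b => A b (Sum.inl a))
          fun i => ∑ l, r l i • fun b => A b (Sum.inr l)) := by
      ext i j
      rcases i with i | i
      · simp [Matrix.mul_apply, Fintype.sum_sum_type, Matrix.one_apply]
      · simp [Matrix.mul_apply, Fintype.sum_sum_type, mul_comm]
    rw [h2, det_sum_elim_sum_rows (p := fun i l => r l i) (w := fun l b => A b (Sum.inr l))]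
    exact Finset.sum_congr rfl fun l _ => by rw [h1]
  rw [Matrix.mul_assoc, hrow]
  refine Finset.sum_congr rfl fun h _ => ?_
  have h3 : (M * Matrix.fromBlocks (1 : Matrix κ κ ℂ) 0 0 r).submatrix (Sum.map id h) id =
      M.submatrix (Sum.map id h) id * Matrix.fromBlocks (1 : Matrix κ κ ℂ) 0 0 r := by
    ext i j
    simp [Matrix.mul_apply]
  rw [h3, hcol, Finset.mul_sum]
  refine Finset.sum_congr rfl fun l _ => ?_
  rw [Finset.prod_mul_distrib, mul_assoc]
  rfl

/-! ### Finite rank kernels -/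

/-- The matrix `[C (x i) (x j)]` for a family of points indexed by an arbitrary type. -/
def gram {E ι : Type*} (C : E → E → ℂ) (x : ι → E) : Matrix ι ι ℂ :=
  Matrix.of fun i j => C (x i) (x j)

/-- The finite rank kernel `∑ h, c h * φ h x * conj (φ h y)`. -/
def finKernel {E N : Type*} [Fintype N] (c : N → ℝ) (φ : N → E → ℂ) (x y : E) : ℂ :=
  ∑ h, (c h : ℂ) * φ h x * conj (φ h y)

theorem gram_finKernel_posSemidef {E N ι : Type*} [Fintype N] [Fintype ι] {c : N → ℝ}
    (hc : ∀ h, 0 ≤ c h) (φ : N → E → ℂ) (x : ι → E) :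
    (gram (finKernel c φ) x).PosSemidef := by
  have : gram (finKernel c φ) x =
      (Matrix.of fun i h => (Real.sqrt (c h) : ℂ) * φ h (x i)) *
        (Matrix.of fun i h => (Real.sqrt (c h) : ℂ) * φ h (x i)).conjTranspose := by
    ext i j
    simp only [gram, finKernel, Matrix.of_apply, Matrix.mul_apply, Matrix.conjTranspose_apply,
      star_mul', Complex.star_def, Complex.conj_ofReal]
    refine Finset.sum_congr rfl fun h _ => ?_
    have : (c h : ℂ) = (Real.sqrt (c h) : ℂ) * (Real.sqrt (c h) : ℂ) := by
      rw [← Complex.ofReal_mul, Real.mul_self_sqrt (hc h)]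
    rw [this]
    ring
  rw [this]
  exact Matrix.posSemidef_self_mul_conjTranspose _

section FiniteRank

variable {E N κ : Type*} [Fintype N] [DecidableEq N] [Fintype κ] [DecidableEq κ]

/-- The matrix `[[Φ c Φ*, Φ c], [c Φ*, c]]`, with `Φ = [φ h (y i)]`. -/
def borderedMatrix (c : N → ℝ) (φ : N → E → ℂ) (y : κ → E) : Matrix (κ ⊕ N) (κ ⊕ N) ℂ :=
  Matrix.fromBlocks (gram (finKernel c φ) y) (Matrix.of fun i h => φ h (y i) * c h)
    (Matrix.of fun h i => c h * conj (φ h (y i))) (Matrix.diagonal fun h => (c h : ℂ))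

/-- The Gram matrix of a finite rank kernel at the points `y` and `z` factors through the bordered
matrix of `y`, which does not depend on `z`. -/
theorem gram_finKernel_sumElim {ι : Type*} [Fintype ι] [DecidableEq ι] (c : N → ℝ)
    (φ : N → E → ℂ) (y : κ → E) (z : ι → E) :
    gram (finKernel c φ) (Sum.elim y z) =
      Matrix.fromBlocks (1 : Matrix κ κ ℂ) 0 0 (Matrix.of fun i h => φ h (z i)) *
        borderedMatrix c φ y *
        Matrix.fromBlocks (1 : Matrix κ κ ℂ) 0 0 (Matrix.of fun h i => conj (φ h (z i))) := by
  rw [borderedMatrix, Matrix.fromBlocks_multiply, Matrix.fromBlocks_multiply]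
  simp only [Matrix.one_mul, Matrix.zero_mul, add_zero, zero_add, Matrix.mul_zero, Matrix.mul_one]
  ext i j
  rcases i with i | i <;> rcases j with j | j
  · simp [gram]
  · simp only [gram, finKernel, Matrix.of_apply, Sum.elim_inl, Sum.elim_inr,
      Matrix.fromBlocks_apply₁₂, Matrix.mul_apply]
    exact Finset.sum_congr rfl fun h _ => by ring
  · simp only [gram, finKernel, Matrix.of_apply, Sum.elim_inl, Sum.elim_inr,
      Matrix.fromBlocks_apply₂₁, Matrix.mul_apply]
    exact Finset.sum_congr rfl fun h _ => by ring
  · simp only [gram, finKernel, Matrix.of_apply, Sum.elim_inr,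
      Matrix.fromBlocks_apply₂₂, Matrix.mul_apply, Matrix.diagonal_apply, mul_ite, mul_zero,
      Finset.sum_ite_eq', Finset.mem_univ, if_true]
    exact Finset.sum_congr rfl fun h _ => by ring

/-- The Schur complement with respect to the diagonal block `1 + c` replaces the eigenvalues `c h` by
`c h - c h ^ 2 / (1 + c h) = c h / (1 + c h)`. -/
theorem det_borderedMatrix_add {c : N → ℝ} (hc : ∀ h, 0 ≤ c h) (φ : N → E → ℂ) (y : κ → E) :
    (borderedMatrix c φ y + Matrix.fromBlocks 0 0 0 1).det =
      (∏ h, (1 + c h : ℂ)) * (gram (finKernel (fun h => c h / (1 + c h)) φ) y).det := by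
  have hne : ∀ h, (1 + c h : ℂ) ≠ 0 := fun h => by
    have := hc h
    exact_mod_cast (by positivity : (1 + c h : ℝ) ≠ 0)
  let D : Matrix N N ℂ := Matrix.diagonal fun h => 1 + (c h : ℂ)
  have hD : borderedMatrix c φ y + Matrix.fromBlocks 0 0 0 1 =
      Matrix.fromBlocks (gram (finKernel c φ) y) (Matrix.of fun i h => φ h (y i) * c h)
        (Matrix.of fun h i => c h * conj (φ h (y i))) D := by
    rw [borderedMatrix, Matrix.fromBlocks_add]
    simp only [add_zero]
    congr 1
    rw [← Matrix.diagonal_one, Matrix.diagonal_add]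
    congr 1
    ext h
    ring
  have hDdet : D.det = ∏ h, (1 + c h : ℂ) := Matrix.det_diagonal
  have hDinv : D⁻¹ = Matrix.diagonal fun h => (1 + (c h : ℂ))⁻¹ := by
    refine Matrix.inv_eq_right_inv ?_
    rw [Matrix.diagonal_mul_diagonal, ← Matrix.diagonal_one]
    congr 1
    ext h
    exact mul_inv_cancel₀ (hne h)
  have : Invertible D := Matrix.invertibleOfIsUnitDet D (by
    rw [hDdet]
    exact IsUnit.mk0 _ (Finset.prod_ne_zero_iff.2 fun h _ => hne h))
  rw [hD, Matrix.det_fromBlocks₂₂, hDdet, Matrix.invOf_eq_nonsing_inv, hDinv]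
  congr 2
  ext i j
  simp only [gram, finKernel, Matrix.sub_apply, Matrix.of_apply, Matrix.mul_apply,
    Matrix.diagonal_apply, mul_ite, mul_zero, Finset.sum_ite_eq', Finset.mem_univ, if_true]
  rw [← Finset.sum_sub_distrib]
  refine Finset.sum_congr rfl fun h _ => ?_
  have := hne h
  push_cast
  field_simp
  ring

variable [MeasurableSpace E] {ω : Measure E} [SigmaFinite ω]

/-- Integrating out the points `z`: orthonormality of the `φ h` leaves only the diagonal terms of the
expansion of the determinant. -/
theorem integral_det_gram_finKernel (c : N → ℝ) {φ : N → E → ℂ}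
    (hφ : ∀ h, MemLp (φ h) 2 ω)
    (horth : ∀ h l, ∫ z, φ h z * conj (φ l z) ∂ω = if h = l then 1 else 0) (y : κ → E) (m : ℕ) :
    Integrable (fun z : Fin m → E => (gram (finKernel c φ) (Sum.elim y z)).det)
        (Measure.pi fun _ => ω) ∧
      ∫ z : Fin m → E, (gram (finKernel c φ) (Sum.elim y z)).det ∂(Measure.pi fun _ => ω) =
        ∑ h : Fin m → N, ((borderedMatrix c φ y).submatrix (Sum.map id h) (Sum.map id h)).det := by
  have hexp : ∀ z : Fin m → E, (gram (finKernel c φ) (Sum.elim y z)).det =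
      ∑ h : Fin m → N, ∑ l : Fin m → N, (∏ i, φ (h i) (z i) * conj (φ (l i) (z i))) *
        ((borderedMatrix c φ y).submatrix (Sum.map id h) (Sum.map id l)).det := fun z => by
    rw [gram_finKernel_sumElim, det_fromBlocks_mul_mul_eq_sum]
    rfl
  have hint : ∀ h l : N, Integrable (fun z => φ h z * conj (φ l z)) ω := fun h l =>
    (hφ h).integrable_mul (hφ l).star
  have hint' : ∀ h l : Fin m → N, Integrable (fun z : Fin m → E =>
      (∏ i, φ (h i) (z i) * conj (φ (l i) (z i))) *
        ((borderedMatrix c φ y).submatrix (Sum.map id h) (Sum.map id l)).det)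
      (Measure.pi fun _ => ω) := fun h l =>
    (Integrable.fintype_prod (μ := fun _ => ω)
      (f := fun i z => φ (h i) z * conj (φ (l i) z)) fun i => hint (h i) (l i)).mul_const _
  simp_rw [hexp]
  refine ⟨integrable_finsetSum _ fun h _ => integrable_finsetSum _ fun l _ => hint' h l, ?_⟩
  rw [integral_finsetSum _ fun h _ => integrable_finsetSum _ fun l _ => hint' h l]
  refine Finset.sum_congr rfl fun h _ => ?_
  rw [integral_finsetSum _ fun l _ => hint' h l, Finset.sum_eq_single h]
  · rw [integral_mul_const, integral_fintype_prod_eq_prod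
      (f := fun i z => φ (h i) z * conj (φ (h i) z))]
    simp [horth]
  · intro l _ hl
    obtain ⟨i, hi⟩ := Function.ne_iff.1 hl
    rw [integral_mul_const, integral_fintype_prod_eq_prod
      (f := fun i z => φ (h i) z * conj (φ (l i) z)),
      Finset.prod_eq_zero (Finset.mem_univ i) (by rw [horth, if_neg (Ne.symm hi)]), zero_mul]
  · simp

end FiniteRank

/-! ### The Fredholm expansion -/

/-- Adding a rank one positive matrix does not decrease the determinant of a positive matrix. -/
theorem Matrix.PosSemidef.det_le_det_add_vecMulVec {ι : Type*} [Fintype ι] [DecidableEq ι]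
    {A : Matrix ι ι ℂ} (hA : A.PosSemidef) (v : ι → ℂ) :
    A.det ≤ (A + Matrix.vecMulVec v (star v)).det := by
  have hB : (Matrix.vecMulVec v (star v)).PosSemidef := Matrix.posSemidef_vecMulVec_self_star v
  by_cases h0 : A.det = 0
  · rw [h0]
    exact (hA.add hB).det_nonneg
  · have hu : IsUnit A.det := IsUnit.mk0 _ h0
    have hv : Matrix.vecMulVec v (star v) =
        Matrix.replicateCol Unit v * (Matrix.replicateCol Unit v).conjTranspose := by
      ext i j
      simp [Matrix.vecMulVec_apply, Matrix.mul_apply]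
    rw [hv, Matrix.det_add_mul _ _ hu]
    have h1 : (1 : ℂ) ≤ (1 + (Matrix.replicateCol Unit v).conjTranspose * A⁻¹ *
        Matrix.replicateCol Unit v).det := by
      rw [Matrix.det_unique, Matrix.add_apply, Matrix.one_apply_eq]
      have := (hA.inv.conjTranspose_mul_mul_same (Matrix.replicateCol Unit v)).diag_nonneg
        (i := default)
      exact le_add_of_nonneg_right this
    calc A.det = A.det * 1 := (mul_one _).symm
      _ ≤ _ := mul_le_mul_of_nonneg_left h1 hA.det_nonneg

/-- The determinant of `[C (x i) (x j)]` as an extended nonnegative real (it is used for positive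
semidefinite kernels, where it is a nonnegative real number). -/
noncomputable def detWeight {E ι : Type*} [Fintype ι] [DecidableEq ι] (C : E → E → ℂ)
    (x : ι → E) : ℝ≥0∞ :=
  ENNReal.ofReal (gram C x).det.re

theorem detWeight_comp_equiv {E ι κ : Type*} [Fintype ι] [DecidableEq ι] [Fintype κ]
    [DecidableEq κ] (C : E → E → ℂ) (x : ι → E) (e : κ ≃ ι) :
    detWeight C (x ∘ e) = detWeight C x := by
  rw [detWeight, detWeight, ← Matrix.det_submatrix_equiv_self e (gram C x)]
  rfl

theorem detWeight_eq_zero_of_not_injective {E ι : Type*} [Fintype ι] [DecidableEq ι]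
    (C : E → E → ℂ) (x : ι → E) (hx : ¬ Function.Injective x) : detWeight C x = 0 := by
  simp only [Function.Injective, not_forall] at hx
  obtain ⟨a, b, hab, hne⟩ := hx
  rw [detWeight, Matrix.det_zero_of_row_eq hne (by ext j; simp [gram, hab])]
  simp

theorem detWeight_congr {E ι : Type*} [Fintype ι] [DecidableEq ι] {C C' : E → E → ℂ}
    {x : ι → E} (h : ∀ i j, C (x i) (x j) = C' (x i) (x j)) : detWeight C x = detWeight C' x := by
  have : gram C x = gram C' x := by ext i j; exact h i j
  rw [detWeight, this, detWeight]

/-- `C` is the kernel `∑ h, c h * φ h x * conj (φ h y)`, the series converging for all `x` and `y`,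
with `c h ≥ 0`, `∑ h, c h < ∞` and `(φ h)` orthonormal in `L²(ω)`. -/
structure IsMercerKernel {E : Type*} [MeasurableSpace E] (ω : Measure E) (C : E → E → ℂ)
    (c : ℕ → ℝ) (φ : ℕ → E → ℂ) : Prop where
  measurable : ∀ h, Measurable (φ h)
  memLp : ∀ h, MemLp (φ h) 2 ω
  orthonormal : ∀ h l, ∫ z, φ h z * conj (φ l z) ∂ω = if h = l then 1 else 0
  nonneg : ∀ h, 0 ≤ c h
  summable : Summable c
  hasSum : ∀ x y, HasSum (fun h => (c h : ℂ) * φ h x * conj (φ h y)) (C x y)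

/-- The total mass `∑ n, 1 / n! * ∫ det [C (x i) (x j)] dω^n`: the Fredholm determinant
of `1 + C`. -/
noncomputable def fredholmDet {E : Type*} [MeasurableSpace E] (ω : Measure E)
    (C : E → E → ℂ) : ℝ≥0∞ :=
  ∑' n : ℕ, (n.factorial : ℝ≥0∞)⁻¹ * ∫⁻ x : Fin n → E, detWeight C x ∂(Measure.pi fun _ => ω)

/-- Truncation of the series of a kernel. -/
noncomputable def truncKernel {E : Type*} (c : ℕ → ℝ) (φ : ℕ → E → ℂ) (n : ℕ) : E → E → ℂ :=
  finKernel (fun h : Fin n => c h) fun h => φ h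

section

variable {E : Type*} {c : ℕ → ℝ} {φ : ℕ → E → ℂ}

theorem truncKernel_apply (n : ℕ) (x y : E) :
    truncKernel c φ n x y = ∑ h ∈ Finset.range n, (c h : ℂ) * φ h x * conj (φ h y) := by
  rw [truncKernel, finKernel, Fin.sum_univ_eq_sum_range
    (fun h => (c h : ℂ) * φ h x * conj (φ h y))]

theorem monotone_detWeight_truncKernel {ι : Type*} [Fintype ι] [DecidableEq ι]
    (hc : ∀ h, 0 ≤ c h) (x : ι → E) : Monotone fun n => detWeight (truncKernel c φ n) x := by
  refine monotone_nat_of_le_succ fun n => ENNReal.ofReal_le_ofReal ?_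
  have h1 : gram (truncKernel c φ (n + 1)) x = gram (truncKernel c φ n) x +
      Matrix.vecMulVec (fun i => (Real.sqrt (c n) : ℂ) * φ n (x i))
        (star fun i => (Real.sqrt (c n) : ℂ) * φ n (x i)) := by
    ext i j
    have : (c n : ℂ) = (Real.sqrt (c n) : ℂ) * (Real.sqrt (c n) : ℂ) := by
      rw [← Complex.ofReal_mul, Real.mul_self_sqrt (hc n)]
    simp only [gram, Matrix.of_apply, Matrix.add_apply, truncKernel_apply, Finset.sum_range_succ,
      Matrix.vecMulVec_apply, Pi.star_apply, star_mul', Complex.star_def, Complex.conj_ofReal]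
    congr 1
    conv_lhs => rw [this]
    ring
  rw [h1]
  have := (gram_finKernel_posSemidef (fun h : Fin n => hc h) (fun h : Fin n => φ h)
    x).det_le_det_add_vecMulVec (fun i => (Real.sqrt (c n) : ℂ) * φ n (x i))
  exact (Complex.le_def.1 this).1

theorem tendsto_det_gram_truncKernel {ι : Type*} [Fintype ι] [DecidableEq ι] {C : E → E → ℂ}
    (x : ι → E)
    (hC : ∀ i j, HasSum (fun h => (c h : ℂ) * φ h (x i) * conj (φ h (x j))) (C (x i) (x j))) :
    Filter.Tendsto (fun n => (gram (truncKernel c φ n) x).det) Filter.atTop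
      (nhds (gram C x).det) := by
  have h1 : Filter.Tendsto (fun n => gram (truncKernel c φ n) x) Filter.atTop
      (nhds (gram C x)) := by
    refine tendsto_pi_nhds.2 fun i => tendsto_pi_nhds.2 fun j => ?_
    simp only [gram, Matrix.of_apply, truncKernel_apply]
    exact (hC i j).tendsto_sum_nat
  exact ((continuous_id.matrix_det).tendsto (gram C x)).comp h1

theorem tendsto_detWeight_truncKernel {ι : Type*} [Fintype ι] [DecidableEq ι] {C : E → E → ℂ}
    (x : ι → E)
    (hC : ∀ i j, HasSum (fun h => (c h : ℂ) * φ h (x i) * conj (φ h (x j))) (C (x i) (x j))) :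
    Filter.Tendsto (fun n => detWeight (truncKernel c φ n) x) Filter.atTop
      (nhds (detWeight C x)) :=
  (ENNReal.continuous_ofReal.tendsto _).comp
    ((Complex.continuous_re.tendsto _).comp (tendsto_det_gram_truncKernel x hC))

theorem det_gram_nonneg {ι : Type*} [Fintype ι] [DecidableEq ι] {C : E → E → ℂ}
    (hc : ∀ h, 0 ≤ c h) (x : ι → E)
    (hC : ∀ i j, HasSum (fun h => (c h : ℂ) * φ h (x i) * conj (φ h (x j))) (C (x i) (x j))) :
    0 ≤ (gram C x).det :=
  ge_of_tendsto' (tendsto_det_gram_truncKernel x hC) fun n =>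
    (gram_finKernel_posSemidef (fun h : Fin n => hc h) (fun h : Fin n => φ h) x).det_nonneg

theorem tendsto_tsum_lintegral_of_monotone {X : ℕ → Type*}
    [∀ m, MeasurableSpace (X m)] (μ : ∀ m, Measure (X m)) (a : ℕ → ℝ≥0∞)
    (ha : ∀ m, a m ≠ ∞)
    {F : ℕ → ∀ m, X m → ℝ≥0∞} {G : ∀ m, X m → ℝ≥0∞} (hF : ∀ n m, AEMeasurable (F n m) (μ m))
    (hmono : ∀ m x, Monotone fun n => F n m x)
    (hlim : ∀ m x, Filter.Tendsto (fun n => F n m x) Filter.atTop (nhds (G m x))) :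
    Filter.Tendsto (fun n => ∑' m, a m * ∫⁻ x, F n m x ∂(μ m)) Filter.atTop
      (nhds (∑' m, a m * ∫⁻ x, G m x ∂(μ m))) := by
  simp_rw [← lintegral_count]
  refine lintegral_tendsto_of_tendsto_of_monotone (fun n => (measurable_of_countable _).aemeasurable)
    (Filter.Eventually.of_forall fun m i j hij => by
      exact mul_le_mul_right (lintegral_mono fun x => hmono m x hij) _)
    (Filter.Eventually.of_forall fun m => ?_)
  exact ENNReal.Tendsto.const_mul (lintegral_tendsto_of_tendsto_of_monotone (fun n => hF n m)
    (Filter.Eventually.of_forall (hmono m)) (Filter.Eventually.of_forall (hlim m)))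
    (Or.inr (ha m))

variable [MeasurableSpace E] {ω : Measure E} {C : E → E → ℂ}

theorem measurable_truncKernel (hφ : ∀ h, Measurable (φ h)) (n : ℕ) :
    Measurable fun p : E × E => truncKernel c φ n p.1 p.2 := by
  simp_rw [truncKernel_apply]
  refine Finset.measurable_fun_sum _ fun h _ => ?_
  have h1 : Measurable fun p : E × E => φ h p.1 := (hφ h).comp measurable_fst
  have h2 : Measurable fun p : E × E => conj (φ h p.2) :=
    Complex.continuous_conj.measurable.comp ((hφ h).comp measurable_snd)
  exact (measurable_const.mul h1).mul h2

theorem IsMercerKernel.measurable_kernel (hC : IsMercerKernel ω C c φ) :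
    Measurable fun p : E × E => C p.1 p.2 := by
  refine measurable_of_tendsto_metrizable (measurable_truncKernel (c := c) hC.measurable)
    (tendsto_pi_nhds.2 fun p => ?_)
  simp_rw [truncKernel_apply]
  exact (hC.hasSum p.1 p.2).tendsto_sum_nat

theorem measurable_detWeight {ι : Type*} [Fintype ι] [DecidableEq ι]
    (hC : Measurable fun p : E × E => C p.1 p.2) :
    Measurable fun x : ι → E => detWeight C x := by
  refine ENNReal.measurable_ofReal.comp (Complex.measurable_re.comp ?_)
  simp_rw [Matrix.det_apply]
  refine Finset.measurable_fun_sum _ fun σ _ => Measurable.const_smul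
    (Finset.measurable_fun_prod _ fun i _ => ?_) _
  have h1 : Measurable fun x : ι → E => (x (σ i), x i) :=
    (measurable_pi_apply (σ i)).prodMk (measurable_pi_apply i)
  exact hC.comp h1

variable [SigmaFinite ω]

/-- The Fredholm expansion for a finite rank kernel. -/
theorem tsum_lintegral_detWeight_truncKernel {κ : Type*} [Fintype κ] [DecidableEq κ]
    (hC : IsMercerKernel ω C c φ) (n : ℕ) (y : κ → E) :
    ∑' m : ℕ, (m.factorial : ℝ≥0∞)⁻¹ * ∫⁻ z : Fin m → E,
      detWeight (truncKernel c φ n) (Sum.elim y z) ∂(Measure.pi fun _ => ω) =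
    ENNReal.ofReal (∏ h ∈ Finset.range n, (1 + c h)) *
      detWeight (truncKernel (fun h => c h / (1 + c h)) φ n) y := by
  let A : ℕ → ℂ := fun m => ∑ h : Fin m → Fin n,
    ((borderedMatrix (fun h : Fin n => c h) (fun h : Fin n => φ h) y).submatrix
      (Sum.map id h) (Sum.map id h)).det
  have horth : ∀ h l : Fin n, ∫ z, φ h z * conj (φ l z) ∂ω = if h = l then 1 else 0 := by
    intro h l
    simp only [hC.orthonormal, Fin.ext_iff]
  have hpos : ∀ m (z : Fin m → E), 0 ≤ (gram (truncKernel c φ n) (Sum.elim y z)).det :=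
    fun m z => (gram_finKernel_posSemidef (fun h : Fin n => hC.nonneg h) (fun h : Fin n => φ h)
      (Sum.elim y z)).det_nonneg
  have hA : ∀ m, 0 ≤ (A m).re ∧ ∫⁻ z : Fin m → E,
      detWeight (truncKernel c φ n) (Sum.elim y z) ∂(Measure.pi fun _ => ω) =
      ENNReal.ofReal (A m).re := by
    intro m
    obtain ⟨h1, h2⟩ := integral_det_gram_finKernel (fun h : Fin n => c h)
      (fun h : Fin n => hC.memLp h) horth y m
    have h3 : (A m).re = ∫ z : Fin m → E, (gram (truncKernel c φ n) (Sum.elim y z)).det.re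
        ∂(Measure.pi fun _ => ω) := by
      change (∑ h : Fin m → Fin n, _ : ℂ).re = _
      rw [← h2]
      exact (integral_re h1).symm
    refine ⟨?_, ?_⟩
    · rw [h3]
      exact integral_nonneg fun z => (Complex.le_def.1 (hpos m z)).1
    · rw [h3, ofReal_integral_eq_lintegral_ofReal
        (f := fun z : Fin m → E => (gram (truncKernel c φ n) (Sum.elim y z)).det.re) h1.re
        (Filter.Eventually.of_forall fun z => (Complex.le_def.1 (hpos m z)).1)]
      rfl
  obtain ⟨hvan, hsum⟩ := sum_tuples_det_submatrix_eq
    (borderedMatrix (fun h : Fin n => c h) (fun h : Fin n => φ h) y)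
  rw [det_borderedMatrix_add fun h : Fin n => hC.nonneg h, Fintype.card_fin] at hsum
  rw [Fintype.card_fin] at hvan
  have hterm : ∀ m, (m.factorial : ℝ≥0∞)⁻¹ * ENNReal.ofReal (A m).re =
      ENNReal.ofReal ((m.factorial : ℝ)⁻¹ * (A m).re) := by
    intro m
    rw [ENNReal.ofReal_mul (by positivity), ENNReal.ofReal_inv_of_pos (by positivity),
      ENNReal.ofReal_natCast]
  simp_rw [fun m => (hA m).2, hterm]
  rw [tsum_eq_sum (s := Finset.range (n + 1)) (fun m hm => by
    have : A m = 0 := hvan m (by simpa [Nat.lt_succ_iff] using hm)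
    simp [this]), ← ENNReal.ofReal_sum_of_nonneg fun m _ =>
      mul_nonneg (by positivity) (hA m).1, detWeight, ← ENNReal.ofReal_mul
      (Finset.prod_nonneg fun h _ => add_nonneg zero_le_one (hC.nonneg h))]
  congr 1
  have h4 : (∑ m ∈ Finset.range (n + 1), ((m.factorial : ℂ)⁻¹ * A m)).re =
      ∑ m ∈ Finset.range (n + 1), (m.factorial : ℝ)⁻¹ * (A m).re := by
    rw [Complex.re_sum]
    refine Finset.sum_congr rfl fun m _ => ?_
    rw [← Complex.re_ofReal_mul]
    push_cast
    rfl
  rw [← h4]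
  change (∑ m ∈ Finset.range (n + 1), ((m.factorial : ℂ)⁻¹ * _)).re = _
  rw [hsum, ← Complex.re_ofReal_mul, Finset.prod_range]
  push_cast
  rfl

theorem tendsto_fredholm_trunc {κ : Type*} [Fintype κ] [DecidableEq κ]
    (hC : IsMercerKernel ω C c φ) (y : κ → E) :
    Filter.Tendsto (fun n => ENNReal.ofReal (∏ h ∈ Finset.range n, (1 + c h)) *
      detWeight (truncKernel (fun h => c h / (1 + c h)) φ n) y) Filter.atTop
      (nhds (∑' m : ℕ, (m.factorial : ℝ≥0∞)⁻¹ * ∫⁻ z : Fin m → E,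
        detWeight C (Sum.elim y z) ∂(Measure.pi fun _ => ω))) := by
  simp_rw [← tsum_lintegral_detWeight_truncKernel hC]
  refine tendsto_tsum_lintegral_of_monotone (fun m => Measure.pi fun _ : Fin m => ω) _
    (fun m => by simp [Nat.factorial_ne_zero])
    (F := fun n m z => detWeight (truncKernel c φ n) (Sum.elim y z))
    (fun n m => ?_) (fun m z => monotone_detWeight_truncKernel hC.nonneg _)
    (fun m z => tendsto_detWeight_truncKernel _ fun i j => hC.hasSum _ _)
  refine ((measurable_detWeight (measurable_truncKernel hC.measurable n)).comp
    (measurable_pi_iff.2 fun i => ?_)).aemeasurable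
  rcases i with i | i
  · exact (measurable_const : Measurable fun _ : Fin m → E => y i)
  · exact (measurable_pi_apply i : Measurable fun z : Fin m → E => z i)

theorem tendsto_fredholmDet (hC : IsMercerKernel ω C c φ) :
    Filter.Tendsto (fun n => ENNReal.ofReal (∏ h ∈ Finset.range n, (1 + c h))) Filter.atTop
      (nhds (fredholmDet ω C)) := by
  have h := tendsto_fredholm_trunc hC (κ := Empty) Empty.elim
  have h1 : ∀ m (z : Fin m → E), detWeight C (Sum.elim Empty.elim z) = detWeight C z := by
    intro m z
    rw [← detWeight_comp_equiv C z (Equiv.emptySum Empty (Fin m))]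
    congr 1
    ext i
    rcases i with i | i
    · exact i.elim
    · rfl
  have h0 : ∀ C' : E → E → ℂ, detWeight C' (Empty.elim : Empty → E) = 1 := by
    intro C'
    simp [detWeight]
  simp_rw [h1, h0, mul_one] at h
  exact h

theorem fredholmDet_ne_top (hC : IsMercerKernel ω C c φ) : fredholmDet ω C ≠ ∞ := by
  refine ne_top_of_le_ne_top (b := ENNReal.ofReal (Real.exp (∑' h, c h))) ENNReal.ofReal_ne_top
    (le_of_tendsto' (tendsto_fredholmDet hC) fun n => ENNReal.ofReal_le_ofReal ?_)
  calc ∏ h ∈ Finset.range n, (1 + c h) ≤ ∏ h ∈ Finset.range n, Real.exp (c h) :=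
        Finset.prod_le_prod (fun h _ => add_nonneg zero_le_one (hC.nonneg h))
          fun h _ => by rw [add_comm]; exact Real.add_one_le_exp _
    _ = Real.exp (∑ h ∈ Finset.range n, c h) := (Real.exp_sum _ _).symm
    _ ≤ _ := Real.exp_le_exp.2 (hC.summable.sum_le_tsum _ fun h _ => hC.nonneg h)

theorem fredholmDet_ne_zero (ω : Measure E) [SigmaFinite ω] (C : E → E → ℂ) :
    fredholmDet ω C ≠ 0 := by
  intro h
  have := ENNReal.tsum_eq_zero.1 h 0
  simp [detWeight] at this

/-- The Fredholm expansion: with `K = C (1 + C)⁻¹`, the correlation functions of the point process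
whose Janossy densities are proportional to `det [C (x i) (x j)]` are `det [K (x i) (x j)]`. -/
theorem tsum_lintegral_detWeight {κ : Type*} [Fintype κ] [DecidableEq κ]
    (hC : IsMercerKernel ω C c φ) {K : E → E → ℂ} (y : κ → E)
    (hK : ∀ i j, HasSum (fun h => ((c h / (1 + c h) : ℝ) : ℂ) * φ h (y i) * conj (φ h (y j)))
      (K (y i) (y j))) :
    ∑' m : ℕ, (m.factorial : ℝ≥0∞)⁻¹ * ∫⁻ z : Fin m → E,
      detWeight C (Sum.elim y z) ∂(Measure.pi fun _ => ω) = fredholmDet ω C * detWeight K y :=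
  tendsto_nhds_unique (tendsto_fredholm_trunc hC y)
    (ENNReal.Tendsto.mul (tendsto_fredholmDet hC) (Or.inr ENNReal.ofReal_ne_top)
      (tendsto_detWeight_truncKernel y hK) (Or.inr (fredholmDet_ne_top hC)))

end

/-! ### Configurations and powers of random measures -/

section Config

variable {E : Type*} [MeasurableSpace E]

instance isFiniteMeasure_config {n : ℕ} (x : Fin n → E) : IsFiniteMeasure (config x) := by
  rw [config]
  infer_instance

theorem config_apply {n : ℕ} (x : Fin n → E) {s : Set E} (hs : MeasurableSet s) :
    config x s = ∑ i, s.indicator 1 (x i) := by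
  rw [config, Measure.finsetSum_apply]
  exact Finset.sum_congr rfl fun i _ => Measure.dirac_apply' _ hs

theorem config_univ {n : ℕ} (x : Fin n → E) : config x Set.univ = n := by
  rw [config_apply x MeasurableSet.univ]
  simp

theorem measurable_config {n : ℕ} : Measurable (config : (Fin n → E) → Measure E) := by
  refine Measure.measurable_of_measurable_coe _ fun s hs => ?_
  simp_rw [config_apply _ hs]
  refine Finset.measurable_fun_sum _ fun i _ => ?_
  have h : Measurable (s.indicator (1 : E → ℝ≥0∞)) := measurable_one.indicator hs
  exact h.comp (measurable_pi_apply i)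

theorem pi_config (k : ℕ) {n : ℕ} (x : Fin n → E) :
    (Measure.pi fun _ : Fin k => config x) = ∑ i : Fin k → Fin n, Measure.dirac (x ∘ i) := by
  refine Measure.pi_eq fun s hs => ?_
  rw [Measure.finsetSum_apply]
  simp_rw [config_apply _ (hs _), Finset.prod_univ_sum, Fintype.piFinset_univ]
  refine Finset.sum_congr rfl fun i _ => ?_
  rw [Measure.dirac_apply' _ (MeasurableSet.univ_pi hs)]
  by_cases h : ∀ j, x (i j) ∈ s j
  · rw [Set.indicator_of_mem (by simpa using h)]
    simp [h]
  · rw [Set.indicator_of_notMem (by simpa using h)]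
    push Not at h
    obtain ⟨j, hj⟩ := h
    exact (Finset.prod_eq_zero (Finset.mem_univ j) (by simp [hj])).symm

theorem measurableSet_distinctTuples [MeasurableEq E] (k : ℕ) :
    MeasurableSet (distinctTuples E k) := by
  have : distinctTuples E k = ⋂ (i : Fin k) (j : Fin k) (_ : i ≠ j), {x | x i = x j}ᶜ := by
    ext x
    simp only [distinctTuples, Set.mem_ofPred_eq, Set.mem_iInter, Set.mem_compl_iff]
    exact ⟨fun h i j hij hx => hij (h hx), fun h i j hx => by
      by_contra hij
      exact h i j hij hx⟩
  rw [this]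
  exact MeasurableSet.iInter fun i => MeasurableSet.iInter fun j => MeasurableSet.iInter fun _ =>
    (measurableSet_eq_fun (measurable_pi_apply i) (measurable_pi_apply j)).compl

theorem measurableSet_lt_top_univ : MeasurableSet {ν : Measure E | ν Set.univ < ∞} :=
  measurableSet_lt (Measure.measurable_coe MeasurableSet.univ) measurable_const

open Classical in
/-- The measure itself if it is finite, and `0` otherwise. -/
noncomputable def finPart (ν : Measure E) : Measure E := if ν Set.univ < ∞ then ν else 0

theorem finPart_of_lt_top {ν : Measure E} (h : ν Set.univ < ∞) : finPart ν = ν := if_pos h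

instance isFiniteMeasure_finPart (ν : Measure E) : IsFiniteMeasure (finPart ν) := by
  unfold finPart
  split_ifs with h
  · exact ⟨h⟩
  · infer_instance

theorem finPart_config {n : ℕ} (x : Fin n → E) : finPart (config x) = config x :=
  finPart_of_lt_top (measure_lt_top _ _)

theorem measurable_finPart : Measurable (finPart : Measure E → Measure E) :=
  Measurable.ite measurableSet_lt_top_univ measurable_id measurable_const

/-- The `k`-fold power `ν ↦ ν^k` of finite measures as a kernel. Infinite measures are replaced by
zero, which makes this a measurable map and an s-finite kernel on the space of all measures. -/
noncomputable def powKernel (E : Type*) [MeasurableSpace E] (k : ℕ) :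
    Kernel (Measure E) (Fin k → E) where
  toFun ν := Measure.pi fun _ => finPart ν
  measurable' := by
    refine Measurable.measure_of_isPiSystem generateFrom_pi.symm isPiSystem_pi ?_ ?_
    · rintro s ⟨t, ht, rfl⟩
      simp_rw [Measure.pi_pi]
      exact Finset.measurable_fun_prod _ fun i _ =>
        (Measure.measurable_coe (ht i (Set.mem_univ i))).comp measurable_finPart
    · simp_rw [Measure.pi_univ]
      exact Finset.measurable_fun_prod _ fun i _ =>
        (Measure.measurable_coe MeasurableSet.univ).comp measurable_finPart

theorem powKernel_apply (k : ℕ) (ν : Measure E) :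
    powKernel E k ν = Measure.pi fun _ => finPart ν := rfl

instance isSFiniteKernel_powKernel (k : ℕ) : IsSFiniteKernel (powKernel E k) := by
  let N : Measure E → ℕ := fun ν => ⌊(finPart ν Set.univ).toReal⌋₊
  have hN : Measurable N := Nat.measurable_floor.comp
    ((Measure.measurable_coe MeasurableSet.univ).comp measurable_finPart).ennreal_toReal
  have hs : ∀ n, MeasurableSet (N ⁻¹' {n}) := fun n => hN (measurableSet_singleton n)
  classical
  have hfin : ∀ n, IsFiniteKernel (Kernel.piecewise (hs n) (powKernel E k) 0) := by
    intro n
    refine ⟨⟨((n : ℝ≥0∞) + 1) ^ k, ENNReal.pow_lt_top (by simp), fun ν => ?_⟩⟩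
    rw [Kernel.piecewise_apply]
    split_ifs with h
    · rw [powKernel_apply, Measure.pi_univ, Finset.prod_const, Finset.card_univ, Fintype.card_fin]
      gcongr
      have h1 : (finPart ν Set.univ).toReal < n + 1 := by
        rw [← (h : N ν = n)]
        exact Nat.lt_floor_add_one _
      rw [← ENNReal.ofReal_toReal (measure_ne_top (finPart ν) Set.univ)]
      refine (ENNReal.ofReal_le_ofReal h1.le).trans_eq ?_
      rw [ENNReal.ofReal_add (by positivity) zero_le_one, ENNReal.ofReal_natCast,
        ENNReal.ofReal_one]
    · simp
  have heq : powKernel E k = Kernel.sum fun n => Kernel.piecewise (hs n) (powKernel E k) 0 := by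
    ext ν s hs'
    rw [Kernel.sum_apply' _ _ hs', tsum_eq_single (N ν)]
    · rw [Kernel.piecewise_apply, if_pos (show ν ∈ N ⁻¹' {N ν} from rfl)]
    · intro n hn
      rw [Kernel.piecewise_apply, if_neg (show ν ∉ N ⁻¹' {n} from fun h => hn (h : N ν = n).symm)]
      simp
  rw [heq]
  exact Kernel.isSFiniteKernel_sum

theorem measurable_lintegral_powKernel (k : ℕ) {g : (Fin k → E) → Measure E → ℝ≥0∞}
    (hg : Measurable (Function.uncurry g)) :
    Measurable fun ν => ∫⁻ x, g x ν ∂(powKernel E k ν) := by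
  have h1 : Measurable (Function.uncurry fun (ν : Measure E) (x : Fin k → E) => g x ν) :=
    hg.comp measurable_swap
  exact h1.lintegral_kernel_prod_right

theorem measurable_setLIntegral_powKernel [MeasurableEq E] (k : ℕ)
    {g : (Fin k → E) → Measure E → ℝ≥0∞} (hg : Measurable (Function.uncurry g)) :
    Measurable fun ν => ∫⁻ x in distinctTuples E k, g x ν ∂(powKernel E k ν) := by
  have hD := measurableSet_distinctTuples (E := E) k
  simp_rw [← lintegral_indicator hD]
  refine measurable_lintegral_powKernel k
    (g := fun x ν => (distinctTuples E k).indicator (fun x => g x ν) x) ?_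
  have : (Function.uncurry fun x ν => (distinctTuples E k).indicator (fun x => g x ν) x) =
      (Prod.fst ⁻¹' (distinctTuples E k)).indicator (Function.uncurry g) := by
    ext ⟨x, ν⟩
    by_cases hx : x ∈ distinctTuples E k <;> simp [hx]
  rw [this]
  exact hg.indicator (measurable_fst hD)

theorem lintegral_momentMeasure [MeasurableEq E] (k : ℕ) {P : Measure (Measure E)}
    (hP : ∀ᵐ ν ∂P, ν Set.univ < ∞) {g : (Fin k → E) → ℝ≥0∞} (hg : Measurable g) :
    ∫⁻ x, g x ∂(momentMeasure k P) =
      ∫⁻ ν, ∫⁻ x in distinctTuples E k, g x ∂(powKernel E k ν) ∂P := by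
  have hae : (fun ν : Measure E => (Measure.pi fun _ : Fin k => ν).restrict (distinctTuples E k))
      =ᵐ[P] fun ν => (powKernel E k ν).restrict (distinctTuples E k) := by
    filter_upwards [hP] with ν hν
    rw [powKernel_apply, finPart_of_lt_top hν]
  have hm : Measurable fun ν : Measure E =>
      (powKernel E k ν).restrict (distinctTuples E k) :=
    ((powKernel E k).restrict (measurableSet_distinctTuples k)).measurable
  rw [momentMeasure, Measure.bind_congr_right hae, Measure.lintegral_bind hm.aemeasurable
    hg.aemeasurable]

theorem setLIntegral_powKernel_config [MeasurableEq E] (k : ℕ) {n : ℕ} {x : Fin n → E}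
    (hx : Function.Injective x) {g : (Fin k → E) → ℝ≥0∞} (hg : Measurable g) :
    ∫⁻ y in distinctTuples E k, g y ∂(powKernel E k (config x)) =
      ∑ i : Fin k ↪ Fin n, g (x ∘ i) := by
  have hD := measurableSet_distinctTuples (E := E) k
  rw [← lintegral_indicator hD, powKernel_apply, finPart_config, pi_config,
    lintegral_finsetSum_measure]
  simp_rw [lintegral_dirac' _ (hg.indicator hD)]
  rw [sum_eq_sum_embedding]
  · refine Finset.sum_congr rfl fun i _ => Set.indicator_of_mem ?_ _
    exact hx.comp i.injective
  · intro i hi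
    refine Set.indicator_of_notMem (fun h => hi ?_) _
    exact Function.Injective.of_comp (f := x) h

end Config

/-! ### The unnormalised law with Janossy densities `det C` -/

section DetLaw

variable {E : Type*} [MeasurableSpace E]

/-- The measure on configurations with Janossy densities `det [C (x i) (x j)]` with respect to the
powers of `ω`; its total mass is `fredholmDet ω C`. -/
noncomputable def detLaw (ω : Measure E) (C : E → E → ℂ) : Measure (Measure E) :=
  Measure.sum fun n : ℕ => (n.factorial : ℝ≥0∞)⁻¹ •
    ((Measure.pi fun _ : Fin n => ω).withDensity (detWeight C)).map config

variable {ω : Measure E} {C : E → E → ℂ}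

theorem lintegral_detLaw (hC : Measurable fun p : E × E => C p.1 p.2) {G : Measure E → ℝ≥0∞}
    (hG : Measurable G) :
    ∫⁻ ν, G ν ∂(detLaw ω C) = ∑' n : ℕ, (n.factorial : ℝ≥0∞)⁻¹ *
      ∫⁻ x : Fin n → E, detWeight C x * G (config x) ∂(Measure.pi fun _ => ω) := by
  rw [detLaw, lintegral_sum_measure]
  refine tsum_congr fun n => ?_
  rw [lintegral_smul_measure, smul_eq_mul, lintegral_map hG measurable_config]
  congr 1
  exact lintegral_withDensity_eq_lintegral_mul _ (measurable_detWeight hC)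
    (hG.comp measurable_config)

theorem detLaw_univ (hC : Measurable fun p : E × E => C p.1 p.2) :
    detLaw ω C Set.univ = fredholmDet ω C := by
  rw [← lintegral_one, lintegral_detLaw hC measurable_const]
  simp [fredholmDet]

theorem ae_detLaw_iff (hC : Measurable fun p : E × E => C p.1 p.2) {S : Set (Measure E)}
    (hS : MeasurableSet S) :
    (∀ᵐ ν ∂(detLaw ω C), ν ∈ S) ↔
      ∀ n : ℕ, ∀ᵐ x : Fin n → E ∂(Measure.pi fun _ => ω), detWeight C x ≠ 0 → config x ∈ S := by
  rw [detLaw, Measure.ae_sum_iff' (p := fun ν => ν ∈ S) hS]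
  refine forall_congr' fun n => ?_
  rw [Measure.ae_ennreal_smul_measure_iff
    (ENNReal.inv_ne_zero.2 (ENNReal.natCast_ne_top _)),
    ae_map_iff (p := fun ν => ν ∈ S) measurable_config.aemeasurable hS,
    ae_withDensity_iff (measurable_detWeight hC)]

theorem ae_detLaw_lt_top (hC : Measurable fun p : E × E => C p.1 p.2) :
    ∀ᵐ ν ∂(detLaw ω C), ν Set.univ < ∞ :=
  (ae_detLaw_iff hC measurableSet_lt_top_univ).2 fun _ =>
    Filter.Eventually.of_forall fun x _ => measure_lt_top (config x) Set.univ

theorem lintegral_detWeight_mul_comp_embedding [SigmaFinite ω]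
    (hC : Measurable fun p : E × E => C p.1 p.2) {k m n : ℕ} (hn : m + k = n) (i : Fin k ↪ Fin n)
    {g : (Fin k → E) → Measure E → ℝ≥0∞} (hg : Measurable (Function.uncurry g)) :
    ∫⁻ x : Fin n → E, detWeight C x * g (x ∘ i) (config x) ∂(Measure.pi fun _ => ω) =
      ∫⁻ y : Fin k → E, ∫⁻ z : Fin m → E, detWeight C (Sum.elim y z) *
        g y (config y + config z) ∂(Measure.pi fun _ => ω) ∂(Measure.pi fun _ => ω) := by
  obtain ⟨e, he⟩ : ∃ e : Fin k ⊕ Fin m ≃ Fin n, ∀ a, e (Sum.inl a) = i a := by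
    classical
    have hcard : Fintype.card ((Set.range i)ᶜ : Set (Fin n)) = m := by
      rw [Fintype.card_compl_set, Set.card_range_of_injective i.injective]
      simp
      omega
    exact ⟨(Equiv.sumCongr (Equiv.ofInjective i i.injective)
      (Fintype.equivFinOfCardEq hcard).symm).trans (Equiv.Set.sumCompl (Set.range i)), fun a => rfl⟩
  have hmeas : Measurable fun x : Fin n → E => detWeight C x * g (x ∘ i) (config x) := by
    have h1 : Measurable fun x : Fin n → E => (x ∘ i, config x) :=
      (measurable_pi_iff.2 fun a => measurable_pi_apply (i a)).prodMk measurable_config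
    exact (measurable_detWeight hC).mul (hg.comp h1)
  have h1 := (measurePreserving_piCongrLeft (fun _ : Fin n => ω) e)
  have h2 := (measurePreserving_sumPiEquivProdPi_symm
    (fun _ : Fin k ⊕ Fin m => ω))
  have h3 : ∀ p : (Fin k → E) × (Fin m → E),
      (MeasurableEquiv.piCongrLeft (fun _ : Fin n => E) e
        ((MeasurableEquiv.sumPiEquivProdPi fun _ => E).symm p)) ∘ e = Sum.elim p.1 p.2 := by
    intro p
    ext a
    simp only [Function.comp_apply, MeasurableEquiv.coe_piCongrLeft, Equiv.piCongrLeft_apply_apply]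
    rcases a with a | a <;> rfl
  rw [← h1.lintegral_comp hmeas]
  refine (h2.lintegral_comp (hmeas.comp h1.measurable)).symm.trans ?_
  rw [lintegral_prod]
  · refine lintegral_congr fun y => lintegral_congr fun z => ?_
    have h4 := h3 (y, z)
    set x := (MeasurableEquiv.piCongrLeft (fun _ : Fin n => E) e
        ((MeasurableEquiv.sumPiEquivProdPi fun _ => E).symm (y, z))) with hx
    have h5 : x ∘ i = y := by
      ext a
      have := congrFun h4 (Sum.inl a)
      simpa [he] using this
    have h6 : config x = config y + config z := by
      simp only [config]
      rw [← Equiv.sum_comp e, Fintype.sum_sum_type]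
      congr 1
      · exact Finset.sum_congr rfl fun a _ => congrArg _ (congrFun h4 (Sum.inl a))
      · exact Finset.sum_congr rfl fun a _ => congrArg _ (congrFun h4 (Sum.inr a))
    change detWeight C x * g (x ∘ i) (config x) = _
    rw [← detWeight_comp_equiv C x e, h4, h5, h6]
  · exact ((hmeas.comp h1.measurable).comp h2.measurable).aemeasurable

theorem lintegral_detWeight_mul_distinctTuples [MeasurableEq E]
    (hC : Measurable fun p : E × E => C p.1 p.2) (k n : ℕ)
    {g : (Fin k → E) → Measure E → ℝ≥0∞} (hg : Measurable (Function.uncurry g)) :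
    ∫⁻ x : Fin n → E, detWeight C x *
      ∫⁻ y in distinctTuples E k, g y (config x) ∂(powKernel E k (config x))
        ∂(Measure.pi fun _ => ω) = ∑ i : Fin k ↪ Fin n, ∫⁻ x : Fin n → E,
          detWeight C x * g (x ∘ i) (config x) ∂(Measure.pi fun _ => ω) := by
  rw [← lintegral_finsetSum]
  · refine lintegral_congr fun x => ?_
    by_cases hx : Function.Injective x
    · have h1 : Measurable fun y => g y (config x) := hg.comp measurable_prodMk_right
      rw [setLIntegral_powKernel_config k hx h1, Finset.mul_sum]
    · simp [detWeight_eq_zero_of_not_injective C x hx]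
  · intro i _
    have h1 : Measurable fun x : Fin n → E => (x ∘ i, config x) :=
      (measurable_pi_iff.2 fun a => measurable_pi_apply (i a)).prodMk measurable_config
    exact (measurable_detWeight hC).mul (hg.comp h1)

theorem inv_factorial_mul_descFactorial (m k : ℕ) (t : ℝ≥0∞) :
    ((m + k).factorial : ℝ≥0∞)⁻¹ * (((m + k).descFactorial k : ℝ≥0∞) * t) =
      (m.factorial : ℝ≥0∞)⁻¹ * t := by
  rw [← mul_assoc]
  congr 1
  have h1 := Nat.factorial_mul_descFactorial (n := m + k) (k := k) (Nat.le_add_left k m)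
  rw [Nat.add_sub_cancel] at h1
  have h2 : (m + k).descFactorial k ≠ 0 :=
    (Nat.descFactorial_pos.2 (Nat.le_add_left k m)).ne'
  rw [← h1, Nat.cast_mul, ENNReal.mul_inv
    (Or.inl (Nat.cast_ne_zero.2 (Nat.factorial_ne_zero m))) (Or.inl (ENNReal.natCast_ne_top _)),
    mul_assoc, ENNReal.inv_mul_cancel (Nat.cast_ne_zero.2 h2) (ENNReal.natCast_ne_top _), mul_one]

theorem measurable_detWeight_sumElim_mul (hC : Measurable fun p : E × E => C p.1 p.2) (k m : ℕ)
    {g : (Fin k → E) → Measure E → ℝ≥0∞} (hg : Measurable (Function.uncurry g)) :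
    Measurable fun p : (Fin k → E) × (Fin m → E) => detWeight C (Sum.elim p.1 p.2) *
      g p.1 (config p.1 + config p.2) := by
  have h1 : Measurable fun p : (Fin k → E) × (Fin m → E) => (Sum.elim p.1 p.2) := by
    refine measurable_pi_iff.2 fun i => ?_
    rcases i with i | i
    · exact (measurable_pi_apply i).comp measurable_fst
    · exact (measurable_pi_apply i).comp measurable_snd
  have h2 : Measurable fun p : (Fin k → E) × (Fin m → E) =>
      (p.1, config p.1 + config p.2) := by
    refine measurable_fst.prodMk (Measure.measurable_of_measurable_coe _ fun s hs => ?_)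
    simp_rw [Measure.add_apply]
    exact (((Measure.measurable_coe hs).comp measurable_config).comp measurable_fst).add
      (((Measure.measurable_coe hs).comp measurable_config).comp measurable_snd)
  exact ((measurable_detWeight hC).comp h1).mul (hg.comp h2)

theorem ENNReal.tsum_eq_tsum_add_of_lt {f : ℕ → ℝ≥0∞} (k : ℕ) (hf : ∀ n, n < k → f n = 0) :
    ∑' n, f n = ∑' m, f (m + k) := by
  have h := Summable.sum_add_tsum_nat_add' (f := f) (k := k) ENNReal.summable
  rw [← h, Finset.sum_eq_zero fun n hn => hf n (Finset.mem_range.1 hn), zero_add]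

/-- The Campbell–Mecke formula: summing over `k`-tuples of points of a configuration amounts to
adding `k` points, with the Janossy density of the enlarged configuration. -/
theorem lintegral_detLaw_distinctTuples [MeasurableEq E] [SigmaFinite ω]
    (hC : Measurable fun p : E × E => C p.1 p.2) (k : ℕ)
    {g : (Fin k → E) → Measure E → ℝ≥0∞} (hg : Measurable (Function.uncurry g)) :
    ∫⁻ ν, ∫⁻ x in distinctTuples E k, g x ν ∂(powKernel E k ν) ∂(detLaw ω C) =
      ∫⁻ y : Fin k → E, ∑' m : ℕ, (m.factorial : ℝ≥0∞)⁻¹ * ∫⁻ z : Fin m → E,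
        detWeight C (Sum.elim y z) * g y (config y + config z) ∂(Measure.pi fun _ => ω)
        ∂(Measure.pi fun _ => ω) := by
  have hhigh : ∀ m, ∑ i : Fin k ↪ Fin (m + k), ∫⁻ x : Fin (m + k) → E,
      detWeight C x * g (x ∘ i) (config x) ∂(Measure.pi fun _ => ω) =
      ((m + k).descFactorial k : ℝ≥0∞) * ∫⁻ y : Fin k → E, ∫⁻ z : Fin m → E,
        detWeight C (Sum.elim y z) * g y (config y + config z)
        ∂(Measure.pi fun _ => ω) ∂(Measure.pi fun _ => ω) := by
    intro m
    rw [Finset.sum_congr rfl fun i _ => lintegral_detWeight_mul_comp_embedding hC rfl i hg,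
      Finset.sum_const, Finset.card_univ, Fintype.card_embedding_eq, Fintype.card_fin,
      Fintype.card_fin, nsmul_eq_mul]
  have hlow : ∀ n, n < k → ∑ i : Fin k ↪ Fin n, ∫⁻ x : Fin n → E,
      detWeight C x * g (x ∘ i) (config x) ∂(Measure.pi fun _ => ω) = 0 := by
    intro n hn
    have : IsEmpty (Fin k ↪ Fin n) := ⟨fun i => by
      have := Fintype.card_le_of_embedding i
      simp at this
      omega⟩
    exact Fintype.sum_empty _
  rw [lintegral_detLaw hC (measurable_setLIntegral_powKernel k hg)]
  simp only [lintegral_detWeight_mul_distinctTuples (ω := ω) hC k _ hg]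
  rw [ENNReal.tsum_eq_tsum_add_of_lt k fun n hn => by rw [hlow n hn, mul_zero]]
  simp only [hhigh, inv_factorial_mul_descFactorial]
  rw [lintegral_tsum fun m => ((measurable_detWeight_sumElim_mul hC k m
    hg).lintegral_prod_right'.const_mul _).aemeasurable]
  exact tsum_congr fun m => (lintegral_const_mul _
    (measurable_detWeight_sumElim_mul hC k m hg).lintegral_prod_right').symm

/-- The moment measures of the normalised law have the densities `det K`, `K = C (1 + C)⁻¹`. -/
theorem momentMeasure_smul_detLaw [MeasurableEq E] [SigmaFinite ω] {c : ℕ → ℝ} {φ : ℕ → E → ℂ}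
    (hC : IsMercerKernel ω C c φ) {K : E → E → ℂ} (hK : ∀ x y,
      HasSum (fun h => ((c h / (1 + c h) : ℝ) : ℂ) * φ h x * conj (φ h y)) (K x y)) (k : ℕ) :
    momentMeasure k ((fredholmDet ω C)⁻¹ • detLaw ω C) =
      (Measure.pi fun _ : Fin k => ω).withDensity (detWeight K) := by
  have hCm := hC.measurable_kernel
  refine Measure.ext fun s hs => ?_
  rw [← lintegral_indicator_one hs, lintegral_momentMeasure k
    (Measure.ae_smul_measure (ae_detLaw_lt_top hCm) _) (measurable_one.indicator hs),
    lintegral_smul_measure, lintegral_detLaw_distinctTuples hCm k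
      (g := fun x _ => s.indicator 1 x) ((measurable_one.indicator hs).comp measurable_fst),
    withDensity_apply _ hs, ← lintegral_indicator hs, smul_eq_mul,
    ← lintegral_const_mul' _ _ (ENNReal.inv_ne_top.2 (fredholmDet_ne_zero ω C))]
  refine lintegral_congr fun y => ?_
  by_cases hy : y ∈ s
  · simp only [Set.indicator_of_mem hy, Pi.one_apply, mul_one]
    rw [tsum_lintegral_detWeight hC y fun i j => hK _ _, ← mul_assoc,
      ENNReal.inv_mul_cancel (fredholmDet_ne_zero ω C) (fredholmDet_ne_top hC), one_mul]
  · simp [Set.indicator_of_notMem hy]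

end DetLaw

/-! ### Simple configurations -/

section Simple

variable {E : Type*} [MeasurableSpace E]

/-- The finite measures carried by `R` all of whose mass sits in atoms of mass one; these are the
finite simple configurations in `R`, and this description makes the set visibly measurable. -/
def simpleConfigs (R : Set E) : Set (Measure E) :=
  {ν | ν Set.univ < ∞ ∧ ν Rᶜ = 0 ∧ ν {x | ν {x} ≠ 1} = 0}

theorem measurableSet_simpleConfigs [MeasurableEq E] {R : Set E} (hR : MeasurableSet R) :
    MeasurableSet (simpleConfigs R) := by
  let κ : Kernel (Measure E) E := (powKernel E 1).map fun x => x 0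
  have hκ : ∀ ν : Measure E, ν Set.univ < ∞ → κ ν = ν := by
    intro ν hν
    rw [Kernel.map_apply _ (measurable_pi_apply 0), powKernel_apply, finPart_of_lt_top hν]
    have : IsFiniteMeasure ν := ⟨hν⟩
    rw [Measure.pi_map_eval]
    simp
  have h1 : Measurable fun p : Measure E × E => κ p.1 {p.2} := by
    have ht : MeasurableSet {q : (Measure E × E) × E | q.2 = q.1.2} :=
      measurableSet_eq_fun measurable_snd (measurable_snd.comp measurable_fst)
    exact Kernel.measurable_kernel_prodMk_left (κ := κ.comap Prod.fst measurable_fst) ht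
  have h2 : Measurable fun ν : Measure E => κ ν {x | κ ν {x} ≠ 1} := by
    have ht : MeasurableSet {p : Measure E × E | κ p.1 {p.2} ≠ 1} :=
      (h1 (measurableSet_singleton 1)).compl
    exact Kernel.measurable_kernel_prodMk_left (κ := κ) ht
  have h3 : simpleConfigs R = {ν | ν Set.univ < ∞} ∩
      ({ν | ν Rᶜ = 0} ∩ {ν | κ ν {x | κ ν {x} ≠ 1} = 0}) := by
    ext ν
    simp only [simpleConfigs, Set.mem_ofPred_eq, Set.mem_inter_iff]
    refine and_congr_right fun hν => ?_
    rw [hκ ν hν]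
  rw [h3]
  exact measurableSet_lt_top_univ.inter
    ((Measure.measurable_coe hR.compl (measurableSet_singleton 0)).inter
      (h2 (measurableSet_singleton 0)))

theorem config_mem_simpleConfigs [MeasurableEq E] [MeasurableSingletonClass E] {R : Set E}
    (hR : MeasurableSet R) {n : ℕ} {x : Fin n → E} (hx : Function.Injective x)
    (hxR : ∀ i, x i ∈ R) : config x ∈ simpleConfigs R := by
  have hone : ∀ i, config x {x i} = 1 := by
    intro i
    rw [config_apply _ (measurableSet_singleton _), Finset.sum_eq_single i]
    · simp
    · intro j _ hj
      exact Set.indicator_of_notMem (f := (1 : E → ℝ≥0∞)) (fun h : x j ∈ {x i} => hj (hx h))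
    · simp
  refine ⟨measure_lt_top _ _, ?_, ?_⟩
  · rw [config_apply _ hR.compl]
    exact Finset.sum_eq_zero fun i _ =>
      Set.indicator_of_notMem (f := (1 : E → ℝ≥0∞)) fun h : x i ∈ Rᶜ => h (hxR i)
  · refine measure_mono_null (t := (Set.range x)ᶜ) ?_ ?_
    · rintro z hz ⟨i, rfl⟩
      exact hz (hone i)
    · rw [config_apply _ (Set.finite_range x).measurableSet.compl]
      exact Finset.sum_eq_zero fun i _ =>
        Set.indicator_of_notMem (f := (1 : E → ℝ≥0∞)) fun h : x i ∈ (Set.range x)ᶜ => h ⟨i, rfl⟩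

theorem exists_config_of_mem_simpleConfigs [MeasurableSingletonClass E] {R : Set E}
    {ν : Measure E} (hν : ν ∈ simpleConfigs R) :
    ∃ (n : ℕ) (x : Fin n → E), Function.Injective x ∧ (∀ i, x i ∈ R) ∧ ν = config x := by
  obtain ⟨hfin, hR, hA⟩ := hν
  set A : Set E := {x | ν {x} = 1} with hAdef
  have hcard : ∀ F : Finset E, (F : Set E) ⊆ A → ν F = F.card := by
    intro F hF
    rw [← sum_measure_singleton, Finset.sum_congr rfl fun a ha => (hF ha : ν {a} = 1)]
    simp
  have hAfin : A.Finite := by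
    by_contra hinf
    obtain ⟨n, hn⟩ := ENNReal.exists_nat_gt hfin.ne
    obtain ⟨F, hF, hFn⟩ := Set.Infinite.exists_subset_card_eq hinf n
    have h := hcard F hF
    rw [hFn] at h
    exact absurd (h ▸ measure_mono (Set.subset_univ (F : Set E))) (not_le.2 hn)
  have hRmem : ∀ a ∈ A, a ∈ R := by
    intro a ha
    by_contra haR
    have : ν {a} = 0 := measure_mono_null (Set.singleton_subset_iff.2 haR) hR
    rw [(ha : ν {a} = 1)] at this
    exact one_ne_zero this
  let F := hAfin.toFinset
  refine ⟨F.card, fun i => (F.equivFin.symm i : E), fun i j h => F.equivFin.symm.injective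
    (Subtype.ext h), fun i => hRmem _ ((hAfin.mem_toFinset).1 (F.equivFin.symm i).2), ?_⟩
  classical
  refine Measure.ext fun s hs => ?_
  have h1 : ν s = ν (F.filter (· ∈ s) : Finset E) := by
    have h2 : ((F.filter (· ∈ s) : Finset E) : Set E) = s ∩ A := by
      ext a
      simp [F, and_comm]
    rw [h2, measure_inter_conull]
    exact measure_mono_null (fun z hz => hz) hA
  rw [h1, hcard _ fun a ha => (hAfin.mem_toFinset).1 (Finset.mem_filter.1 ha).1,
    config_apply _ hs, Finset.card_filter, ← Finset.sum_coe_sort]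
  push_cast
  refine Fintype.sum_equiv F.equivFin _ _ fun a => ?_
  simp [Set.indicator_apply]

end Simple

/-! ### Determinantal processes with a given density -/

section Density

variable {E : Type*} [MeasurableSpace E] {C : E → E → ℂ}

theorem lintegral_powKernel_detWeight (hC : Measurable fun p : E × E => C p.1 p.2) {n : ℕ}
    (x : Fin n → E) :
    ∫⁻ y, detWeight C y ∂(powKernel E n (config x)) = n.factorial * detWeight C x := by
  rw [powKernel_apply, finPart_config, pi_config, lintegral_finsetSum_measure]
  simp_rw [lintegral_dirac' _ (measurable_detWeight hC)]
  rw [sum_eq_sum_embedding (fun i : Fin n → Fin n => detWeight C (x ∘ i)) fun i hi =>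
    detWeight_eq_zero_of_not_injective C _ fun h => hi (Function.Injective.of_comp h)]
  have h1 : ∀ i : Fin n ↪ Fin n, detWeight C (x ∘ i) = detWeight C x := fun i =>
    detWeight_comp_equiv C x (Equiv.ofBijective i (Finite.injective_iff_bijective.1 i.injective))
  simp_rw [h1]
  rw [Finset.sum_const, Finset.card_univ, Fintype.card_embedding_eq, Fintype.card_fin,
    Nat.descFactorial_self, nsmul_eq_mul]

/-- The function of a configuration `∑ i, δ_{x i}` with value `det [C (x i) (x j)]`, as a measurable
function on the space of measures: the determinant is averaged over the tuples of points. -/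
noncomputable def detFunctional (C : E → E → ℂ) (ν : Measure E) : ℝ≥0∞ :=
  ∑' n : ℕ, {ν : Measure E | ν Set.univ = n}.indicator
    (fun ν => (n.factorial : ℝ≥0∞)⁻¹ * ∫⁻ y, detWeight C y ∂(powKernel E n ν)) ν

theorem measurable_detFunctional (hC : Measurable fun p : E × E => C p.1 p.2) :
    Measurable (detFunctional C) := by
  refine Measurable.tsum fun n => Measurable.indicator ?_
    (Measure.measurable_coe MeasurableSet.univ (measurableSet_singleton _))
  exact (measurable_lintegral_powKernel n (g := fun y _ => detWeight C y)
    ((measurable_detWeight hC).comp measurable_fst)).const_mul _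

theorem detFunctional_config (hC : Measurable fun p : E × E => C p.1 p.2) {n : ℕ}
    (x : Fin n → E) : detFunctional C (config x) = detWeight C x := by
  rw [detFunctional, tsum_eq_single n]
  · rw [Set.indicator_of_mem (by exact config_univ x), lintegral_powKernel_detWeight hC,
      ← mul_assoc, ENNReal.inv_mul_cancel (Nat.cast_ne_zero.2 n.factorial_ne_zero)
        (ENNReal.natCast_ne_top _), one_mul]
  · intro m hm
    refine Set.indicator_of_notMem (fun h => hm ?_) _
    have h1 : config x Set.univ = m := h
    rw [config_univ] at h1
    exact_mod_cast h1.symm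

theorem detLaw_eq_poissonLaw_withDensity {ω : Measure E} [IsFiniteMeasure ω]
    (hC : Measurable fun p : E × E => C p.1 p.2) :
    detLaw ω C = (poissonLaw ω).withDensity fun ν =>
      ENNReal.ofReal (Real.exp (ω.real Set.univ)) * detFunctional C ν := by
  have hf : Measurable fun ν =>
      ENNReal.ofReal (Real.exp (ω.real Set.univ)) * detFunctional C ν :=
    (measurable_detFunctional hC).const_mul _
  refine Measure.ext fun s hs => ?_
  rw [withDensity_apply _ hs, ← lintegral_indicator hs, ← lintegral_indicator_one hs,
    lintegral_detLaw hC (measurable_one.indicator hs), poissonLaw, lintegral_sum_measure]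
  refine tsum_congr fun n => ?_
  rw [lintegral_smul_measure, smul_eq_mul, lintegral_map (hf.indicator hs) measurable_config]
  have h1 : ∀ x : Fin n → E, s.indicator (fun ν => ENNReal.ofReal (Real.exp (ω.real Set.univ)) *
      detFunctional C ν) (config x) = ENNReal.ofReal (Real.exp (ω.real Set.univ)) *
        (detWeight C x * s.indicator 1 (config x)) := by
    intro x
    by_cases hx : config x ∈ s
    · simp [hx, detFunctional_config hC]
    · simp [hx]
  simp_rw [h1]
  rw [lintegral_const_mul' _ _ ENNReal.ofReal_ne_top, ← mul_assoc,
    ← ENNReal.ofReal_mul (by positivity)]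
  congr 1
  rw [div_mul_eq_mul_div, ← Real.exp_add, neg_add_cancel, Real.exp_zero, one_div,
    ENNReal.ofReal_inv_of_pos (by positivity), ENNReal.ofReal_natCast]

end Density

section Spectral

variable {q : ℕ} {R : Set (EuclideanSpace ℝ (Fin q))}
  {C : EuclideanSpace ℝ (Fin q) → EuclideanSpace ℝ (Fin q) → ℂ}
  {c : ℕ → ℝ} {φ : ℕ → EuclideanSpace ℝ (Fin q) → ℂ}

open Classical in
/-- The kernel `C` on `R × R`, extended by zero. -/
noncomputable def cutKernel {E : Type*} (R : Set E) (C : E → E → ℂ) (x y : E) : ℂ :=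
  if x ∈ R ∧ y ∈ R then C x y else 0

theorem cutKernel_apply {E : Type*} {R : Set E} {C : E → E → ℂ} {x y : E} (hx : x ∈ R)
    (hy : y ∈ R) : cutKernel R C x y = C x y := if_pos ⟨hx, hy⟩

theorem HasSpectralRepresentation.integral_mul_conj (hC : HasSpectralRepresentation R C c φ)
    (h l : ℕ) : ∫ z in R, φ h z * conj (φ l z) = if h = l then 1 else 0 := by
  have h1 := (orthonormal_iff_ite.1 hC.orthonormal) l h
  rw [MeasureTheory.L2.inner_def] at h1
  rw [show (if h = l then (1 : ℂ) else 0) = if l = h then 1 else 0 by simp [eq_comm], ← h1]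
  refine integral_congr_ae ?_
  filter_upwards [(hC.memLp h).coeFn_toLp, (hC.memLp l).coeFn_toLp] with z hz hz'
  rw [hz, hz']
  simp

theorem HasSpectralRepresentation.isMercerKernel (hR : MeasurableSet R)
    (hC : HasSpectralRepresentation R C c φ) :
    IsMercerKernel (volume.restrict R) (cutKernel R C) c fun h => R.indicator (φ h) where
  measurable h := (hC.measurable h).indicator hR
  memLp h := (hC.memLp h).indicator hR
  orthonormal h l := by
    rw [← hC.integral_mul_conj h l]
    refine setIntegral_congr_fun hR fun z hz => ?_
    simp [Set.indicator_of_mem hz]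
  nonneg := hC.nonneg
  summable := hC.summable
  hasSum x y := by
    by_cases hx : x ∈ R
    · by_cases hy : y ∈ R
      · simpa [cutKernel, hx, hy] using hC.hasSum x hx y hy
      · simp [cutKernel, hy, hasSum_zero]
    · simp [cutKernel, hx, hasSum_zero]

theorem ae_pi_restrict_mem (hR : MeasurableSet R) (n : ℕ) :
    ∀ᵐ x : Fin n → EuclideanSpace ℝ (Fin q) ∂(Measure.pi fun _ => volume.restrict R),
      ∀ i, x i ∈ R := by
  refine ae_all_iff.2 fun i => ?_
  exact Measure.tendsto_eval_ae_ae.eventually (ae_restrict_mem hR)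

/-- The probability law with Janossy densities proportional to `det C` on `R`. -/
noncomputable def detProcess {q : ℕ} (R : Set (EuclideanSpace ℝ (Fin q)))
    (C : EuclideanSpace ℝ (Fin q) → EuclideanSpace ℝ (Fin q) → ℂ) :
    Measure (Measure (EuclideanSpace ℝ (Fin q))) :=
  (fredholmDet (volume.restrict R) (cutKernel R C))⁻¹ •
    detLaw (volume.restrict R) (cutKernel R C)

theorem isProbabilityMeasure_detProcess (hR : MeasurableSet R)
    (hC : HasSpectralRepresentation R C c φ) : IsProbabilityMeasure (detProcess R C) := by
  have hM := hC.isMercerKernel hR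
  refine ⟨?_⟩
  rw [detProcess, Measure.smul_apply, detLaw_univ hM.measurable_kernel, smul_eq_mul,
    ENNReal.inv_mul_cancel (fredholmDet_ne_zero _ _) (fredholmDet_ne_top hM)]

theorem ae_detProcess_mem_simpleConfigs (hR : MeasurableSet R)
    (hC : HasSpectralRepresentation R C c φ) : ∀ᵐ ν ∂(detProcess R C), ν ∈ simpleConfigs R := by
  refine Measure.ae_smul_measure ?_ _
  refine (ae_detLaw_iff (hC.isMercerKernel hR).measurable_kernel
    (measurableSet_simpleConfigs hR)).2 fun n => ?_
  filter_upwards [ae_pi_restrict_mem hR n] with x hx hw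
  refine config_mem_simpleConfigs hR ?_ hx
  by_contra h
  exact hw (detWeight_eq_zero_of_not_injective _ x h)

/-- The eigenvalues `c` of the kernel of the density correspond to the eigenvalues `c / (1 + c)` of
the kernel of the correlation functions. -/
theorem isDPP_detProcess (hR : MeasurableSet R) (hC : HasSpectralRepresentation R C c φ)
    {K : EuclideanSpace ℝ (Fin q) → EuclideanSpace ℝ (Fin q) → ℂ}
    (hK : HasSpectralRepresentation R K (fun h => c h / (1 + c h)) φ) :
    IsDPP R K (detProcess R C) where
  prob := isProbabilityMeasure_detProcess hR hC
  simple := by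
    filter_upwards [ae_detProcess_mem_simpleConfigs hR hC] with ν hν
    exact exists_config_of_mem_simpleConfigs hν
  moment k := by
    rw [detProcess, momentMeasure_smul_detLaw (hC.isMercerKernel hR) (hK.isMercerKernel hR).hasSum]
    refine withDensity_congr_ae ?_
    filter_upwards [ae_pi_restrict_mem hR k] with x hx
    exact detWeight_congr fun i j => cutKernel_apply (hx i) (hx j)

theorem det_kernelMatrix_nonneg (hC : HasSpectralRepresentation R C c φ) {n : ℕ}
    {x : Fin n → EuclideanSpace ℝ (Fin q)} (hx : ∀ i, x i ∈ R) : 0 ≤ (kernelMatrix C x).det :=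
  det_gram_nonneg hC.nonneg x fun i j => hC.hasSum _ (hx i) _ (hx j)

theorem hasDetDensity_detProcess (hR : IsCompact R) (hC : HasSpectralRepresentation R C c φ) :
    HasDetDensity R C (detProcess R C) := by
  have hM := hC.isMercerKernel hR.measurableSet
  have hfin : IsFiniteMeasure (volume.restrict R) := ⟨by
    rw [Measure.restrict_apply_univ]
    exact hR.measure_lt_top⟩
  set ω := volume.restrict R
  set Z := fredholmDet ω (cutKernel R C) with hZ
  have hZ0 : Z ≠ 0 := fredholmDet_ne_zero _ _
  have hZt : Z ≠ ∞ := fredholmDet_ne_top hM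
  set a : ℝ≥0∞ := Z⁻¹ * ENNReal.ofReal (Real.exp (ω.real Set.univ)) with ha
  have hat : a ≠ ∞ := ENNReal.mul_ne_top (ENNReal.inv_ne_top.2 hZ0) ENNReal.ofReal_ne_top
  have ha0 : a ≠ 0 := mul_ne_zero (ENNReal.inv_ne_zero.2 hZt)
    (by simpa using Real.exp_pos _)
  refine ⟨a.toReal, fun ν => a * detFunctional (cutKernel R C) ν, ENNReal.toReal_pos ha0 hat,
    (measurable_detFunctional hM.measurable_kernel).const_mul _, fun n x hx => ?_, ?_⟩
  · have h0 := Complex.le_def.1 (det_kernelMatrix_nonneg hC hx)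
    refine ⟨(kernelMatrix C x).det.re, h0.1, Complex.ext rfl h0.2.symm, ?_⟩
    change a * detFunctional (cutKernel R C) (config x) = _
    rw [detFunctional_config hM.measurable_kernel, ENNReal.ofReal_mul ENNReal.toReal_nonneg,
      ENNReal.ofReal_toReal hat]
    congr 1
    exact detWeight_congr fun i j => cutKernel_apply (hx i) (hx j)
  · rw [detProcess, detLaw_eq_poissonLaw_withDensity hM.measurable_kernel,
      ← withDensity_smul _ ((measurable_detFunctional hM.measurable_kernel).const_mul _)]
    congr 1
    ext ν
    simp only [Pi.smul_apply, smul_eq_mul, ha]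
    rw [mul_assoc]

end Spectral

/-! ### Laws of random measures are determined by Laplace functionals -/

section Laplace

open scoped NNReal BoundedContinuousFunction

variable {E : Type*} [mE : MeasurableSpace E]

/-- A sequence of measurable sets which is a `π`-system generating the `σ`-algebra, and which
contains an increasing sequence exhausting the space. -/
structure IsTestSystem (A : ℕ → Set E) : Prop where
  measurableSet : ∀ i, MeasurableSet (A i)
  isPiSystem : IsPiSystem (Set.range A)
  generateFrom : mE = MeasurableSpace.generateFrom (Set.range A)
  exhausting : ∃ b : ℕ → ℕ, Monotone (fun n => A (b n)) ∧ ⋃ n, A (b n) = Set.univ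

/-- The test functional `ν ↦ exp (-∑ i ∈ l, ν (A i))`. -/
noncomputable def laplaceTest (A : ℕ → Set E) (l : List ℕ) (ν : Measure E) : ℝ :=
  Real.exp (-(l.map fun i => ν.real (A i)).sum)

theorem laplaceTest_nonneg (A : ℕ → Set E) (l : List ℕ) (ν : Measure E) :
    0 ≤ laplaceTest A l ν := (Real.exp_pos _).le

theorem laplaceTest_le_one (A : ℕ → Set E) (l : List ℕ) (ν : Measure E) :
    laplaceTest A l ν ≤ 1 := by
  refine Real.exp_le_one_iff.2 (neg_nonpos.2 (List.sum_nonneg fun x hx => ?_))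
  obtain ⟨i, -, rfl⟩ := List.mem_map.1 hx
  exact measureReal_nonneg

theorem measurable_laplaceTest {A : ℕ → Set E} (hA : ∀ i, MeasurableSet (A i)) (l : List ℕ) :
    Measurable (laplaceTest A l) := by
  refine Real.measurable_exp.comp (Measurable.neg ?_)
  induction l with
  | nil => exact measurable_const
  | cons i l ih =>
    simp only [List.map_cons, List.sum_cons]
    exact (Measure.measurable_coe (hA i)).ennreal_toReal.add ih

/-- The masses of the sets of a test system. -/
noncomputable def masses (A : ℕ → Set E) (ν : Measure E) (i : ℕ) : ℝ≥0 := (ν (A i)).toNNReal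

theorem measurable_masses {A : ℕ → Set E} (hA : ∀ i, MeasurableSet (A i)) :
    Measurable (masses A) :=
  measurable_pi_iff.2 fun i => (Measure.measurable_coe (hA i)).ennreal_toNNReal

/-- On finite measures, the `σ`-algebra of the space of measures is generated by the masses of the
sets of a test system. -/
theorem IsTestSystem.exists_preimage_masses {A : ℕ → Set E} (hA : IsTestSystem A)
    {S : Set (Measure E)} (hS : MeasurableSet S) :
    ∃ t : Set (ℕ → ℝ≥0), MeasurableSet t ∧
      ∀ ν : Measure E, ν Set.univ < ∞ → (ν ∈ S ↔ masses A ν ∈ t) := by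
  let F := {ν : Measure E // ν Set.univ < ∞}
  let m0 : MeasurableSpace F := MeasurableSpace.comap (fun ν : F => masses A ν.1) inferInstance
  have hfin : ∀ ν : F, IsFiniteMeasure ν.1 := fun ν => ⟨ν.2⟩
  have hcoord : ∀ i, Measurable[m0] fun ν : F => ν.1 (A i) := by
    intro i
    have h1 : Measurable[m0] fun ν : F => masses A ν.1 :=
      comap_measurable (fun ν : F => masses A ν.1)
    have h2 : Measurable[m0] fun ν : F => ((masses A ν.1 i : ℝ≥0) : ℝ≥0∞) :=
      measurable_coe_nnreal_ennreal.comp ((measurable_pi_apply i).comp h1)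
    have h3 : (fun ν : F => ν.1 (A i)) = fun ν : F => ((masses A ν.1 i : ℝ≥0) : ℝ≥0∞) := by
      ext ν
      exact (ENNReal.coe_toNNReal (measure_ne_top _ _)).symm
    rw [h3]
    exact h2
  have huniv : Measurable[m0] fun ν : F => ν.1 Set.univ := by
    obtain ⟨b, hb, hbU⟩ := hA.exhausting
    have h1 : (fun ν : F => ν.1 Set.univ) = fun ν : F => ⨆ n, ν.1 (A (b n)) := by
      ext ν
      have h2 := hb.measure_iUnion (μ := ν.1)
      rw [hbU] at h2
      exact h2
    rw [h1]
    exact Measurable.iSup fun n => hcoord (b n)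
  have hval : Measurable[m0] (Subtype.val : F → Measure E) := by
    refine Measurable.measure_of_isPiSystem hA.generateFrom hA.isPiSystem ?_ huniv
    rintro s ⟨i, rfl⟩
    exact hcoord i
  obtain ⟨t, ht, htS⟩ := hval hS
  refine ⟨t, ht, fun ν hν => ?_⟩
  have : (⟨ν, hν⟩ : F) ∈ (fun ν : F => masses A ν.1) ⁻¹' t ↔
      (⟨ν, hν⟩ : F) ∈ (Subtype.val : F → Measure E) ⁻¹' S := by rw [htS]
  exact this.symm

/-- The function `x ↦ exp (-x i)` on sequences. -/
noncomputable def expCoord (i : ℕ) : (ℕ → ℝ≥0) →ᵇ ℝ :=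
  BoundedContinuousFunction.ofNormedAddCommGroup (fun x => Real.exp (-(x i : ℝ)))
    (by fun_prop) 1 fun x => by
      rw [Real.norm_eq_abs, abs_of_pos (Real.exp_pos _)]
      exact Real.exp_le_one_iff.2 (neg_nonpos.2 (x i).2)

/-- Probability laws on sequences are determined by the integrals of monomials in the functions
`exp (-x i)`. -/
theorem ext_of_lintegral_expCoord {P Q : Measure (ℕ → ℝ≥0)} [IsFiniteMeasure P]
    [IsFiniteMeasure Q]
    (h : ∀ l : List ℕ, ∫ x, Real.exp (-(l.map fun i => (x i : ℝ)).sum) ∂P =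
      ∫ x, Real.exp (-(l.map fun i => (x i : ℝ)).sum) ∂Q) : P = Q := by
  let 𝒜 : StarSubalgebra ℝ ((ℕ → ℝ≥0) →ᵇ ℝ) :=
    { Algebra.adjoin ℝ (Set.range expCoord) with
      star_mem' := fun {a} ha => by
        have : star a = a := by ext x; simp
        rw [this]
        exact ha }
  refine ext_of_forall_mem_subalgebra_integral_eq_of_polish (𝕜 := ℝ) (A := 𝒜) ?_ ?_
  · intro x y hxy
    obtain ⟨i, hi⟩ := Function.ne_iff.1 hxy
    refine ⟨fun z => expCoord i z, ⟨(BoundedContinuousFunction.toContinuousMapStarₐ ℝ) (expCoord i),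
      ⟨expCoord i, Algebra.subset_adjoin ⟨i, rfl⟩, rfl⟩, rfl⟩, fun hexp => hi ?_⟩
    have h1 : Real.exp (-(x i : ℝ)) = Real.exp (-(y i : ℝ)) := hexp
    have h2 := neg_injective (Real.exp_injective h1)
    exact_mod_cast h2
  · intro g hg
    have hg' : g ∈ Submodule.span ℝ (Submonoid.closure (Set.range expCoord) :
        Set ((ℕ → ℝ≥0) →ᵇ ℝ)) := by
      rw [← Algebra.adjoin_eq_span]
      exact hg
    clear hg
    induction hg' using Submodule.span_induction with
    | mem g hg =>
      obtain ⟨l, hl⟩ : ∃ l : List ℕ, ∀ x, g x = Real.exp (-(l.map fun i => (x i : ℝ)).sum) := by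
        induction hg using Submonoid.closure_induction with
        | mem g hg =>
          obtain ⟨i, rfl⟩ := hg
          exact ⟨[i], fun x => by simp [expCoord]⟩
        | one => exact ⟨[], fun x => by simp⟩
        | mul a b _ _ ha hb =>
          obtain ⟨l, hl⟩ := ha
          obtain ⟨l', hl'⟩ := hb
          refine ⟨l ++ l', fun x => ?_⟩
          rw [BoundedContinuousFunction.mul_apply, hl, hl', ← Real.exp_add, List.map_append,
            List.sum_append, neg_add]
      simp_rw [hl]
      exact h l
    | zero => simp
    | add a b _ _ ha hb =>
      simp only [BoundedContinuousFunction.coe_add, Pi.add_apply]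
      rw [integral_add (a.integrable P) (b.integrable P),
        integral_add (a.integrable Q) (b.integrable Q), ha, hb]
    | smul r a _ ha =>
      simp only [BoundedContinuousFunction.coe_smul, smul_eq_mul]
      rw [integral_const_mul, integral_const_mul, ha]

/-- Laws of random finite measures agree if their Laplace functionals agree on sums of indicators
of sets of a test system. -/
theorem IsTestSystem.ext_of_lintegral_laplaceTest {A : ℕ → Set E} (hA : IsTestSystem A)
    {P Q : Measure (Measure E)} [IsFiniteMeasure P] [IsFiniteMeasure Q]
    (hP : ∀ᵐ ν ∂P, ν Set.univ < ∞) (hQ : ∀ᵐ ν ∂Q, ν Set.univ < ∞)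
    (h : ∀ l, ∫⁻ ν, ENNReal.ofReal (laplaceTest A l ν) ∂P =
      ∫⁻ ν, ENNReal.ofReal (laplaceTest A l ν) ∂Q) : P = Q := by
  have hT := measurable_masses hA.measurableSet
  have hmap : P.map (masses A) = Q.map (masses A) := by
    refine ext_of_lintegral_expCoord fun l => ?_
    have hm : Measurable fun x : ℕ → ℝ≥0 => Real.exp (-(l.map fun i => (x i : ℝ)).sum) := by
      refine Real.measurable_exp.comp (Measurable.neg ?_)
      induction l with
      | nil => exact measurable_const
      | cons i l ih =>
        simp only [List.map_cons, List.sum_cons]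
        exact (measurable_coe_nnreal_real.comp (measurable_pi_apply i)).add ih
    rw [integral_map hT.aemeasurable hm.aestronglyMeasurable,
      integral_map hT.aemeasurable hm.aestronglyMeasurable]
    have h1 : ∀ ν : Measure E, Real.exp (-(l.map fun i => (masses A ν i : ℝ)).sum) =
        laplaceTest A l ν := fun ν => rfl
    simp_rw [h1]
    rw [integral_eq_lintegral_of_nonneg_ae
        (Filter.Eventually.of_forall (laplaceTest_nonneg A l))
        (measurable_laplaceTest hA.measurableSet l).aestronglyMeasurable,
      integral_eq_lintegral_of_nonneg_ae
        (Filter.Eventually.of_forall (laplaceTest_nonneg A l))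
        (measurable_laplaceTest hA.measurableSet l).aestronglyMeasurable, h l]
  refine Measure.ext fun S hS => ?_
  obtain ⟨t, ht, htS⟩ := hA.exists_preimage_masses hS
  have hkey : ∀ {P' : Measure (Measure E)}, (∀ᵐ ν ∂P', ν Set.univ < ∞) →
      P' S = P'.map (masses A) t := by
    intro P' hP'
    rw [Measure.map_apply hT ht]
    refine measure_congr ?_
    filter_upwards [hP'] with ν hν
    exact propext (htS ν hν)
  rw [hkey hP, hkey hQ, hmap]

/-- A second countable metric space has a test system consisting of bounded sets. -/
theorem exists_isTestSystem_isBounded (X : Type*) [MetricSpace X] [SecondCountableTopology X]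
    [MeasurableSpace X] [BorelSpace X] [Nonempty X] :
    ∃ A : ℕ → Set X, IsTestSystem A ∧ ∀ i, Bornology.IsBounded (A i) := by
  obtain ⟨x₀⟩ := ‹Nonempty X›
  let 𝓑 := TopologicalSpace.countableBasis X
  let 𝓕 : Set (Set (Set X)) := {F | F.Finite ∧ F ⊆ 𝓑}
  have h𝓕 : 𝓕.Countable :=
    Set.countable_ofPred_finite_subset (TopologicalSpace.countable_countableBasis X)
  let S : Set (Set X) := (fun p : Set (Set X) × ℕ => ⋂₀ p.1 ∩ Metric.ball x₀ p.2) ''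
    (𝓕 ×ˢ Set.univ)
  have hS : S.Countable := (h𝓕.prod Set.countable_univ).image _
  have hball : ∀ n : ℕ, Metric.ball x₀ n ∈ S := fun n =>
    ⟨(∅, n), ⟨⟨Set.finite_empty, Set.empty_subset _⟩, Set.mem_univ _⟩, by simp⟩
  obtain ⟨A, hA⟩ := hS.exists_eq_range ⟨_, hball 0⟩
  have hopen : ∀ s ∈ S, IsOpen s := by
    rintro s ⟨⟨F, n⟩, ⟨⟨hF, hFB⟩, -⟩, rfl⟩
    exact (hF.isOpen_sInter fun s hs =>
      (TopologicalSpace.isBasis_countableBasis X).isOpen (hFB hs)).inter Metric.isOpen_ball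
  have hmem : ∀ i, A i ∈ S := fun i => by rw [hA]; exact ⟨i, rfl⟩
  have hunion : ⋃ n : ℕ, Metric.ball x₀ n = Set.univ := Metric.iUnion_ball_nat x₀
  refine ⟨A, ⟨fun i => (hopen _ (hmem i)).measurableSet, ?_, ?_, ?_⟩, fun i => ?_⟩
  · rw [← hA]
    rintro s ⟨⟨F, n⟩, ⟨⟨hF, hFB⟩, -⟩, rfl⟩ t ⟨⟨G, m⟩, ⟨⟨hG, hGB⟩, -⟩, rfl⟩ -
    refine ⟨(F ∪ G, min n m), ⟨⟨hF.union hG, Set.union_subset hFB hGB⟩, Set.mem_univ _⟩, ?_⟩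
    simp only [Set.sInter_union]
    ext z
    simp only [Set.mem_inter_iff, Metric.mem_ball, Nat.cast_min, lt_min_iff]
    tauto
  · rw [← hA]
    refine le_antisymm ?_ (MeasurableSpace.generateFrom_le fun s hs => (hopen s hs).measurableSet)
    rw [BorelSpace.measurable_eq (α := X), (TopologicalSpace.isBasis_countableBasis
      X).borel_eq_generateFrom]
    refine MeasurableSpace.generateFrom_le fun s hs => ?_
    have h1 : s = ⋃ n : ℕ, (⋂₀ {s} ∩ Metric.ball x₀ n) := by
      rw [← Set.inter_iUnion, hunion]
      simp
    rw [h1]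
    refine MeasurableSet.iUnion fun n => MeasurableSpace.measurableSet_generateFrom
      ⟨({s}, n), ⟨⟨Set.finite_singleton s, Set.singleton_subset_iff.2 hs⟩, Set.mem_univ _⟩, rfl⟩
  · have h1 : ∀ n : ℕ, ∃ i, A i = Metric.ball x₀ n := fun n => by
      have := hball n
      rw [hA] at this
      exact this
    choose b hb using h1
    refine ⟨b, fun m n hmn => ?_, ?_⟩
    · simp only [hb]
      exact Metric.ball_subset_ball (by exact_mod_cast hmn)
    · simp only [hb, hunion]
  · obtain ⟨⟨F, n⟩, -, h⟩ := hmem i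
    rw [← h]
    exact Metric.isBounded_ball.subset Set.inter_subset_right

end Laplace

/-! ### Simple point processes are determined by their factorial moments -/

section Moments

/-- Inclusion-exclusion, with the terms of negative sign moved to the left-hand side. -/
theorem prod_one_sub_add_sum_odd {n : ℕ} (g : Fin n → ℝ) :
    ∏ j, (1 - g j) + ∑ k ∈ Finset.range (n + 1),
        ∑ s ∈ Finset.powersetCard (2 * k + 1) Finset.univ, ∏ j ∈ s, g j =
      ∑ k ∈ Finset.range (n + 1), ∑ s ∈ Finset.powersetCard (2 * k) Finset.univ, ∏ j ∈ s, g j := by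
  set e : ℕ → ℝ := fun k => ∑ s ∈ Finset.powersetCard k (Finset.univ : Finset (Fin n)),
    ∏ j ∈ s, g j with he
  have h1 : ∏ j, (1 - g j) = ∑ k ∈ Finset.range (n + 1), (-1) ^ k * e k := by
    simp_rw [sub_eq_add_neg]
    rw [Finset.prod_one_add, Finset.sum_powerset, Finset.card_univ, Fintype.card_fin]
    refine Finset.sum_congr rfl fun k _ => ?_
    rw [he, Finset.mul_sum]
    refine Finset.sum_congr rfl fun s hs => ?_
    rw [Finset.prod_neg, (Finset.mem_powersetCard.1 hs).2]
  have h2 : ∑ k ∈ Finset.range (n + 1), (-1) ^ k * e k =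
      ∑ k ∈ Finset.range (2 * (n + 1)), (-1) ^ k * e k := by
    refine Finset.sum_subset (Finset.range_mono (by lia)) fun k _ hk => ?_
    rw [he]
    simp only
    rw [Finset.powersetCard_eq_empty.2, Finset.sum_empty, mul_zero]
    rw [Finset.card_univ, Fintype.card_fin]
    simpa using hk
  have h3 : ∀ m : ℕ, ∑ k ∈ Finset.range (2 * m), (-1) ^ k * e k =
      ∑ k ∈ Finset.range m, (e (2 * k) - e (2 * k + 1)) := by
    intro m
    induction m with
    | zero => simp
    | succ m ih =>
      rw [Nat.mul_succ, Finset.sum_range_succ, Finset.sum_range_succ, ih, Finset.sum_range_succ,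
        pow_succ, pow_mul]
      ring
  rw [h1, h2, h3, Finset.sum_sub_distrib]
  ring

variable {E : Type*} [MeasurableSpace E]

/-- The integral of `g ⊗ ⋯ ⊗ g` over the `k`-tuples of distinct points, divided by `k!`. -/
noncomputable def distinctPower (g : E → ℝ≥0∞) (k : ℕ) (ν : Measure E) : ℝ≥0∞ :=
  (k.factorial : ℝ≥0∞)⁻¹ *
    ∫⁻ y in distinctTuples E k, ∏ j, g (y j) ∂(powKernel E k ν)

theorem measurable_prod_apply {g : E → ℝ≥0∞} (hg : Measurable g) (k : ℕ) :
    Measurable fun y : Fin k → E => ∏ j, g (y j) :=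
  Finset.measurable_fun_prod _ fun j _ => hg.comp (measurable_pi_apply j)

variable [MeasurableEq E]

theorem measurable_distinctPower {g : E → ℝ≥0∞} (hg : Measurable g) (k : ℕ) :
    Measurable (distinctPower g k) :=
  (measurable_setLIntegral_powKernel k (g := fun y _ => ∏ j, g (y j))
    ((measurable_prod_apply hg k).comp measurable_fst)).const_mul _

theorem distinctPower_config {g : E → ℝ} (hg : Measurable g) (hg0 : ∀ z, 0 ≤ g z) (k : ℕ) {n : ℕ}
    {x : Fin n → E} (hx : Function.Injective x) :
    distinctPower (fun z => ENNReal.ofReal (g z)) k (config x) =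
      ENNReal.ofReal (∑ s ∈ Finset.powersetCard k Finset.univ, ∏ j ∈ s, g (x j)) := by
  rw [distinctPower, setLIntegral_powKernel_config k hx
    (measurable_prod_apply hg.ennreal_ofReal k)]
  have h1 : ∀ i : Fin k ↪ Fin n, ∏ j, ENNReal.ofReal (g ((x ∘ i) j)) =
      (fun s : Finset (Fin n) => ENNReal.ofReal (∏ j ∈ s, g (x j))) (Finset.univ.map i) := by
    intro i
    simp only [Function.comp_apply, Finset.prod_map]
    rw [ENNReal.ofReal_prod_of_nonneg fun j _ => hg0 _]
  simp_rw [h1]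
  have h2 := sum_embedding_map_univ k
    (fun s : Finset (Fin n) => ENNReal.ofReal (∏ j ∈ s, g (x j)))
  rw [h2, nsmul_eq_mul, ← mul_assoc, ENNReal.inv_mul_cancel
    (Nat.cast_ne_zero.2 k.factorial_ne_zero) (ENNReal.natCast_ne_top _), one_mul,
    ENNReal.ofReal_sum_of_nonneg fun s _ => Finset.prod_nonneg fun j _ => hg0 _]

/-- Inclusion-exclusion for the product of `1 - g` over the points of a configuration. -/
theorem ofReal_prod_one_sub_add_tsum {g : E → ℝ} (hg : Measurable g) (hg0 : ∀ z, 0 ≤ g z)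
    (hg1 : ∀ z, g z ≤ 1) {n : ℕ} {x : Fin n → E} (hx : Function.Injective x) :
    ENNReal.ofReal (∏ j, (1 - g (x j))) +
        ∑' k, distinctPower (fun z => ENNReal.ofReal (g z)) (2 * k + 1) (config x) =
      ∑' k, distinctPower (fun z => ENNReal.ofReal (g z)) (2 * k) (config x) := by
  have hnn : ∀ k : ℕ, 0 ≤ ∑ s ∈ Finset.powersetCard k (Finset.univ : Finset (Fin n)),
      ∏ j ∈ s, g (x j) :=
    fun k => Finset.sum_nonneg fun s _ => Finset.prod_nonneg fun j _ => hg0 _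
  have hzero : ∀ k : ℕ, n < k → ∑ s ∈ Finset.powersetCard k (Finset.univ : Finset (Fin n)),
      ∏ j ∈ s, g (x j) = 0 := by
    intro k hk
    rw [Finset.powersetCard_eq_empty.2 (by simpa using hk), Finset.sum_empty]
  simp_rw [distinctPower_config hg hg0 _ hx]
  rw [tsum_eq_sum (s := Finset.range (n + 1)) fun k hk => by
      rw [hzero _ (by have := Finset.mem_range.not.1 hk; lia), ENNReal.ofReal_zero],
    tsum_eq_sum (s := Finset.range (n + 1)) fun k hk => by
      rw [hzero _ (by have := Finset.mem_range.not.1 hk; lia), ENNReal.ofReal_zero],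
    ← ENNReal.ofReal_sum_of_nonneg fun k _ => hnn _,
    ← ENNReal.ofReal_sum_of_nonneg fun k _ => hnn _,
    ← ENNReal.ofReal_add (Finset.prod_nonneg fun j _ => sub_nonneg.2 (hg1 _))
      (Finset.sum_nonneg fun k _ => hnn _), prod_one_sub_add_sum_odd fun j => g (x j)]

theorem lintegral_distinctPower {P : Measure (Measure E)} (hP : ∀ᵐ ν ∂P, ν Set.univ < ∞)
    {g : E → ℝ≥0∞} (hg : Measurable g) (k : ℕ) :
    ∫⁻ ν, distinctPower g k ν ∂P =
      (k.factorial : ℝ≥0∞)⁻¹ * ∫⁻ y, ∏ j, g (y j) ∂(momentMeasure k P) := by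
  rw [lintegral_momentMeasure k hP (measurable_prod_apply hg k)]
  exact lintegral_const_mul _ (measurable_setLIntegral_powKernel k
    (g := fun y _ => ∏ j, g (y j)) ((measurable_prod_apply hg k).comp measurable_fst))

end Moments

section TestFun

variable {E : Type*}

/-- The sum of the indicators of the sets `A i`, `i ∈ l`. -/
noncomputable def testFun (A : ℕ → Set E) (l : List ℕ) (z : E) : ℝ :=
  (l.map fun i => (A i).indicator (fun _ => (1 : ℝ)) z).sum

theorem testFun_cons (A : ℕ → Set E) (i : ℕ) (l : List ℕ) (z : E) :
    testFun A (i :: l) z = (A i).indicator (fun _ => (1 : ℝ)) z + testFun A l z := by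
  simp [testFun]

theorem testFun_nonneg (A : ℕ → Set E) (l : List ℕ) (z : E) : 0 ≤ testFun A l z := by
  refine List.sum_nonneg fun x hx => ?_
  obtain ⟨i, -, rfl⟩ := List.mem_map.1 hx
  exact Set.indicator_nonneg (fun _ _ => zero_le_one) _

theorem testFun_le (A : ℕ → Set E) (l : List ℕ) (z : E) : testFun A l z ≤ l.length := by
  induction l with
  | nil => simp [testFun]
  | cons i l ih =>
    rw [testFun_cons, List.length_cons]
    push_cast
    have h : (A i).indicator (fun _ => (1 : ℝ)) z ≤ 1 :=
      Set.indicator_le_self' (fun _ _ => zero_le_one) z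
    linarith

variable [MeasurableSpace E]

theorem measurable_testFun {A : ℕ → Set E} (hA : ∀ i, MeasurableSet (A i)) (l : List ℕ) :
    Measurable (testFun A l) := by
  induction l with
  | nil => exact measurable_const
  | cons i l ih =>
    have h : testFun A (i :: l) = fun z => (A i).indicator (fun _ => (1 : ℝ)) z + testFun A l z :=
      funext (testFun_cons A i l)
    rw [h]
    exact (measurable_const.indicator (hA i)).add ih

theorem integrable_testFun {A : ℕ → Set E} (hA : ∀ i, MeasurableSet (A i)) (l : List ℕ)
    (ν : Measure E) [IsFiniteMeasure ν] : Integrable (testFun A l) ν := by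
  refine Integrable.of_bound (measurable_testFun hA l).aestronglyMeasurable (l.length : ℝ)
    (Filter.Eventually.of_forall fun z => ?_)
  rw [Real.norm_eq_abs, abs_of_nonneg (testFun_nonneg A l z)]
  exact testFun_le A l z

theorem integral_testFun {A : ℕ → Set E} (hA : ∀ i, MeasurableSet (A i)) (l : List ℕ)
    (ν : Measure E) [IsFiniteMeasure ν] :
    ∫ z, testFun A l z ∂ν = (l.map fun i => ν.real (A i)).sum := by
  induction l with
  | nil => simp [testFun]
  | cons i l ih =>
    simp_rw [testFun_cons]
    rw [integral_add ((integrable_const _).indicator (hA i)) (integrable_testFun hA l ν), ih,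
      integral_indicator_const _ (hA i)]
    simp

theorem laplaceTest_eq_exp_integral {A : ℕ → Set E} (hA : ∀ i, MeasurableSet (A i)) (l : List ℕ)
    (ν : Measure E) [IsFiniteMeasure ν] :
    laplaceTest A l ν = Real.exp (-∫ z, testFun A l z ∂ν) := by
  rw [integral_testFun hA, laplaceTest]

theorem integral_config {n : ℕ} (x : Fin n → E) {f : E → ℝ} (hf : Measurable f) :
    ∫ z, f z ∂(config x) = ∑ j, f (x j) := by
  rw [config, integral_finsetSum_measure fun i _ => ?_]
  · exact Finset.sum_congr rfl fun i _ => integral_dirac' _ _ hf.stronglyMeasurable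
  · exact (integrable_dirac' hf.stronglyMeasurable (by simp))

theorem laplaceTest_config {A : ℕ → Set E} (hA : ∀ i, MeasurableSet (A i)) (l : List ℕ) {n : ℕ}
    (x : Fin n → E) : laplaceTest A l (config x) = ∏ j, Real.exp (-testFun A l (x j)) := by
  rw [laplaceTest_eq_exp_integral hA, integral_config x (measurable_testFun hA l),
    ← Finset.sum_neg_distrib, Real.exp_sum]

/-- A finite simple point process whose factorial moment measures `M k` satisfy
`∑ k, M k (univ) / k! < ∞` is determined by them. -/
theorem IsTestSystem.ext_of_momentMeasure [MeasurableEq E] {A : ℕ → Set E} (hA : IsTestSystem A)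
    {P Q : Measure (Measure E)} [IsFiniteMeasure P] [IsFiniteMeasure Q]
    (hP : ∀ᵐ ν ∂P, ∃ (n : ℕ) (x : Fin n → E), Function.Injective x ∧ ν = config x)
    (hQ : ∀ᵐ ν ∂Q, ∃ (n : ℕ) (x : Fin n → E), Function.Injective x ∧ ν = config x)
    (hM : ∀ k, momentMeasure k P = momentMeasure k Q)
    (hfin : ∑' k : ℕ, (k.factorial : ℝ≥0∞)⁻¹ * momentMeasure k P Set.univ ≠ ∞) : P = Q := by
  have hlt : ∀ {P' : Measure (Measure E)}, (∀ᵐ ν ∂P', ∃ (n : ℕ) (x : Fin n → E),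
      Function.Injective x ∧ ν = config x) → ∀ᵐ ν ∂P', ν Set.univ < ∞ := by
    intro P' hP'
    filter_upwards [hP'] with ν ⟨n, x, _, hν⟩
    rw [hν]
    exact measure_lt_top _ _
  refine hA.ext_of_lintegral_laplaceTest (hlt hP) (hlt hQ) fun l => ?_
  set g : E → ℝ := fun z => 1 - Real.exp (-testFun A l z) with hgdef
  have hg : Measurable g :=
    measurable_const.sub (Real.measurable_exp.comp (measurable_testFun hA.measurableSet l).neg)
  have hg0 : ∀ z, 0 ≤ g z := fun z =>
    sub_nonneg.2 (Real.exp_le_one_iff.2 (neg_nonpos.2 (testFun_nonneg A l z)))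
  have hg1 : ∀ z, g z ≤ 1 := fun z => sub_le_self _ (Real.exp_pos _).le
  have hgm := hg.ennreal_ofReal
  set T : ℕ → ℝ≥0∞ := fun k => (k.factorial : ℝ≥0∞)⁻¹ *
    ∫⁻ y, ∏ j, ENNReal.ofReal (g (y j)) ∂(momentMeasure k P) with hT
  have hT' : ∀ k, T k ≤ (k.factorial : ℝ≥0∞)⁻¹ * momentMeasure k P Set.univ := by
    intro k
    rw [hT, ← lintegral_one (μ := momentMeasure k P)]
    refine mul_le_mul' le_rfl (lintegral_mono fun y => Finset.prod_le_one' fun j _ => ?_)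
    exact ENNReal.ofReal_le_one.2 (hg1 _)
  have hodd : ∑' k, T (2 * k + 1) ≠ ∞ := by
    refine ne_top_of_le_ne_top hfin ((ENNReal.tsum_comp_le_tsum_of_injective
      (f := fun k : ℕ => 2 * k + 1) (fun a b h => by simpa using h) T).trans
      (ENNReal.tsum_le_tsum hT'))
  have key : ∀ {P' : Measure (Measure E)}, (∀ᵐ ν ∂P', ∃ (n : ℕ) (x : Fin n → E),
      Function.Injective x ∧ ν = config x) → (∀ k, momentMeasure k P = momentMeasure k P') →
      ∫⁻ ν, ENNReal.ofReal (laplaceTest A l ν) ∂P' + ∑' k, T (2 * k + 1) = ∑' k, T (2 * k) := by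
    intro P' hP' hM'
    have h1 : ∀ k, T k = ∫⁻ ν, distinctPower (fun z => ENNReal.ofReal (g z)) k ν ∂P' := by
      intro k
      rw [lintegral_distinctPower (hlt hP') hgm, ← hM' k]
    simp_rw [h1]
    rw [← lintegral_tsum fun k => (measurable_distinctPower hgm _).aemeasurable,
      ← lintegral_tsum fun k => (measurable_distinctPower hgm _).aemeasurable,
      ← lintegral_add_left (measurable_laplaceTest hA.measurableSet l).ennreal_ofReal]
    refine lintegral_congr_ae ?_
    filter_upwards [hP'] with ν ⟨n, x, hx, hν⟩
    rw [hν, ← ofReal_prod_one_sub_add_tsum hg hg0 hg1 hx, laplaceTest_config hA.measurableSet]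
    simp [hgdef]
  exact (ENNReal.add_left_inj hodd).1 ((key hP fun k => rfl).trans (key hQ hM).symm)

end TestFun

section Determinantal

variable {q : ℕ} {R : Set (EuclideanSpace ℝ (Fin q))}
  {C K : EuclideanSpace ℝ (Fin q) → EuclideanSpace ℝ (Fin q) → ℂ}
  {c : ℕ → ℝ} {φ : ℕ → EuclideanSpace ℝ (Fin q) → ℂ}

/-- A determinantal point process is determined by its kernel: the sum of its factorial moments
`M k (univ) / k!` is the Fredholm determinant of `1 + K`, which is finite. -/
theorem IsDPP.eq_detProcess (hR : MeasurableSet R) (hC : HasSpectralRepresentation R C c φ)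
    (hK : HasSpectralRepresentation R K (fun h => c h / (1 + c h)) φ)
    {P : Measure (Measure (EuclideanSpace ℝ (Fin q)))} (hP : IsDPP R K P) :
    P = detProcess R C := by
  obtain ⟨A, hA, -⟩ := exists_isTestSystem_isBounded (EuclideanSpace ℝ (Fin q))
  have hQ := isDPP_detProcess hR hC hK
  have := hP.prob
  have := hQ.prob
  have hs : ∀ {P' : Measure (Measure (EuclideanSpace ℝ (Fin q)))}, IsDPP R K P' →
      ∀ᵐ ν ∂P', ∃ (n : ℕ) (x : Fin n → EuclideanSpace ℝ (Fin q)),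
        Function.Injective x ∧ ν = config x := by
    intro P' hP'
    filter_upwards [hP'.simple] with ν ⟨n, x, hx, _, hν⟩
    exact ⟨n, x, hx, hν⟩
  refine hA.ext_of_momentMeasure (hs hP) (hs hQ) (fun k => by rw [hP.moment, hQ.moment]) ?_
  have h1 : ∀ k : ℕ, momentMeasure k P Set.univ = ∫⁻ x : Fin k → EuclideanSpace ℝ (Fin q),
      detWeight (cutKernel R K) x ∂(Measure.pi fun _ => volume.restrict R) := by
    intro k
    rw [hP.moment, withDensity_apply _ MeasurableSet.univ, Measure.restrict_univ]
    refine lintegral_congr_ae ?_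
    filter_upwards [ae_pi_restrict_mem hR k] with x hx
    exact (detWeight_congr fun i j => cutKernel_apply (hx i) (hx j)).symm
  simp_rw [h1]
  exact fredholmDet_ne_top (hK.isMercerKernel hR)

end Determinantal

/-! ### Compact operators on separable Hilbert spaces -/

section Compact

open scoped InnerProductSpace
open Module.End

variable {ℋ : Type*} [NormedAddCommGroup ℋ] [InnerProductSpace ℂ ℋ]

/-- Diagonal operators with entries tending to zero are compact. -/
theorem exists_isCompactOperator_diagonal (b : HilbertBasis ℕ ℂ ℋ) {a : ℕ → ℝ}
    (ha : Filter.Tendsto a Filter.atTop (nhds 0)) :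
    ∃ D : ℋ →L[ℂ] ℋ, IsCompactOperator D ∧ ∀ v h, ⟪b h, D v⟫_ℂ = a h * ⟪b h, v⟫_ℂ := by
  obtain ⟨B, hB⟩ : ∃ B, ∀ h, |a h| ≤ B := by
    obtain ⟨B, hB⟩ := (Metric.isBounded_range_of_tendsto a ha).exists_norm_le
    exact ⟨B, fun h => hB _ ⟨h, rfl⟩⟩
  have hB0 : 0 ≤ B := (abs_nonneg _).trans (hB 0)
  have hmem : ∀ v : lp (fun _ : ℕ => ℂ) 2, Memℓp (fun h => (a h : ℂ) * v h) 2 := fun v =>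
    ((lp.memℓp v).const_smul (B : ℂ)).mono' fun h => by
      rw [norm_mul, Pi.smul_apply, norm_smul, Complex.norm_real, Complex.norm_real]
      exact mul_le_mul_of_nonneg_right ((hB h).trans (le_abs_self B)) (norm_nonneg _)
  let L : lp (fun _ : ℕ => ℂ) 2 →ₗ[ℂ] lp (fun _ : ℕ => ℂ) 2 :=
    { toFun := fun v => ⟨fun h => (a h : ℂ) * v h, hmem v⟩
      map_add' := fun v w => lp.ext (funext fun h => mul_add _ _ _)
      map_smul' := fun r v => lp.ext (funext fun h => mul_left_comm _ _ _) }
  let D₀ : lp (fun _ : ℕ => ℂ) 2 →L[ℂ] lp (fun _ : ℕ => ℂ) 2 := L.mkContinuous B fun v => by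
    have h1 : ‖L v‖ ≤ ‖(B : ℂ) • v‖ := lp.norm_mono (by simp) fun h => by
      rw [lp.coeFn_smul, Pi.smul_apply, norm_smul, Complex.norm_real]
      change ‖(a h : ℂ) * v h‖ ≤ _
      rw [norm_mul, Complex.norm_real]
      exact mul_le_mul_of_nonneg_right ((hB h).trans (le_abs_self B)) (norm_nonneg _)
    rwa [norm_smul, Complex.norm_real, Real.norm_of_nonneg hB0] at h1
  have hD₀ : ∀ v h, D₀ v h = a h * v h := fun v h => rfl
  let F : ℕ → lp (fun _ : ℕ => ℂ) 2 →L[ℂ] lp (fun _ : ℕ => ℂ) 2 := fun N =>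
    ∑ h ∈ Finset.range N, (a h : ℂ) • ((lp.singleContinuousLinearMap ℂ (fun _ : ℕ => ℂ) 2 h).comp
      (lp.evalCLM ℂ (fun _ : ℕ => ℂ) 2 h))
  have hFapply : ∀ N v l, F N v l = if l < N then (a l : ℂ) * v l else 0 := by
    intro N v l
    have h1 : F N v = ∑ h ∈ Finset.range N, (a h : ℂ) • lp.single 2 h (v h) := by
      simp only [F, _root_.sum_apply]
      rfl
    rw [h1, lp.coeFn_sum, Finset.sum_apply]
    simp only [lp.coeFn_smul, Pi.smul_apply, lp.single_apply, Pi.single_apply, smul_eq_mul,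
      mul_ite, mul_zero]
    simp
  have hFc : ∀ N, IsCompactOperator (F N) := by
    intro N
    have h1 : ∀ s : Finset ℕ, IsCompactOperator
        (∑ h ∈ s, (a h : ℂ) • ((lp.singleContinuousLinearMap ℂ (fun _ : ℕ => ℂ) 2 h).comp
          (lp.evalCLM ℂ (fun _ : ℕ => ℂ) 2 h)) :
            lp (fun _ : ℕ => ℂ) 2 →L[ℂ] lp (fun _ : ℕ => ℂ) 2) := by
      intro s
      induction s using Finset.induction_on with
      | empty => simpa using isCompactOperator_zero
      | insert h s hs ih =>
        rw [Finset.sum_insert hs]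
        refine IsCompactOperator.add (IsCompactOperator.smul ?_ _) ih
        have h2 : IsCompactOperator (lp.evalCLM ℂ (fun _ : ℕ => ℂ) 2 h) :=
          isCompactOperator_of_locallyCompactSpace_dom _
        exact h2.clm_comp (lp.singleContinuousLinearMap ℂ (fun _ : ℕ => ℂ) 2 h)
    exact h1 _
  have hlim : Filter.Tendsto F Filter.atTop (nhds D₀) := by
    rw [Metric.tendsto_atTop]
    intro ε hε
    obtain ⟨N, hN⟩ := Metric.tendsto_atTop.1 ha (ε / 2) (by positivity)
    refine ⟨N, fun n hn => ?_⟩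
    rw [dist_eq_norm]
    refine (ContinuousLinearMap.opNorm_le_bound _ (by positivity : 0 ≤ ε / 2) fun v => ?_).trans_lt
      (half_lt_self hε)
    have h1 : ‖(F n - D₀) v‖ ≤ ‖((ε / 2 : ℝ) : ℂ) • v‖ := lp.norm_mono (by simp) fun h => by
      rw [lp.coeFn_smul, Pi.smul_apply, norm_smul, Complex.norm_real,
        Real.norm_of_nonneg (by positivity)]
      change ‖F n v h - D₀ v h‖ ≤ _
      rw [hFapply, hD₀]
      split_ifs with hh
      · simp only [sub_self, norm_zero]
        positivity
      · rw [zero_sub, norm_neg, norm_mul, Complex.norm_real]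
        have := hN h (hn.trans (not_lt.1 hh))
        rw [dist_zero_right] at this
        exact mul_le_mul_of_nonneg_right this.le (norm_nonneg _)
    rwa [norm_smul, Complex.norm_real, Real.norm_of_nonneg (by positivity)] at h1
  have hD₀c : IsCompactOperator D₀ :=
    isCompactOperator_of_tendsto hlim (Filter.Eventually.of_forall hFc)
  let e₁ : lp (fun _ : ℕ => ℂ) 2 →L[ℂ] ℋ := b.repr.symm.toContinuousLinearEquiv
  let e₂ : ℋ →L[ℂ] lp (fun _ : ℕ => ℂ) 2 := b.repr.toContinuousLinearEquiv
  refine ⟨e₁.comp (D₀.comp e₂), (hD₀c.comp_clm e₂).clm_comp e₁, fun v h => ?_⟩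
  rw [← b.repr_apply_apply, ← b.repr_apply_apply]
  change b.repr (b.repr.symm (D₀ (b.repr v))) h = _
  rw [LinearIsometryEquiv.apply_symm_apply, hD₀]

theorem HilbertBasis.countable_index {ι : Type*} (b : HilbertBasis ℕ ℂ ℋ) {f : ι → ℋ}
    (hf : Orthonormal ℂ f) : Countable ι := by
  have h1 : ∀ h : ℕ, {i | ⟪b h, f i⟫_ℂ ≠ 0}.Countable := by
    intro h
    have hs := (hf.inner_products_summable (b h)).countable_support
    refine hs.mono fun i hi => ?_
    rw [Function.mem_support]
    have : ⟪f i, b h⟫_ℂ ≠ 0 := by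
      rw [← inner_conj_symm]
      exact (map_ne_zero _).2 hi
    simpa using this
  have h2 : (⋃ h : ℕ, {i | ⟪b h, f i⟫_ℂ ≠ 0}) = Set.univ := by
    refine Set.eq_univ_of_forall fun i => ?_
    by_contra hi
    simp only [Set.mem_iUnion, Set.mem_ofPred_eq, not_exists, not_not] at hi
    have h3 : f i = 0 := by
      have h4 := b.hasSum_repr (f i)
      simp_rw [b.repr_apply_apply, hi, zero_smul] at h4
      exact h4.unique hasSum_zero
    exact hf.ne_zero i h3
  exact Set.countable_univ_iff.1 (h2 ▸ Set.countable_iUnion h1)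

variable [CompleteSpace ℋ]

/-- The spectral theorem for compact symmetric operators on an infinite dimensional separable
Hilbert space. -/
theorem exists_hilbertBasis_eigenvectors (b : HilbertBasis ℕ ℂ ℋ) {G : ℋ →L[ℂ] ℋ}
    (hG : IsCompactOperator G) (hG' : G.IsSymmetric) :
    ∃ f : HilbertBasis ℕ ℂ ℋ, ∀ n, ∃ μ : ℂ, G (f n) = μ • f n := by
  let V : ℂ → Submodule ℂ ℋ := fun μ => eigenspace (G : Module.End ℂ ℋ) μ
  have hV : ∀ μ, CompleteSpace (V μ) := fun μ =>
    (ContinuousLinearMap.isClosed_eigenspace G μ).completeSpace_coe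
  choose w e he using fun μ => exists_hilbertBasis ℂ (V μ)
  have horth := (LinearMap.IsSymmetric.orthogonalFamily_eigenspaces hG').orthonormal_sigma_orthonormal
    fun μ => (e μ).orthonormal
  set v : (Σ μ : ℂ, w μ) → ℋ := fun p => ((e p.1 p.2 : V p.1) : ℋ) with hv
  have horth' : Orthonormal ℂ v := horth
  have hbot : (Submodule.span ℂ (Set.range v))ᗮ = ⊥ := by
    rw [Submodule.eq_bot_iff]
    intro x hx
    have h1 : x ∈ (⨆ μ, V μ)ᗮ := by
      rw [← Submodule.iInf_orthogonal, Submodule.mem_iInf]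
      intro μ z hz
      have h2 := ((e μ).hasSum_repr ⟨z, hz⟩).mapL (V μ).subtypeL
      have h3 := h2.mapL (innerSL ℂ x)
      have h4 : ∀ i, (innerSL ℂ x) ((V μ).subtypeL ((e μ).repr ⟨z, hz⟩ i • (e μ) i)) = 0 := by
        intro i
        rw [map_smul, map_smul, innerSL_apply_apply]
        have h5 : ⟪((e μ i : V μ) : ℋ), x⟫_ℂ = 0 :=
          hx _ (Submodule.subset_span ⟨⟨μ, i⟩, rfl⟩)
        have h6 : ⟪x, ((e μ i : V μ) : ℋ)⟫_ℂ = 0 := by rw [← inner_conj_symm, h5, map_zero]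
        change _ • ⟪x, ((e μ i : V μ) : ℋ)⟫_ℂ = 0
        rw [h6, smul_zero]
      simp_rw [h4] at h3
      have h7 : ⟪x, z⟫_ℂ = 0 := h3.unique hasSum_zero
      rw [← inner_conj_symm, h7, map_zero]
    rw [ContinuousLinearMap.orthogonalComplement_iSup_eigenspaces_eq_bot hG hG'] at h1
    exact (Submodule.mem_bot ℂ).1 h1
  have hcount : Countable (Σ μ : ℂ, w μ) := b.countable_index horth'
  have hinf : Infinite (Σ μ : ℂ, w μ) := by
    by_contra hfin
    have hfin' : Finite (Σ μ : ℂ, w μ) := not_infinite_iff_finite.1 hfin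
    have : Fintype (Σ μ : ℂ, w μ) := Fintype.ofFinite _
    have : Module.Finite ℂ ℋ := Module.Finite.of_basis
      (HilbertBasis.mkOfOrthogonalEqBot horth' hbot).toOrthonormalBasis.toBasis
    have h1 : Finite ℕ := b.orthonormal.linearIndependent.finite_of_isNoetherian
    exact not_finite ℕ
  obtain ⟨ε⟩ : Nonempty (ℕ ≃ Σ μ : ℂ, w μ) := by
    obtain ⟨d⟩ := nonempty_denumerable (Σ μ : ℂ, w μ)
    exact ⟨(Denumerable.eqv _).symm⟩
  have horth'' : Orthonormal ℂ (v ∘ ε) := horth'.comp ε ε.injective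
  refine ⟨HilbertBasis.mkOfOrthogonalEqBot horth'' ?_, fun n => ⟨(ε n).1, ?_⟩⟩
  · rw [ε.surjective.range_comp, hbot]
  · rw [HilbertBasis.coe_mkOfOrthogonalEqBot]
    exact mem_eigenspace_iff.1 (e (ε n).1 (ε n).2).2

end Compact

section Singular

open scoped InnerProductSpace
open ContinuousLinearMap (adjoint)

variable {ℋ : Type*} [NormedAddCommGroup ℋ] [InnerProductSpace ℂ ℋ]

theorem HilbertBasis.hasSum_norm_inner_sq {ι : Type*} (b : HilbertBasis ι ℂ ℋ) (v : ℋ) :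
    HasSum (fun i => ‖⟪b i, v⟫_ℂ‖ ^ 2) (‖v‖ ^ 2) := by
  have h1 := b.hasSum_inner_mul_inner v v
  have h2 : ∀ i, ⟪v, b i⟫_ℂ * ⟪b i, v⟫_ℂ = ((‖⟪b i, v⟫_ℂ‖ ^ 2 : ℝ) : ℂ) := by
    intro i
    rw [← inner_conj_symm v (b i), Complex.conj_mul']
    push_cast
    rfl
  have h3 : ⟪v, v⟫_ℂ = ((‖v‖ ^ 2 : ℝ) : ℂ) := by
    rw [inner_self_eq_norm_sq_to_K]
    push_cast
    rfl
  simp_rw [h2] at h1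
  rw [h3] at h1
  exact Complex.hasSum_ofReal.1 h1

/-- A diagonal operator whose squared entries are summable is Hilbert-Schmidt. -/
theorem summable_norm_sq_of_diagonal (b : HilbertBasis ℕ ℂ ℋ) {D : ℋ →L[ℂ] ℋ} {c : ℕ → ℝ}
    (hc : ∀ h, 0 ≤ c h) (hs : Summable c)
    (hD : ∀ v h, ⟪b h, D v⟫_ℂ = (Real.sqrt (c h) : ℝ) * ⟪b h, v⟫_ℂ) {f : ℕ → ℋ}
    (hf : Orthonormal ℂ f) : Summable fun n => ‖D (f n)‖ ^ 2 := by
  have h1 : ∀ v, HasSum (fun h => c h * ‖⟪b h, v⟫_ℂ‖ ^ 2) (‖D v‖ ^ 2) := by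
    intro v
    have h2 := b.hasSum_norm_inner_sq (D v)
    simp_rw [hD, norm_mul, mul_pow, Complex.norm_real, Real.norm_eq_abs, sq_abs,
      Real.sq_sqrt (hc _)] at h2
    exact h2
  refine summable_of_sum_le (c := ∑' h, c h) (fun n => sq_nonneg _) fun s => ?_
  have h2 := hasSum_sum fun (n : ℕ) (_ : n ∈ s) => h1 (f n)
  refine hasSum_le (fun h => ?_) h2 hs.hasSum
  rw [← Finset.mul_sum]
  refine mul_le_of_le_one_right (hc h) ?_
  have h3 := hf.sum_inner_products_le (s := s) (b h)
  rw [b.orthonormal.norm_eq_one, one_pow] at h3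
  refine le_trans (le_of_eq (Finset.sum_congr rfl fun n _ => ?_)) h3
  rw [norm_inner_symm]

variable [CompleteSpace ℋ] {T : ℋ →L[ℂ] ℋ}

/-- Right singular vectors of a compact operator. -/
theorem exists_hilbertBasis_singular (b : HilbertBasis ℕ ℂ ℋ) (hT : IsCompactOperator T) :
    ∃ f : HilbertBasis ℕ ℂ ℋ,
      ∀ n, adjoint T (T (f n)) = ((‖T (f n)‖ ^ 2 : ℝ) : ℂ) • f n := by
  have hG : IsCompactOperator ((adjoint T).comp T) := hT.clm_comp (adjoint T)
  have hG' : ((adjoint T).comp T).IsSymmetric := fun x y => by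
    change ⟪adjoint T (T x), y⟫_ℂ = ⟪x, adjoint T (T y)⟫_ℂ
    rw [ContinuousLinearMap.adjoint_inner_left, ContinuousLinearMap.adjoint_inner_right]
  obtain ⟨f, hf⟩ := exists_hilbertBasis_eigenvectors b hG hG'
  refine ⟨f, fun n => ?_⟩
  obtain ⟨μ, hμ⟩ := hf n
  have hμ' : adjoint T (T (f n)) = μ • f n := hμ
  have h1 : ⟪f n, adjoint T (T (f n))⟫_ℂ = μ := by
    rw [hμ', inner_smul_right, inner_self_eq_norm_sq_to_K, f.orthonormal.norm_eq_one]
    simp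
  rw [ContinuousLinearMap.adjoint_inner_right, inner_self_eq_norm_sq_to_K] at h1
  rw [hμ', ← h1]
  push_cast
  rfl

/-- Parseval's identity along the left singular vectors `T (f n) / ‖T (f n)‖`, which span the
orthogonal complement of the kernel of the adjoint. -/
theorem hasSum_inner_singular {f : HilbertBasis ℕ ℂ ℋ}
    (hf : ∀ n, adjoint T (T (f n)) = ((‖T (f n)‖ ^ 2 : ℝ) : ℂ) • f n) (v w : ℋ)
    (hw : ∀ z, adjoint T z = 0 → ⟪z, w⟫_ℂ = 0) :
    HasSum (fun n => ((‖T (f n)‖ ^ 2 : ℝ) : ℂ)⁻¹ * (⟪v, T (f n)⟫_ℂ * ⟪T (f n), w⟫_ℂ))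
      ⟪v, w⟫_ℂ := by
  let S : Set ℕ := {n | T (f n) ≠ 0}
  let g : S → ℋ := fun n => ((‖T (f n)‖ : ℝ) : ℂ)⁻¹ • T (f n)
  have hg : Orthonormal ℂ g := by
    refine ⟨fun n => ?_, fun n m hnm => ?_⟩
    · exact norm_smul_inv_norm n.2
    · have h1 : ⟪T (f n), T (f m)⟫_ℂ = 0 := by
        rw [← ContinuousLinearMap.adjoint_inner_right, hf, inner_smul_right,
          f.orthonormal.inner_eq_zero fun h => hnm (Subtype.ext h), mul_zero]
      change ⟪_ • T (f n), _ • T (f m)⟫_ℂ = 0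
      rw [inner_smul_left, inner_smul_right, h1, mul_zero, mul_zero]
  obtain ⟨W, B, hW, hB⟩ := hg.toSubtypeRange.exists_hilbertBasis_extension
  let e : S → W := fun n => ⟨g n, hW ⟨n, rfl⟩⟩
  have he : Function.Injective e := fun n m h =>
    hg.linearIndependent.injective (congrArg Subtype.val h)
  have h0 : ∀ z : W, z ∉ Set.range e → ⟪v, B z⟫_ℂ * ⟪B z, w⟫_ℂ = 0 := by
    intro z hz
    rw [hw (B z), mul_zero]
    have h1 : ∀ n, ⟪f n, adjoint T (B z)⟫_ℂ = 0 := by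
      intro n
      rw [ContinuousLinearMap.adjoint_inner_right]
      by_cases hn : T (f n) = 0
      · rw [hn, inner_zero_left]
      · have h2 : ⟪B (e ⟨n, hn⟩), B z⟫_ℂ = 0 :=
          B.orthonormal.inner_eq_zero fun h => hz ⟨_, h⟩
        rw [hB] at h2 ⊢
        have h3 : ⟪((‖T (f n)‖ : ℝ) : ℂ)⁻¹ • T (f n), (z : ℋ)⟫_ℂ = 0 := h2
        rw [inner_smul_left] at h3
        refine (mul_eq_zero.1 h3).resolve_left ?_
        simpa using hn
    have h4 := f.hasSum_repr (adjoint T (B z))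
    simp_rw [f.repr_apply_apply, h1, zero_smul] at h4
    exact h4.unique hasSum_zero
  have h1 := (he.hasSum_iff h0).2 (B.hasSum_inner_mul_inner v w)
  have h2 : Function.support (fun n => ((‖T (f n)‖ ^ 2 : ℝ) : ℂ)⁻¹ *
      (⟪v, T (f n)⟫_ℂ * ⟪T (f n), w⟫_ℂ)) ⊆ S := by
    intro n hn h
    rw [Function.mem_support, h] at hn
    simp at hn
  refine (hasSum_subtype_iff_of_support_subset h2).1 ?_
  convert h1 using 1
  funext n
  simp only [Function.comp_apply, hB]
  change _ = ⟪v, ((‖T (f n)‖ : ℝ) : ℂ)⁻¹ • T (f n)⟫_ℂ * ⟪((‖T (f n)‖ : ℝ) : ℂ)⁻¹ • T (f n), w⟫_ℂ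
  rw [inner_smul_left, inner_smul_right, map_inv₀, Complex.conj_ofReal]
  push_cast
  rw [sq, mul_inv]
  ring

/-- If `C x z = ⟪Ψ x, Ψ z⟫` for feature vectors `Ψ x` with coordinates `√(c h) * conj (φ h x)`, then
the Schur complement of `C` with respect to points `y i`, times `t`, is the kernel of the feature
vectors `Θ x = √t P (Ψ x)` with `P` the projection onto the orthogonal complement of the span of the
vectors `Ψ (y i)`. The map `w ↦ ⟪Θ x, w⟫` is the evaluation at `x` of the adjoint of `√t P D` with
`D` the diagonal operator with entries `√(c h)`. -/
theorem HilbertBasis.exists_projected_feature (b : HilbertBasis ℕ ℂ ℋ) {c : ℕ → ℝ}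
    (hc : ∀ h, 0 ≤ c h) (hs : Summable c) {X : Type*} {R : Set X} {φ : ℕ → X → ℂ} {Ψ : X → ℋ}
    {C : X → X → ℂ}
    (hΨ : ∀ x ∈ R, ∀ h, ⟪b h, Ψ x⟫_ℂ = (Real.sqrt (c h) : ℝ) * conj (φ h x))
    (hΨC : ∀ x ∈ R, ∀ z ∈ R, ⟪Ψ x, Ψ z⟫_ℂ = C x z) {k : ℕ} {y : Fin k → X}
    (hy : ∀ i, y i ∈ R) (hdet : IsUnit (kernelMatrix C y).det) {t : ℝ} (ht : 0 ≤ t) :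
    ∃ (T : ℋ →L[ℂ] ℋ) (Θ : X → ℋ), IsCompactOperator T ∧
      (∀ f : ℕ → ℋ, Orthonormal ℂ f → Summable fun n => ‖T (f n)‖ ^ 2) ∧
      (∀ x ∈ R, ∀ w, HasSum (fun h => ⟪b h, adjoint T w⟫_ℂ * φ h x) ⟪Θ x, w⟫_ℂ) ∧
      ∀ x ∈ R, ∀ z ∈ R, ⟪Θ x, Θ z⟫_ℂ = (t : ℂ) *
        (C x z - ∑ i, ∑ j, (kernelMatrix C y)⁻¹ i j * C x (y i) * C (y j) z) := by
  have hlim : Filter.Tendsto (fun h => Real.sqrt (c h)) Filter.atTop (nhds 0) := by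
    have h1 := (Real.continuous_sqrt.tendsto 0).comp hs.tendsto_atTop_zero
    rwa [Real.sqrt_zero] at h1
  obtain ⟨D, hDc, hD⟩ := exists_isCompactOperator_diagonal b hlim
  let U : Submodule ℂ ℋ := Submodule.span ℂ (Set.range fun i => Ψ (y i))
  have hU : FiniteDimensional ℂ U := FiniteDimensional.span_of_finite ℂ (Set.finite_range _)
  let P : ℋ →L[ℂ] ℋ := Uᗮ.starProjection
  have hP : ∀ v w, ⟪P v, w⟫_ℂ = ⟪v, P w⟫_ℂ := fun v w =>
    Submodule.inner_starProjection_left_eq_right Uᗮ v w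
  have hPP : ∀ v, P (P v) = P v := fun v =>
    Submodule.starProjection_eq_self_iff.2 (Submodule.starProjection_apply_mem Uᗮ v)
  have hPle : ∀ v, ‖P v‖ ≤ ‖v‖ := fun v => Submodule.norm_starProjection_apply_le Uᗮ v
  have hPΨ : ∀ z ∈ R, P (Ψ z) = Ψ z -
      ∑ i, (∑ j, (kernelMatrix C y)⁻¹ i j * C (y j) z) • Ψ (y i) := by
    intro z hz
    refine Submodule.eq_starProjection_of_mem_orthogonal (K := Uᗮ) ?_ ?_
    · refine (Submodule.mem_orthogonal U _).2 fun u hu => ?_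
      induction hu using Submodule.span_induction with
      | mem u hu =>
        obtain ⟨l, rfl⟩ := hu
        simp only [inner_sub_right, inner_sum, inner_smul_right]
        rw [hΨC _ (hy l) z hz, sub_eq_zero]
        simp_rw [hΨC _ (hy l) _ (hy _)]
        have h1 : (kernelMatrix C y * (kernelMatrix C y)⁻¹).mulVec (fun j => C (y j) z) l =
            C (y l) z := by
          rw [Matrix.mul_nonsing_inv _ hdet, Matrix.one_mulVec]
        rw [← h1, ← Matrix.mulVec_mulVec]
        simp only [Matrix.mulVec, dotProduct]
        exact Finset.sum_congr rfl fun i _ => mul_comm _ _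
      | zero => rw [inner_zero_left]
      | add u v _ _ hu hv => rw [inner_add_left, hu, hv, add_zero]
      | smul r u _ hu => rw [inner_smul_left, hu, mul_zero]
    · rw [sub_sub_cancel]
      refine Submodule.le_orthogonal_orthogonal U (Submodule.sum_mem _ fun i _ =>
        Submodule.smul_mem _ _ (Submodule.subset_span ⟨i, rfl⟩))
  have hDb : ∀ h, D (b h) = ((Real.sqrt (c h) : ℝ) : ℂ) • b h := by
    intro h
    refine b.repr.injective (lp.ext (funext fun l => ?_))
    rw [b.repr_apply_apply, b.repr_apply_apply, hD, inner_smul_right]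
    by_cases hl : l = h
    · rw [hl]
    · rw [b.orthonormal.inner_eq_zero hl, mul_zero, mul_zero]
  let s : ℂ := (Real.sqrt t : ℝ)
  have hss : s * s = t := by
    rw [← Complex.ofReal_mul, Real.mul_self_sqrt ht]
  have hsconj : conj s = s := Complex.conj_ofReal _
  let T : ℋ →L[ℂ] ℋ := s • (P.comp D)
  have hTapply : ∀ v, T v = s • P (D v) := fun v => rfl
  refine ⟨T, fun x => s • P (Ψ x), (hDc.clm_comp P).smul s, fun f hf => ?_, fun x hx w => ?_,
    fun x hx z hz => ?_⟩
  · refine ((summable_norm_sq_of_diagonal b hc hs hD hf).mul_left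
      (‖s‖ ^ 2)).of_nonneg_of_le (fun n => sq_nonneg _) fun n => ?_
    rw [hTapply, norm_smul, mul_pow]
    exact mul_le_mul_of_nonneg_left (pow_le_pow_left₀ (norm_nonneg _) (hPle _) 2) (sq_nonneg _)
  · have h1 := (b.hasSum_inner_mul_inner (Ψ x) (P w)).mul_left s
    rw [inner_smul_left, hP, hsconj]
    refine h1.congr_fun fun h => ?_
    rw [ContinuousLinearMap.adjoint_inner_right, hTapply, inner_smul_left, hP, hDb,
      inner_smul_left, ← inner_conj_symm (Ψ x) (b h), hΨ x hx, hsconj, Complex.conj_ofReal, map_mul,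
      Complex.conj_conj, Complex.conj_ofReal]
    ring
  · simp only [inner_smul_left, inner_smul_right]
    rw [hsconj, ← mul_assoc, hss, hP, hPP, hPΨ z hz,
      inner_sub_right, hΨC x hx z hz, inner_sum]
    congr 2
    refine Finset.sum_congr rfl fun i _ => ?_
    rw [inner_smul_right, hΨC x hx _ (hy i), Finset.sum_mul]
    refine Finset.sum_congr rfl fun j _ => ?_
    ring

end Singular

/-! ### Mercer expansions from feature maps -/

section Mercer

open scoped InnerProductSpace
open ContinuousLinearMap (adjoint)

variable {q : ℕ} {R : Set (EuclideanSpace ℝ (Fin q))}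
  {C : EuclideanSpace ℝ (Fin q) → EuclideanSpace ℝ (Fin q) → ℂ}
  {c : ℕ → ℝ} {φ : ℕ → EuclideanSpace ℝ (Fin q) → ℂ}

/-- The functions of a spectral representation as a Hilbert basis of `L²(R)`. -/
noncomputable def HasSpectralRepresentation.hilbertBasis (hC : HasSpectralRepresentation R C c φ) :
    HilbertBasis ℕ ℂ (Lp ℂ 2 (volume.restrict R)) :=
  HilbertBasis.mk hC.orthonormal hC.complete.ge

theorem HasSpectralRepresentation.hilbertBasis_apply (hC : HasSpectralRepresentation R C c φ)
    (h : ℕ) : hC.hilbertBasis h = (hC.memLp h).toLp := by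
  rw [hilbertBasis, HilbertBasis.coe_mk]

/-- If the Fourier series of an element of `L²(R)` converges at every point of `R`, then the
pointwise limit represents this element. -/
theorem HasSpectralRepresentation.ae_eq_of_hasSum (hR : MeasurableSet R)
    (hC : HasSpectralRepresentation R C c φ) {v : Lp ℂ 2 (volume.restrict R)}
    {g : EuclideanSpace ℝ (Fin q) → ℂ}
    (hg : ∀ x ∈ R, HasSum (fun h => ⟪hC.hilbertBasis h, v⟫_ℂ * φ h x) (g x)) :
    g =ᵐ[volume.restrict R] v := by
  set b := hC.hilbertBasis with hb
  have h1 := (b.hasSum_repr v).tendsto_sum_nat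
  obtain ⟨ns, hns, hlim⟩ := (tendstoInMeasure_of_tendsto_Lp h1).exists_seq_tendsto_ae
  have h2 : ∀ N : ℕ, (∑ h ∈ Finset.range N, b.repr v h • b h : Lp ℂ 2 (volume.restrict R))
      =ᵐ[volume.restrict R] fun x => ∑ h ∈ Finset.range N, ⟪b h, v⟫_ℂ * φ h x := by
    intro N
    induction N with
    | zero =>
      simp only [Finset.range_zero, Finset.sum_empty]
      exact Lp.coeFn_zero _ _ _
    | succ N ih =>
      rw [Finset.sum_range_succ]
      have h3 : (b N : EuclideanSpace ℝ (Fin q) → ℂ) =ᵐ[volume.restrict R] φ N := by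
        rw [hb, hC.hilbertBasis_apply]
        exact (hC.memLp N).coeFn_toLp
      filter_upwards [ih, h3, Lp.coeFn_smul (b.repr v N) (b N),
        Lp.coeFn_add (∑ h ∈ Finset.range N, b.repr v h • b h) (b.repr v N • b N)]
        with x hx1 hx2 hx3 hx4
      rw [hx4, Pi.add_apply, hx1, hx3, Pi.smul_apply, hx2, Finset.sum_range_succ,
        b.repr_apply_apply, smul_eq_mul]
  filter_upwards [hlim, ae_all_iff.2 h2, ae_restrict_mem hR] with x hx1 hx2 hxR
  have h4 := ((hg x hxR).tendsto_sum_nat).comp hns.tendsto_atTop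
  refine tendsto_nhds_unique h4 ?_
  refine hx1.congr fun i => ?_
  rw [hx2]
  rfl

/-- A kernel of the form `⟪Θ x, Θ z⟫` has a spectral representation if `w ↦ ⟪Θ ·, w⟫` is, pointwise
on `R`, the adjoint of a Hilbert-Schmidt operator `T` on `L²(R)`: the right singular vectors `f n`
of `T` have the pointwise defined versions `⟪Θ ·, T (f n)⟫ / ‖T (f n)‖ ^ 2`. -/
theorem HasSpectralRepresentation.exists_of_featureMap (hR : MeasurableSet R)
    (hC : HasSpectralRepresentation R C c φ)
    {T : Lp ℂ 2 (volume.restrict R) →L[ℂ] Lp ℂ 2 (volume.restrict R)} (hT : IsCompactOperator T)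
    (hT' : ∀ f : ℕ → Lp ℂ 2 (volume.restrict R), Orthonormal ℂ f →
      Summable fun n => ‖T (f n)‖ ^ 2)
    {Θ : EuclideanSpace ℝ (Fin q) → Lp ℂ 2 (volume.restrict R)}
    (hΘ : ∀ x ∈ R, ∀ w,
      HasSum (fun h => ⟪hC.hilbertBasis h, adjoint T w⟫_ℂ * φ h x) ⟪Θ x, w⟫_ℂ)
    {C' : EuclideanSpace ℝ (Fin q) → EuclideanSpace ℝ (Fin q) → ℂ}
    (hC' : ∀ x ∈ R, ∀ z ∈ R, C' x z = ⟪Θ x, Θ z⟫_ℂ) :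
    ∃ (c' : ℕ → ℝ) (φ' : ℕ → EuclideanSpace ℝ (Fin q) → ℂ),
      HasSpectralRepresentation R C' c' φ' := by
  classical
  obtain ⟨f, hf⟩ := exists_hilbertBasis_singular hC.hilbertBasis hT
  let φ' : ℕ → EuclideanSpace ℝ (Fin q) → ℂ := fun n =>
    if T (f n) = 0 then (Lp.aestronglyMeasurable (f n)).mk (f n)
    else R.indicator fun x => ((‖T (f n)‖ ^ 2 : ℝ) : ℂ)⁻¹ * ⟪Θ x, T (f n)⟫_ℂ
  have hmeas : ∀ n, Measurable (φ' n) := by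
    intro n
    by_cases hn : T (f n) = 0
    · simp only [φ', if_pos hn]
      exact (Lp.aestronglyMeasurable (f n)).stronglyMeasurable_mk.measurable
    · simp only [φ', if_neg hn]
      refine measurable_of_tendsto_metrizable (f := fun N : ℕ => R.indicator fun x =>
        ((‖T (f n)‖ ^ 2 : ℝ) : ℂ)⁻¹ * ∑ h ∈ Finset.range N,
          ⟪hC.hilbertBasis h, adjoint T (T (f n))⟫_ℂ * φ h x) (fun N => ?_) ?_
      · exact (measurable_const.mul (Finset.measurable_fun_sum _ fun h _ =>
          measurable_const.mul (hC.measurable h))).indicator hR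
      · refine tendsto_pi_nhds.2 fun x => ?_
        by_cases hx : x ∈ R
        · simp only [Set.indicator_of_mem hx]
          exact ((hΘ x hx (T (f n))).tendsto_sum_nat).const_mul _
        · simp only [Set.indicator_of_notMem hx]
          exact tendsto_const_nhds
  have hae : ∀ n, φ' n =ᵐ[volume.restrict R] f n := by
    intro n
    by_cases hn : T (f n) = 0
    · simp only [φ', if_pos hn]
      exact (Lp.aestronglyMeasurable (f n)).ae_eq_mk.symm
    · simp only [φ', if_neg hn]
      refine hC.ae_eq_of_hasSum hR fun x hx => ?_
      rw [Set.indicator_of_mem hx]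
      have h1 := (hΘ x hx (T (f n))).mul_left ((‖T (f n)‖ ^ 2 : ℝ) : ℂ)⁻¹
      have h2 : ((‖T (f n)‖ ^ 2 : ℝ) : ℂ) ≠ 0 := by
        simpa using hn
      refine h1.congr_fun fun h => ?_
      rw [hf, inner_smul_right, mul_assoc, inv_mul_cancel_left₀ h2]
  have hmem : ∀ n, MemLp (φ' n) 2 (volume.restrict R) := fun n =>
    (Lp.memLp (f n)).ae_eq (hae n).symm
  have htoLp : (fun n => (hmem n).toLp) = f := by
    funext n
    exact Lp.ext ((hmem n).coeFn_toLp.trans (hae n))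
  refine ⟨fun n => ‖T (f n)‖ ^ 2, φ', hmeas, hmem, ?_, ?_, fun n => sq_nonneg _,
    hT' f f.orthonormal, fun x hx z hz => ?_⟩
  · rw [htoLp]
    exact f.orthonormal
  · rw [htoLp]
    exact f.dense_span
  · rw [hC' x hx z hz]
    have hz0 : ∀ w, adjoint T w = 0 → ⟪w, Θ z⟫_ℂ = 0 := by
      intro w hw
      have h1 := hΘ z hz w
      simp_rw [hw, inner_zero_right, zero_mul] at h1
      rw [← inner_conj_symm, h1.unique hasSum_zero, map_zero]
    have h1 := hasSum_inner_singular hf (Θ x) (Θ z) hz0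
    convert h1 using 1
    funext n
    by_cases hn : T (f n) = 0
    · simp [hn]
    · simp only [φ', if_neg hn, Set.indicator_of_mem hx, Set.indicator_of_mem hz]
      rw [map_mul, map_inv₀, Complex.conj_ofReal, inner_conj_symm]
      have h2 : ((‖T (f n)‖ ^ 2 : ℝ) : ℂ) ≠ 0 := by
        simpa using hn
      field_simp

/-- The feature vectors `Ψ x`, with `⟪Ψ x, Ψ z⟫ = C x z`. -/
theorem HasSpectralRepresentation.exists_feature (hC : HasSpectralRepresentation R C c φ) :
    ∃ Ψ : EuclideanSpace ℝ (Fin q) → Lp ℂ 2 (volume.restrict R),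
      (∀ x ∈ R, ∀ h, ⟪hC.hilbertBasis h, Ψ x⟫_ℂ = (Real.sqrt (c h) : ℝ) * conj (φ h x)) ∧
      ∀ x ∈ R, ∀ z ∈ R, ⟪Ψ x, Ψ z⟫_ℂ = C x z := by
  set b := hC.hilbertBasis with hb
  have hsq : ∀ h, ((Real.sqrt (c h) : ℝ) : ℂ) * (Real.sqrt (c h) : ℝ) = c h := fun h => by
    rw [← Complex.ofReal_mul, Real.mul_self_sqrt (hC.nonneg h)]
  have hmem : ∀ x ∈ R, Memℓp (fun h => ((Real.sqrt (c h) : ℝ) : ℂ) * conj (φ h x)) 2 := by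
    intro x hx
    refine memℓp_gen ?_
    have h1 := (hC.hasSum x hx x hx).summable.norm
    refine h1.congr fun h => ?_
    rw [ENNReal.toReal_ofNat, Real.rpow_ofNat, norm_mul, norm_mul, norm_mul, RCLike.norm_conj,
      ← hsq h, norm_mul]
    ring
  have hex : ∀ x : EuclideanSpace ℝ (Fin q), ∃ v : Lp ℂ 2 (volume.restrict R),
      x ∈ R → ∀ h, ⟪b h, v⟫_ℂ = (Real.sqrt (c h) : ℝ) * conj (φ h x) := by
    intro x
    by_cases hx : x ∈ R
    · refine ⟨b.repr.symm ⟨_, hmem x hx⟩, fun _ h => ?_⟩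
      rw [← b.repr_apply_apply, LinearIsometryEquiv.apply_symm_apply]
    · exact ⟨0, fun h => absurd h hx⟩
  choose Ψ hΨ using hex
  refine ⟨Ψ, hΨ, fun x hx z hz => ?_⟩
  refine (b.hasSum_inner_mul_inner (Ψ x) (Ψ z)).unique ?_
  refine (hC.hasSum x hx z hz).congr_fun fun h => ?_
  rw [← inner_conj_symm, hΨ x hx, hΨ z hz, map_mul, Complex.conj_conj, Complex.conj_ofReal, ← hsq h]
  ring

/-- Schur complements of a kernel with a spectral representation have a spectral representation. -/
theorem HasSpectralRepresentation.exists_schurComplement (hR : MeasurableSet R)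
    (hC : HasSpectralRepresentation R C c φ) {k : ℕ} {y : Fin k → EuclideanSpace ℝ (Fin q)}
    (hy : ∀ i, y i ∈ R) (hdet : IsUnit (kernelMatrix C y).det) {t : ℝ} (ht : 0 ≤ t) :
    ∃ (c' : ℕ → ℝ) (φ' : ℕ → EuclideanSpace ℝ (Fin q) → ℂ),
      HasSpectralRepresentation R (fun x z => (t : ℂ) *
        (C x z - ∑ i, ∑ j, (kernelMatrix C y)⁻¹ i j * C x (y i) * C (y j) z)) c' φ' := by
  obtain ⟨Ψ, hΨ, hΨC⟩ := hC.exists_feature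
  obtain ⟨T, Θ, hT, hT', hΘ, hΘC⟩ := hC.hilbertBasis.exists_projected_feature hC.nonneg hC.summable
    hΨ hΨC hy hdet ht
  exact hC.exists_of_featureMap hR hT hT' hΘ fun x hx z hz => (hΘC x hx z hz).symm

end Mercer

/-! ### The kernels of the process and of its density, and Schur complements -/

section Kernels

variable {q : ℕ} {R : Set (EuclideanSpace ℝ (Fin q))}
  {K C : EuclideanSpace ℝ (Fin q) → EuclideanSpace ℝ (Fin q) → ℂ}
  {lam c : ℕ → ℝ} {φ : ℕ → EuclideanSpace ℝ (Fin q) → ℂ}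

/-- Eigenvalues dominated by those of a kernel give a kernel too, the series converging absolutely
at every pair of points. -/
theorem HasSpectralRepresentation.of_le (hK : HasSpectralRepresentation R K lam φ) {B : ℝ}
    (hc : ∀ h, 0 ≤ c h) (hB : ∀ h, c h ≤ B * lam h) :
    HasSpectralRepresentation R (fun x y => ∑' h, (c h : ℂ) * φ h x * conj (φ h y)) c φ where
  measurable := hK.measurable
  memLp := hK.memLp
  orthonormal := hK.orthonormal
  complete := hK.complete
  nonneg := hc
  summable := (hK.summable.mul_left B).of_nonneg_of_le hc hB
  hasSum x hx y hy := by
    refine Summable.hasSum ?_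
    refine Summable.of_norm_bounded ((hK.hasSum x hx y hy).summable.norm.mul_left B) fun h => ?_
    rw [norm_mul, norm_mul, norm_mul, norm_mul, Complex.norm_real, Complex.norm_real,
      Real.norm_of_nonneg (hc h), Real.norm_of_nonneg (hK.nonneg h), ← mul_assoc, ← mul_assoc]
    exact mul_le_mul_of_nonneg_right (mul_le_mul_of_nonneg_right (hB h) (norm_nonneg _))
      (norm_nonneg _)

theorem HasSpectralRepresentation.cKernel (hK : HasSpectralRepresentation R K lam φ)
    (hlam : ∀ h, lam h < 1) :
    HasSpectralRepresentation R (_root_.cKernel lam φ) (fun h => lam h / (1 - lam h)) φ := by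
  have h1 : Filter.Tendsto (fun h => (1 - lam h)⁻¹) Filter.atTop (nhds 1) := by
    have h2 := (hK.summable.tendsto_atTop_zero.const_sub 1).inv₀ (by norm_num)
    simpa using h2
  obtain ⟨B, hB⟩ := h1.bddAbove_range
  refine hK.of_le (B := B) (fun h => div_nonneg (hK.nonneg h) (sub_nonneg.2 (hlam h).le)) fun h => ?_
  rw [div_eq_mul_inv, mul_comm]
  exact mul_le_mul_of_nonneg_right (hB ⟨h, rfl⟩) (hK.nonneg h)

theorem HasSpectralRepresentation.div_one_add (hC : HasSpectralRepresentation R C c φ) :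
    HasSpectralRepresentation R
      (fun x y => ∑' h, ((c h / (1 + c h) : ℝ) : ℂ) * φ h x * conj (φ h y))
      (fun h => c h / (1 + c h)) φ :=
  hC.of_le (B := 1) (fun h => div_nonneg (hC.nonneg h) (add_nonneg zero_le_one (hC.nonneg h)))
    fun h => by
      rw [one_mul]
      exact div_le_self (hC.nonneg h) (by linarith [hC.nonneg h])

theorem div_one_add_lt_one {a : ℝ} (ha : 0 ≤ a) : a / (1 + a) < 1 := by
  rw [div_lt_one (by linarith)]
  linarith

theorem div_one_add_div_one_sub {a : ℝ} (ha : 0 ≤ a) : a / (1 + a) / (1 - a / (1 + a)) = a := by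
  have h1 : 1 + a ≠ 0 := by linarith
  field_simp
  ring

theorem div_one_sub_div_one_add {a : ℝ} (ha : a < 1) : a / (1 - a) / (1 + a / (1 - a)) = a := by
  have h1 : 1 - a ≠ 0 := by linarith
  field_simp
  ring

theorem HasSpectralRepresentation.cKernel_div_one_add (hC : HasSpectralRepresentation R C c φ)
    {x z : EuclideanSpace ℝ (Fin q)} (hx : x ∈ R) (hz : z ∈ R) :
    _root_.cKernel (fun h => c h / (1 + c h)) φ x z = C x z := by
  rw [_root_.cKernel]
  simp_rw [div_one_add_div_one_sub (hC.nonneg _)]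
  exact (hC.hasSum x hx z hz).tsum_eq

theorem HasSpectralRepresentation.mulVec_kernelMatrix (hC : HasSpectralRepresentation R C c φ)
    {k : ℕ} {y : Fin k → EuclideanSpace ℝ (Fin q)} (hy : ∀ i, y i ∈ R) (v : Fin k → ℂ) (i : Fin k) :
    HasSum (fun h => (c h : ℂ) * φ h (y i) * ∑ j, conj (φ h (y j)) * v j)
      ((kernelMatrix C y).mulVec v i) := by
  have h1 := hasSum_sum fun (j : Fin k) (_ : j ∈ Finset.univ) =>
    (hC.hasSum _ (hy i) _ (hy j)).mul_right (v j)
  refine h1.congr_fun fun h => ?_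
  rw [Finset.mul_sum]
  exact Finset.sum_congr rfl fun j _ => by ring

/-- A null vector of `[C (y i) (y j)]` is orthogonal to the values at `y` of each `φ h` with
`c h ≠ 0`, so it is a null vector of `[K (y i) (y j)]` too. -/
theorem HasSpectralRepresentation.det_kernelMatrix_ne_zero
    (hC : HasSpectralRepresentation R C c φ) (hK : HasSpectralRepresentation R K lam φ)
    (h0 : ∀ h, c h = 0 → lam h = 0) {k : ℕ} {y : Fin k → EuclideanSpace ℝ (Fin q)}
    (hy : ∀ i, y i ∈ R) (hdet : (kernelMatrix K y).det ≠ 0) : (kernelMatrix C y).det ≠ 0 := by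
  intro hzero
  obtain ⟨v, hv0, hv⟩ := Matrix.exists_mulVec_eq_zero_iff.2 hzero
  refine hdet (Matrix.exists_mulVec_eq_zero_iff.1 ⟨v, hv0, ?_⟩)
  -- The quadratic form at `v` is a sum of nonnegative terms, so all of them vanish.
  have h1 := hasSum_sum fun (i : Fin k) (_ : i ∈ Finset.univ) =>
    (hC.mulVec_kernelMatrix hy v i).mul_left (conj (v i))
  simp_rw [hv, Pi.zero_apply, mul_zero, Finset.sum_const_zero] at h1
  have h2 : ∀ h, ∑ i, conj (v i) * ((c h : ℂ) * φ h (y i) * ∑ j, conj (φ h (y j)) * v j) =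
      ((c h * ‖∑ j, conj (φ h (y j)) * v j‖ ^ 2 : ℝ) : ℂ) := by
    intro h
    have h3 : ∑ i, conj (v i) * ((c h : ℂ) * φ h (y i) * ∑ j, conj (φ h (y j)) * v j) =
        (c h : ℂ) * (conj (∑ j, conj (φ h (y j)) * v j) * ∑ j, conj (φ h (y j)) * v j) := by
      rw [map_sum, Finset.sum_mul, Finset.mul_sum]
      refine Finset.sum_congr rfl fun i _ => ?_
      rw [map_mul, Complex.conj_conj]
      ring
    rw [h3, Complex.conj_mul']
    push_cast
    rfl
  have h4 : HasSum (fun h => c h * ‖∑ j, conj (φ h (y j)) * v j‖ ^ 2) 0 := by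
    rw [← Complex.hasSum_ofReal]
    exact h1.congr_fun fun h => (h2 h).symm
  have h5 := (hasSum_zero_iff_of_nonneg fun h => mul_nonneg (hC.nonneg h) (sq_nonneg _)).1 h4
  funext i
  refine (hK.mulVec_kernelMatrix hy v i).unique ?_
  refine hasSum_zero.congr_fun fun h => ?_
  rcases mul_eq_zero.1 (congrFun h5 h) with h6 | h6
  · rw [h0 h h6]
    simp
  · rw [norm_eq_zero.1 (pow_eq_zero_iff two_ne_zero |>.1 h6), mul_zero]

end Kernels

section Schur

variable {E : Type*}

/-- The Schur complement of a kernel with respect to the points `y i`. -/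
noncomputable def schurKernel (C : E → E → ℂ) {k : ℕ} (y : Fin k → E) (x z : E) : ℂ :=
  C x z - ∑ i, ∑ j, (kernelMatrix C y)⁻¹ i j * C x (y i) * C (y j) z

theorem det_gram_sumElim (C : E → E → ℂ) {k m : ℕ} {y : Fin k → E}
    (hdet : IsUnit (kernelMatrix C y).det) (z : Fin m → E) :
    (gram C (Sum.elim y z)).det = (kernelMatrix C y).det * (gram (schurKernel C y) z).det := by
  have hinv : Invertible (kernelMatrix C y) := Matrix.invertibleOfIsUnitDet _ hdet
  let B : Matrix (Fin k) (Fin m) ℂ := Matrix.of fun i j => C (y i) (z j)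
  let B' : Matrix (Fin m) (Fin k) ℂ := Matrix.of fun i j => C (z i) (y j)
  have h1 : gram C (Sum.elim y z) = Matrix.fromBlocks (kernelMatrix C y) B B' (gram C z) := by
    ext i j
    rcases i with i | i <;> rcases j with j | j <;> rfl
  have h2 : gram (schurKernel C y) z = gram C z - B' * ⅟(kernelMatrix C y) * B := by
    ext i j
    rw [Matrix.invOf_eq_nonsing_inv, Matrix.sub_apply, Matrix.mul_apply]
    change C (z i) (z j) - _ = C (z i) (z j) - _
    congr 1
    simp_rw [Matrix.mul_apply, Finset.sum_mul]
    rw [Finset.sum_comm]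
    refine Finset.sum_congr rfl fun j' _ => Finset.sum_congr rfl fun i' _ => ?_
    change _ = C (z i) (y i') * (kernelMatrix C y)⁻¹ i' j' * C (y j') (z j)
    ring
  rw [h1, Matrix.det_fromBlocks₁₁, h2]

theorem detWeight_sumElim (C : E → E → ℂ) {k m : ℕ} {y : Fin k → E}
    (hdet : IsUnit (kernelMatrix C y).det) (hpos : 0 ≤ (kernelMatrix C y).det) (z : Fin m → E) :
    detWeight C (Sum.elim y z) = detWeight C y * detWeight (schurKernel C y) z := by
  have h1 := Complex.le_def.1 hpos
  rw [detWeight, det_gram_sumElim C hdet, Complex.mul_re, ← h1.2, Complex.zero_im, zero_mul,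
    sub_zero, ENNReal.ofReal_mul h1.1]
  rfl

theorem detWeight_const_mul (C : E → E → ℂ) {t : ℝ} (ht : 0 ≤ t) {n : ℕ} (x : Fin n → E) :
    detWeight (fun a b => (t : ℂ) * C a b) x = ENNReal.ofReal t ^ n * detWeight C x := by
  have h1 : gram (fun a b => (t : ℂ) * C a b) x = (t : ℂ) • gram C x := rfl
  rw [detWeight, h1, Matrix.det_smul, Fintype.card_fin, ← Complex.ofReal_pow, Complex.re_ofReal_mul,
    ENNReal.ofReal_mul (pow_nonneg ht n), ENNReal.ofReal_pow ht]
  rfl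

end Schur

/-! ### Laplace functionals of randomly marked point processes -/

section Marked

variable {E : Type*} [MeasurableSpace E]

theorem measurable_integral_of_nonneg {f : E → ℝ} (hf : Measurable f) (hf0 : ∀ z, 0 ≤ f z) :
    Measurable fun μ : Measure E => ∫ z, f z ∂μ := by
  have h1 : (fun μ : Measure E => ∫ z, f z ∂μ) =
      fun μ : Measure E => (∫⁻ z, ENNReal.ofReal (f z) ∂μ).toReal := by
    funext μ
    exact integral_eq_lintegral_of_nonneg_ae (Filter.Eventually.of_forall hf0)
      hf.aestronglyMeasurable
  rw [h1]
  exact (Measure.measurable_lintegral hf.ennreal_ofReal).ennreal_toReal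

theorem measurable_exp_neg_integral {f : E → ℝ} (hf : Measurable f) (hf0 : ∀ z, 0 ≤ f z) :
    Measurable fun μ : Measure E => ENNReal.ofReal (Real.exp (-∫ z, f z ∂μ)) :=
  (Real.measurable_exp.comp (measurable_integral_of_nonneg hf hf0).neg).ennreal_ofReal

theorem laplaceFunctional_eq_toReal {f : E → ℝ} (hf : Measurable f) (hf0 : ∀ z, 0 ≤ f z)
    (Q : Measure (Measure E)) : laplaceFunctional Q f =
      (∫⁻ μ, ENNReal.ofReal (Real.exp (-∫ z, f z ∂μ)) ∂Q).toReal :=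
  integral_eq_lintegral_of_nonneg_ae (Filter.Eventually.of_forall fun _ => (Real.exp_pos _).le)
    (Real.measurable_exp.comp (measurable_integral_of_nonneg hf hf0).neg).aestronglyMeasurable

/-- The measure with mass `s j` (or zero, if `s j` is negative) at `x j`, for `j < n`. -/
noncomputable def markedSum (p : ℕ × (ℕ → E)) (s : ℕ → ℝ) : Measure E :=
  ∑ j ∈ Finset.range p.1, ENNReal.ofReal (s j) • Measure.dirac (p.2 j)

theorem markedSum_apply (p : ℕ × (ℕ → E)) (s : ℕ → ℝ) {t : Set E} (ht : MeasurableSet t) :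
    markedSum p s t = ∑ j ∈ Finset.range p.1, ENNReal.ofReal (s j) * t.indicator 1 (p.2 j) := by
  rw [markedSum, Measure.finsetSum_apply]
  refine Finset.sum_congr rfl fun j _ => ?_
  rw [Measure.smul_apply, Measure.dirac_apply' _ ht, smul_eq_mul]

theorem markedSum_univ_lt_top (p : ℕ × (ℕ → E)) (s : ℕ → ℝ) : markedSum p s Set.univ < ∞ := by
  rw [markedSum_apply p s MeasurableSet.univ]
  exact ENNReal.sum_lt_top.2 fun j _ => ENNReal.mul_lt_top ENNReal.ofReal_lt_top (by simp)

/-- Functions of finitely many of the points and marks, their number being random, are measurable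
if they are so for every fixed number. -/
theorem measurable_of_forall_nat {X Y : Type*} [MeasurableSpace X] [MeasurableSpace Y]
    {F : ℕ × X → Y} (hF : ∀ n, Measurable fun x => F (n, x)) : Measurable F :=
  measurable_from_prod_countable_right hF

theorem measurable_markedSum :
    Measurable fun p : (ℕ × (ℕ → E)) × (ℕ → ℝ) => markedSum p.1 p.2 := by
  refine Measure.measurable_of_measurable_coe _ fun t ht => ?_
  simp_rw [markedSum_apply _ _ ht]
  have h1 : Measurable fun p : ℕ × ((ℕ → E) × (ℕ → ℝ)) => ∑ j ∈ Finset.range p.1,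
      ENNReal.ofReal (p.2.2 j) * t.indicator (1 : E → ℝ≥0∞) (p.2.1 j) := by
    refine measurable_of_forall_nat fun n => ?_
    change Measurable fun x : (ℕ → E) × (ℕ → ℝ) => ∑ j ∈ Finset.range n,
      ENNReal.ofReal (x.2 j) * t.indicator (1 : E → ℝ≥0∞) (x.1 j)
    refine Finset.measurable_fun_sum _ fun j _ => ?_
    have h2 : Measurable (t.indicator (1 : E → ℝ≥0∞)) := measurable_one.indicator ht
    exact ((measurable_pi_apply j).comp measurable_snd).ennreal_ofReal.mul
      (h2.comp ((measurable_pi_apply j).comp measurable_fst))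
  exact h1.comp ((measurable_fst.comp measurable_fst).prodMk
    ((measurable_snd.comp measurable_fst).prodMk measurable_snd))

theorem measurable_markedSum_right (p : ℕ × (ℕ → E)) : Measurable (markedSum p) := by
  have h1 : Measurable fun s : ℕ → ℝ => (p, s) := measurable_const.prodMk measurable_id
  exact measurable_markedSum.comp h1

theorem measurable_config_range :
    Measurable fun p : ℕ × (ℕ → E) => config fun i : Fin p.1 => p.2 i :=
  measurable_of_forall_nat (F := fun p : ℕ × (ℕ → E) => config fun i : Fin p.1 => p.2 i) fun _ =>
    measurable_config.comp (measurable_pi_iff.2 fun i => measurable_pi_apply (i : ℕ))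

theorem integral_markedSum (p : ℕ × (ℕ → E)) (s : ℕ → ℝ) {f : E → ℝ} (hf : Measurable f) :
    ∫ z, f z ∂(markedSum p s) = ∑ j ∈ Finset.range p.1, max (s j) 0 * f (p.2 j) := by
  rw [markedSum, integral_finsetSum_measure fun j _ => ?_]
  · refine Finset.sum_congr rfl fun j _ => ?_
    rw [integral_smul_measure, integral_dirac' _ _ hf.stronglyMeasurable,
      ENNReal.toReal_ofReal', smul_eq_mul]
  · exact (integrable_dirac' hf.stronglyMeasurable (by simp)).smul_measure ENNReal.ofReal_ne_top

section Psi

variable {H : Measure ℝ} [IsProbabilityMeasure H]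

theorem integrable_exp_neg_mul (hH : ∀ᵐ s ∂H, 0 < s) {u : ℝ} (hu : 0 ≤ u) :
    Integrable (fun s => Real.exp (-(u * s))) H := by
  refine Integrable.of_bound (by fun_prop) 1 ?_
  filter_upwards [hH] with s hs
  rw [Real.norm_of_nonneg (Real.exp_pos _).le]
  exact Real.exp_le_one_iff.2 (neg_nonpos.2 (mul_nonneg hu hs.le))

theorem psi_pos (hH : ∀ᵐ s ∂H, 0 < s) {u : ℝ} (hu : 0 ≤ u) : 0 < psi H u :=
  integral_exp_pos (integrable_exp_neg_mul hH hu)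

theorem psi_le_one (hH : ∀ᵐ s ∂H, 0 < s) {u : ℝ} (hu : 0 ≤ u) : psi H u ≤ 1 := by
  have h1 : psi H u ≤ ∫ _, (1 : ℝ) ∂H := by
    refine integral_mono_ae (integrable_exp_neg_mul hH hu) (integrable_const _) ?_
    filter_upwards [hH] with s hs
    exact Real.exp_le_one_iff.2 (neg_nonpos.2 (mul_nonneg hu hs.le))
  simpa using h1

theorem measurable_psi (H : Measure ℝ) [SFinite H] : Measurable (psi H) := by
  have h1 : StronglyMeasurable fun p : ℝ × ℝ => Real.exp (-(p.1 * p.2)) := by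
    apply Measurable.stronglyMeasurable
    fun_prop
  exact h1.integral_prod_right.measurable

theorem lintegral_exp_neg_max_mul (hH : ∀ᵐ s ∂H, 0 < s) {u : ℝ} (hu : 0 ≤ u) :
    ∫⁻ s, ENNReal.ofReal (Real.exp (-(max s 0 * u))) ∂H = ENNReal.ofReal (psi H u) := by
  rw [psi, ofReal_integral_eq_lintegral_ofReal (integrable_exp_neg_mul hH hu)
    (Filter.Eventually.of_forall fun _ => (Real.exp_pos _).le)]
  refine lintegral_congr_ae ?_
  filter_upwards [hH] with s hs
  rw [max_eq_left hs.le, mul_comm]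

theorem lintegral_exp_neg_markedSum (hH : ∀ᵐ s ∂H, 0 < s) {Ω : Type*} [MeasurableSpace Ω]
    {Pr : Measure Ω} {S : ℕ → Ω → ℝ} (hS : ∀ j, Measurable (S j)) (hSind : iIndepFun S Pr)
    (hSH : ∀ j, Pr.map (S j) = H) {f : E → ℝ} (hf : Measurable f) (hf0 : ∀ z, 0 ≤ f z)
    (p : ℕ × (ℕ → E)) :
    ∫⁻ ω, ENNReal.ofReal (Real.exp (-∫ z, f z ∂(markedSum p fun j => S j ω))) ∂Pr =
      ENNReal.ofReal (Real.exp (-∫ z, -Real.log (psi H (f z))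
        ∂(config fun i : Fin p.1 => p.2 i))) := by
  have hg : Measurable fun z => -Real.log (psi H (f z)) :=
    (Real.measurable_log.comp ((measurable_psi H).comp hf)).neg
  have hm : ∀ a : ℝ, Measurable fun s : ℝ => ENNReal.ofReal (Real.exp (-(max s 0 * a))) := by
    intro a
    fun_prop
  let F : ℕ → Ω → ℝ≥0∞ := fun j ω => ENNReal.ofReal (Real.exp (-(max (S j ω) 0 * f (p.2 j))))
  have hFm : ∀ j, Measurable (F j) := fun j => (hm _).comp (hS j)
  have hFind : iIndepFun F Pr :=
    hSind.comp (fun j s => ENNReal.ofReal (Real.exp (-(max s 0 * f (p.2 j))))) fun j => hm _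
  have h1 : ∀ ω, ENNReal.ofReal (Real.exp (-∫ z, f z ∂(markedSum p fun j => S j ω))) =
      ∏ j ∈ Finset.range p.1, F j ω := by
    intro ω
    rw [integral_markedSum p _ hf, ← Finset.sum_neg_distrib, Real.exp_sum,
      ENNReal.ofReal_prod_of_nonneg fun j _ => (Real.exp_pos _).le]
  have h2 : ∀ j, ∫⁻ ω, F j ω ∂Pr = ENNReal.ofReal (psi H (f (p.2 j))) := by
    intro j
    rw [← lintegral_exp_neg_max_mul hH (hf0 (p.2 j)), ← hSH j, lintegral_map (hm _) (hS j)]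
  rw [lintegral_congr h1, lintegral_prod_eq_prod_lintegral_of_indepFun _ F hFind hFm,
    Finset.prod_congr rfl fun j _ => h2 j, integral_config _ hg,
    ← Finset.sum_range (fun j => -Real.log (psi H (f (p.2 j)))), ← Finset.sum_neg_distrib,
    Real.exp_sum, ENNReal.ofReal_prod_of_nonneg fun j _ => (Real.exp_pos _).le]
  refine Finset.prod_congr rfl fun j _ => ?_
  rw [neg_neg, Real.exp_log (psi_pos hH (hf0 _))]

/-- The Laplace functional of a marked point process: integrating out the marks replaces the test
function `f` by `-log ψ(f)`. -/
theorem IsRMLaw.lintegral_exp_neg (hH : ∀ᵐ s ∂H, 0 < s) {P Q : Measure (Measure E)}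
    (hQ : IsRMLaw P H Q) {f : E → ℝ} (hf : Measurable f) (hf0 : ∀ z, 0 ≤ f z) :
    ∫⁻ μ, ENNReal.ofReal (Real.exp (-∫ z, f z ∂μ)) ∂Q =
      ∫⁻ ν, ENNReal.ofReal (Real.exp (-∫ z, -Real.log (psi H (f z)) ∂ν)) ∂P := by
  obtain ⟨Ω, _, Pr, N, X, S, hPr, hN, hX, hS, hSind, hSH, hind, rfl, rfl⟩ := hQ
  have hg : Measurable fun z => -Real.log (psi H (f z)) :=
    (Real.measurable_log.comp ((measurable_psi H).comp hf)).neg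
  have hg0 : ∀ z, 0 ≤ -Real.log (psi H (f z)) := fun z =>
    neg_nonneg.2 (Real.log_nonpos (psi_pos hH (hf0 z)).le (psi_le_one hH (hf0 z)))
  have hNX : Measurable fun ω => (N ω, fun j => X j ω) := hN.prodMk (measurable_pi_iff.2 hX)
  have hSm : Measurable fun ω j => S j ω := measurable_pi_iff.2 hS
  have h1 : (fun ω => ∑ j ∈ Finset.range (N ω), Measure.dirac (X j ω)) =
      fun ω => (fun p : ℕ × (ℕ → E) => config fun i : Fin p.1 => p.2 i)
        (N ω, fun j => X j ω) := by
    funext ω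
    exact Finset.sum_range _
  have h2 : Measurable fun ω => ∑ j ∈ Finset.range (N ω), Measure.dirac (X j ω) := by
    rw [h1]
    exact measurable_config_range.comp hNX
  have h3 : Measurable fun ω => markedSum (N ω, fun j => X j ω) fun j => S j ω :=
    measurable_markedSum.comp (hNX.prodMk hSm)
  have h4 : Measurable fun p : (ℕ × (ℕ → E)) × (ℕ → ℝ) =>
      ENNReal.ofReal (Real.exp (-∫ z, f z ∂(markedSum p.1 p.2))) :=
    (measurable_exp_neg_integral hf hf0).comp measurable_markedSum
  have hjoint := (indepFun_iff_map_prod_eq_prod_map_map hNX.aemeasurable hSm.aemeasurable).1 hind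
  have hprob : IsProbabilityMeasure (Pr.map fun ω j => S j ω) :=
    Measure.isProbabilityMeasure_map hSm.aemeasurable
  rw [lintegral_map (measurable_exp_neg_integral hg hg0) h2]
  change ∫⁻ μ, _ ∂(Pr.map fun ω => markedSum (N ω, fun j => X j ω) fun j => S j ω) = _
  rw [lintegral_map (measurable_exp_neg_integral hf hf0) h3]
  rw [← lintegral_map (f := fun p : (ℕ × (ℕ → E)) × (ℕ → ℝ) =>
      ENNReal.ofReal (Real.exp (-∫ z, f z ∂(markedSum p.1 p.2))))
    (g := fun ω => ((N ω, fun j => X j ω), fun j => S j ω)) h4 (hNX.prodMk hSm), hjoint,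
    lintegral_prod _ h4.aemeasurable]
  have h5 : ∀ p : ℕ × (ℕ → E), ∫⁻ s, ENNReal.ofReal (Real.exp (-∫ z, f z ∂(markedSum p s)))
      ∂(Pr.map fun ω j => S j ω) = ENNReal.ofReal (Real.exp (-∫ z, -Real.log (psi H (f z))
        ∂(config fun i : Fin p.1 => p.2 i))) := by
    intro p
    have h6 : Measurable fun s : ℕ → ℝ =>
        ENNReal.ofReal (Real.exp (-∫ z, f z ∂(markedSum p s))) :=
      (measurable_exp_neg_integral hf hf0).comp (measurable_markedSum_right p)
    rw [lintegral_map h6 hSm]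
    exact lintegral_exp_neg_markedSum hH hS hSind hSH hf hf0 p
  simp_rw [h5]
  have h7 : Measurable fun p : ℕ × (ℕ → E) => ENNReal.ofReal (Real.exp
      (-∫ z, -Real.log (psi H (f z)) ∂(config fun i : Fin p.1 => p.2 i))) :=
    (measurable_exp_neg_integral hg hg0).comp measurable_config_range
  rw [lintegral_map h7 hNX]
  refine lintegral_congr fun ω => ?_
  rw [congrFun h1 ω]

end Psi

theorem IsRMLaw.isProbabilityMeasure {P Q : Measure (Measure E)} {H : Measure ℝ}
    (hQ : IsRMLaw P H Q) : IsProbabilityMeasure Q := by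
  obtain ⟨Ω, _, Pr, N, X, S, hPr, hN, hX, hS, -, -, -, -, rfl⟩ := hQ
  have h3 : Measurable fun ω => markedSum (N ω, fun j => X j ω) fun j => S j ω :=
    measurable_markedSum.comp ((hN.prodMk (measurable_pi_iff.2 hX)).prodMk
      (measurable_pi_iff.2 hS))
  exact Measure.isProbabilityMeasure_map h3.aemeasurable

theorem IsRMLaw.ae_lt_top {P Q : Measure (Measure E)} {H : Measure ℝ}
    (hQ : IsRMLaw P H Q) : ∀ᵐ μ ∂Q, μ Set.univ < ∞ := by
  obtain ⟨Ω, _, Pr, N, X, S, hPr, hN, hX, hS, -, -, -, -, rfl⟩ := hQ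
  have h3 : Measurable fun ω => markedSum (N ω, fun j => X j ω) fun j => S j ω :=
    measurable_markedSum.comp ((hN.prodMk (measurable_pi_iff.2 hX)).prodMk
      (measurable_pi_iff.2 hS))
  exact (ae_map_iff (p := fun μ : Measure E => μ Set.univ < ∞) h3.aemeasurable
    measurableSet_lt_top_univ).2 (Filter.Eventually.of_forall fun ω => markedSum_univ_lt_top _ _)

/-- Point processes given by the laws of their points on each event of a fixed number of points
can be marked. The points live in a `Type` because the sample space in `IsRMLaw` does. -/
theorem exists_isRMLaw {E : Type} [MeasurableSpace E] [Nonempty E] (ρ : ∀ n, Measure (Fin n → E))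
    {P : Measure (Measure E)} [IsProbabilityMeasure P]
    (hP : P = Measure.sum fun n => (ρ n).map config) (H : Measure ℝ) [IsProbabilityMeasure H] :
    ∃ Q, IsRMLaw P H Q := by
  classical
  obtain ⟨x₀⟩ := ‹Nonempty E›
  let ext : ∀ n, (Fin n → E) → ℕ × (ℕ → E) := fun n x =>
    (n, fun j => if h : j < n then x ⟨j, h⟩ else x₀)
  have hext : ∀ n, Measurable (ext n) := fun n => by
    refine measurable_const.prodMk (measurable_pi_iff.2 fun j => ?_)
    by_cases h : j < n
    · simp only [h, dif_pos]
      exact measurable_pi_apply _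
    · simp only [h, dif_neg, not_false_iff]
      exact measurable_const
  let L : Measure (ℕ × (ℕ → E)) := Measure.sum fun n => (ρ n).map (ext n)
  have hLmap : L.map (fun p : ℕ × (ℕ → E) => config fun i : Fin p.1 => p.2 i) = P := by
    rw [hP, Measure.map_sum measurable_config_range.aemeasurable]
    congr 1
    funext n
    rw [Measure.map_map measurable_config_range (hext n)]
    congr 1
    funext x
    change config (fun i : Fin n => if h : (i : ℕ) < n then x ⟨i, h⟩ else x₀) = config x
    congr 1
    funext i
    rw [dif_pos i.2]
  have hL : IsProbabilityMeasure L := by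
    refine ⟨?_⟩
    have h1 : P Set.univ = 1 := measure_univ
    rwa [← hLmap, Measure.map_apply measurable_config_range MeasurableSet.univ,
      Set.preimage_univ] at h1
  let M : Measure (ℕ → ℝ) := Measure.infinitePi fun _ : ℕ => H
  have hSmap : ∀ j, (L.prod M).map (fun ω => ω.2 j) = H := by
    intro j
    have h1 : (L.prod M).map (fun ω => ω.2 j) = ((L.prod M).map Prod.snd).map fun s => s j := by
      rw [Measure.map_map (measurable_pi_apply j) measurable_snd]
      rfl
    rw [h1, Measure.map_snd_prod, measure_univ, one_smul]
    exact Measure.infinitePi_map_eval (fun _ : ℕ => H) j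
  refine ⟨(L.prod M).map fun ω => ∑ j ∈ Finset.range ω.1.1,
    ENNReal.ofReal (ω.2 j) • Measure.dirac (ω.1.2 j), (ℕ × (ℕ → E)) × (ℕ → ℝ), inferInstance,
    L.prod M, fun ω => ω.1.1, fun j ω => ω.1.2 j, fun j ω => ω.2 j, inferInstance,
    measurable_fst.comp measurable_fst,
    fun j => (measurable_pi_apply j).comp (measurable_snd.comp measurable_fst),
    fun j => (measurable_pi_apply j).comp measurable_snd, ?_, hSmap, ?_, ?_, rfl⟩
  · have hm : ∀ j : ℕ, Measurable fun ω : (ℕ × (ℕ → E)) × (ℕ → ℝ) => ω.2 j := fun j =>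
      (measurable_pi_apply j).comp measurable_snd
    rw [iIndepFun_iff_map_fun_eq_infinitePi_map hm]
    simp_rw [hSmap]
    exact (Measure.map_snd_prod (μ := L) (ν := M)).trans (by rw [measure_univ, one_smul])
  · exact indepFun_prod (μ := L) (ν := M) (X := id) (Y := id) measurable_id measurable_id
  · rw [← hLmap]
    have h1 : (fun ω : (ℕ × (ℕ → E)) × (ℕ → ℝ) => ∑ j ∈ Finset.range ω.1.1,
        Measure.dirac (ω.1.2 j)) =
        (fun p : ℕ × (ℕ → E) => config fun i : Fin p.1 => p.2 i) ∘ Prod.fst := by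
      funext ω
      exact Finset.sum_range _
    rw [h1, ← Measure.map_map measurable_config_range measurable_fst, Measure.map_fst_prod,
      measure_univ, one_smul]

end Marked

/-! ### Reduced Palm kernels -/

section Palm

variable {E : Type*} [MeasurableSpace E] {ω : Measure E} {C K : E → E → ℂ} {c : ℕ → ℝ}
  {φ : ℕ → E → ℂ}

theorem laplaceTest_add (A : ℕ → Set E) (l : List ℕ) (ν μ : Measure E) [IsFiniteMeasure ν]
    [IsFiniteMeasure μ] : laplaceTest A l (ν + μ) = laplaceTest A l ν * laplaceTest A l μ := by
  rw [laplaceTest, laplaceTest, laplaceTest, ← Real.exp_add]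
  congr 1
  induction l with
  | nil => simp
  | cons i l ih =>
    have h : (ν + μ).real (A i) = ν.real (A i) + μ.real (A i) := by
      rw [Measure.real, Measure.add_apply, ENNReal.toReal_add (measure_ne_top _ _)
        (measure_ne_top _ _), Measure.real, Measure.real]
    simp only [List.map_cons, List.sum_cons] at ih ⊢
    rw [h]
    linarith

theorem measurable_prodMk_add_config (k : ℕ) :
    Measurable fun p : (Fin k → E) × Measure E => (p.1, p.2 + config p.1) := by
  refine measurable_fst.prodMk (Measure.measurable_of_measurable_coe _ fun s hs => ?_)
  simp_rw [Measure.add_apply]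
  exact ((Measure.measurable_coe hs).comp measurable_snd).add
    (((Measure.measurable_coe hs).comp measurable_config).comp measurable_fst)

/-- The reduced Palm laws in terms of the Janossy densities: adding the points `y` to the
configuration. -/
theorem ae_lintegral_reducedPalm [MeasurableEq E] [IsFiniteMeasure ω]
    (hC : IsMercerKernel ω C c φ) (hK : ∀ x y,
      HasSum (fun h => ((c h / (1 + c h) : ℝ) : ℂ) * φ h x * conj (φ h y)) (K x y))
    (hKm : Measurable fun p : E × E => K p.1 p.2) {k : ℕ}
    {Pal : Kernel (Fin k → E) (Measure E)}
    (hPal : IsReducedPalm k ((fredholmDet ω C)⁻¹ • detLaw ω C) Pal)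
    {G : Measure E → ℝ≥0∞} (hG : Measurable G) :
    ∀ᵐ y : Fin k → E ∂(Measure.pi fun _ => ω), (fredholmDet ω C)⁻¹ *
      ∑' m : ℕ, (m.factorial : ℝ≥0∞)⁻¹ * ∫⁻ z : Fin m → E,
        detWeight C (Sum.elim y z) * G (config y + config z) ∂(Measure.pi fun _ => ω) =
      detWeight K y * ∫⁻ ν, G (ν + config y) ∂(Pal y) := by
  have hCm := hC.measurable_kernel
  have hmarkov := hPal.markov
  have hJm : Measurable fun y : Fin k → E => (fredholmDet ω C)⁻¹ *
      ∑' m : ℕ, (m.factorial : ℝ≥0∞)⁻¹ * ∫⁻ z : Fin m → E,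
        detWeight C (Sum.elim y z) * G (config y + config z) ∂(Measure.pi fun _ => ω) :=
    (Measurable.tsum fun m => (measurable_detWeight_sumElim_mul hCm k m
      (g := fun _ ν => G ν) (hG.comp measurable_snd)).lintegral_prod_right'.const_mul _).const_mul _
  have hGm : Measurable fun p : (Fin k → E) × Measure E => G (p.2 + config p.1) :=
    hG.comp (measurable_snd.comp (measurable_prodMk_add_config k))
  have hIm : Measurable fun y : Fin k → E => ∫⁻ ν, G (ν + config y) ∂(Pal y) :=
    hGm.lintegral_kernel_prod_right'
  refine ae_eq_of_forall_setLIntegral_eq_of_sigmaFinite hJm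
    ((measurable_detWeight hKm).mul hIm) fun S hS _ => ?_
  have hg : Measurable (Function.uncurry fun (x : Fin k → E) (ν : Measure E) =>
      S.indicator (fun _ => G ν) x) := by
    have h1 : (Function.uncurry fun (x : Fin k → E) (ν : Measure E) =>
        S.indicator (fun _ => G ν) x) = (Prod.fst ⁻¹' S).indicator fun p => G p.2 := by
      ext ⟨x, ν⟩
      by_cases hx : x ∈ S <;> simp [hx]
    rw [h1]
    exact (hG.comp measurable_snd).indicator (measurable_fst hS)
  have hdis := hPal.disintegration (fun x ν => S.indicator (fun _ => G ν) x) hg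
  have hlhs : ∫⁻ ν, ∫⁻ x in distinctTuples E k, S.indicator (fun _ => G ν) x
      ∂(Measure.pi fun _ : Fin k => ν) ∂((fredholmDet ω C)⁻¹ • detLaw ω C) =
      ∫⁻ y in S, (fredholmDet ω C)⁻¹ *
        ∑' m : ℕ, (m.factorial : ℝ≥0∞)⁻¹ * ∫⁻ z : Fin m → E,
          detWeight C (Sum.elim y z) * G (config y + config z) ∂(Measure.pi fun _ => ω)
          ∂(Measure.pi fun _ => ω) := by
    have h1 : ∀ᵐ ν ∂(detLaw ω C), ∫⁻ x in distinctTuples E k, S.indicator (fun _ => G ν) x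
        ∂(Measure.pi fun _ : Fin k => ν) = ∫⁻ x in distinctTuples E k,
          S.indicator (fun _ => G ν) x ∂(powKernel E k ν) := by
      filter_upwards [ae_detLaw_lt_top hCm] with ν hν
      rw [powKernel_apply, finPart_of_lt_top hν]
    rw [lintegral_smul_measure, lintegral_congr_ae h1, lintegral_detLaw_distinctTuples hCm k hg,
      smul_eq_mul, ← lintegral_const_mul' _ _ (ENNReal.inv_ne_top.2 (fredholmDet_ne_zero ω C)),
      ← lintegral_indicator hS]
    refine lintegral_congr fun y => ?_
    by_cases hy : y ∈ S
    · simp only [Set.indicator_of_mem hy]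
    · simp [Set.indicator_of_notMem hy]
  have hrhs : ∫⁻ x, ∫⁻ ν, S.indicator (fun _ => G (ν + config x)) x ∂(Pal x)
      ∂(momentMeasure k ((fredholmDet ω C)⁻¹ • detLaw ω C)) =
      ∫⁻ y in S, detWeight K y * ∫⁻ ν, G (ν + config y) ∂(Pal y)
        ∂(Measure.pi fun _ => ω) := by
    have h1 : ∀ x : Fin k → E, ∫⁻ ν, S.indicator (fun _ => G (ν + config x)) x ∂(Pal x) =
        S.indicator (fun y => ∫⁻ ν, G (ν + config y) ∂(Pal y)) x := by
      intro x
      by_cases hx : x ∈ S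
      · simp only [Set.indicator_of_mem hx]
      · simp [Set.indicator_of_notMem hx]
    simp_rw [h1]
    rw [momentMeasure_smul_detLaw hC hK, lintegral_withDensity_eq_lintegral_mul _
      (measurable_detWeight hKm) (hIm.indicator hS), ← lintegral_indicator hS]
    refine lintegral_congr fun y => ?_
    by_cases hy : y ∈ S
    · simp only [Pi.mul_apply, Set.indicator_of_mem hy]
    · simp [Set.indicator_of_notMem hy]
  exact hlhs.symm.trans (hdis.trans hrhs)

end Palm

section DetPalm

variable {q : ℕ} {R : Set (EuclideanSpace ℝ (Fin q))}
  {K C : EuclideanSpace ℝ (Fin q) → EuclideanSpace ℝ (Fin q) → ℂ}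
  {c : ℕ → ℝ} {φ : ℕ → EuclideanSpace ℝ (Fin q) → ℂ}

theorem HasSpectralRepresentation.exists_schurKernel (hR : MeasurableSet R)
    (hC : HasSpectralRepresentation R C c φ) {k : ℕ} {y : Fin k → EuclideanSpace ℝ (Fin q)}
    (hy : ∀ i, y i ∈ R) (hdet : IsUnit (kernelMatrix C y).det) :
    ∃ (c' : ℕ → ℝ) (φ' : ℕ → EuclideanSpace ℝ (Fin q) → ℂ),
      HasSpectralRepresentation R (schurKernel C y) c' φ' := by
  obtain ⟨c', φ', h⟩ := hC.exists_schurComplement hR hy hdet zero_le_one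
  have h1 : schurKernel C y = fun x z => ((1 : ℝ) : ℂ) *
      (C x z - ∑ i, ∑ j, (kernelMatrix C y)⁻¹ i j * C x (y i) * C (y j) z) := by
    funext x z
    rw [Complex.ofReal_one, one_mul, schurKernel]
  exact ⟨c', φ', h1 ▸ h⟩

/-- The reduced Palm laws of a determinantal process are determinantal: the kernel of the density
is replaced by its Schur complement. -/
theorem ae_reducedPalm_eq_detProcess (hR : IsCompact R) (hC : HasSpectralRepresentation R C c φ)
    (hK : HasSpectralRepresentation R K (fun h => c h / (1 + c h)) φ) {k : ℕ}
    {Pal : Kernel (Fin k → EuclideanSpace ℝ (Fin q)) (Measure (EuclideanSpace ℝ (Fin q)))}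
    (hPal : IsReducedPalm k (detProcess R C) Pal) :
    ∀ᵐ y ∂(momentMeasure k (detProcess R C)), (∀ i, y i ∈ R) ∧
      IsUnit (kernelMatrix C y).det ∧ Pal y = detProcess R (schurKernel C y) := by
  have hRm := hR.measurableSet
  have hMC := hC.isMercerKernel hRm
  have hMK := hK.isMercerKernel hRm
  obtain ⟨A, hA, -⟩ := exists_isTestSystem_isBounded (EuclideanSpace ℝ (Fin q))
  have hfin : IsFiniteMeasure (volume.restrict R) := ⟨by
    rw [Measure.restrict_apply_univ]
    exact hR.measure_lt_top⟩
  have hmarkov := hPal.markov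
  have hV : ∀ l, Measurable fun ν => ENNReal.ofReal (laplaceTest A l ν) := fun l =>
    (measurable_laplaceTest hA.measurableSet l).ennreal_ofReal
  have hV0 : ∀ l ν, ENNReal.ofReal (laplaceTest A l ν) ≠ 0 := fun l ν => by
    simpa [laplaceTest] using Real.exp_pos _
  have hI : MeasurableSet {ν : Measure (EuclideanSpace ℝ (Fin q)) | ν Set.univ < ∞}ᶜ :=
    measurableSet_lt_top_univ.compl
  rw [detProcess, momentMeasure_smul_detLaw hMC hMK.hasSum, ae_withDensity_iff
    (measurable_detWeight hMK.measurable_kernel)]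
  filter_upwards [ae_pi_restrict_mem hRm k,
    ae_all_iff.2 fun l => ae_lintegral_reducedPalm hMC hMK.hasSum hMK.measurable_kernel hPal (hV l),
    ae_lintegral_reducedPalm hMC hMK.hasSum hMK.measurable_kernel hPal
      (measurable_one.indicator hI)] with y hy hl hinf hKy
  set ω := volume.restrict R with hω
  set Z := fredholmDet ω (cutKernel R C) with hZ
  have hZ0 : Z ≠ 0 := fredholmDet_ne_zero _ _
  have hZt : Z ≠ ∞ := fredholmDet_ne_top hMC
  have hKdet : (kernelMatrix K y).det ≠ 0 := by
    intro h
    refine hKy ?_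
    rw [detWeight_congr fun i j => cutKernel_apply (hy i) (hy j)]
    change ENNReal.ofReal (kernelMatrix K y).det.re = 0
    rw [h, Complex.zero_re, ENNReal.ofReal_zero]
  have hCdet : (kernelMatrix C y).det ≠ 0 :=
    hC.det_kernelMatrix_ne_zero hK (fun h h0 => by rw [h0, zero_div]) hy hKdet
  have hunit : IsUnit (kernelMatrix C y).det := isUnit_iff_ne_zero.2 hCdet
  obtain ⟨c', φ', hS⟩ := hC.exists_schurKernel hRm hy hunit
  have hMS := hS.isMercerKernel hRm
  set Z' := fredholmDet ω (cutKernel R (schurKernel C y)) with hZ'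
  have hZ'0 : Z' ≠ 0 := fredholmDet_ne_zero _ _
  have hZ't : Z' ≠ ∞ := fredholmDet_ne_top hMS
  refine ⟨hy, hunit, ?_⟩
  have hfinite : ∀ᵐ ν ∂(Pal y), ν Set.univ < ∞ := by
    have h0 : ∀ (m : ℕ) (z : Fin m → EuclideanSpace ℝ (Fin q)),
        {ν : Measure (EuclideanSpace ℝ (Fin q)) | ν Set.univ < ∞}ᶜ.indicator
          (1 : Measure (EuclideanSpace ℝ (Fin q)) → ℝ≥0∞) (config y + config z) = 0 := by
      intro m z
      exact Set.indicator_of_notMem (f := (1 : Measure (EuclideanSpace ℝ (Fin q)) → ℝ≥0∞))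
        fun h : (config y + config z) ∈ {ν : Measure (EuclideanSpace ℝ (Fin q)) |
          ν Set.univ < ∞}ᶜ => h (measure_lt_top (config y + config z) Set.univ)
    simp_rw [h0, mul_zero, lintegral_zero, mul_zero, tsum_zero, mul_zero] at hinf
    have h1 := (mul_eq_zero.1 hinf.symm).resolve_left hKy
    have hm : Measurable fun ν : Measure (EuclideanSpace ℝ (Fin q)) => ν + config y :=
      measurable_snd.comp ((measurable_prodMk_add_config k).comp
        (measurable_const.prodMk measurable_id))
    have hm' : Measurable fun ν : Measure (EuclideanSpace ℝ (Fin q)) =>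
        {ν : Measure (EuclideanSpace ℝ (Fin q)) | ν Set.univ < ∞}ᶜ.indicator
          (1 : Measure (EuclideanSpace ℝ (Fin q)) → ℝ≥0∞) (ν + config y) :=
      (measurable_one.indicator hI).comp hm
    filter_upwards [(lintegral_eq_zero_iff hm').1 h1] with ν hν
    by_contra hνt
    refine one_ne_zero (α := ℝ≥0∞) ?_
    have hν0 : {ν : Measure (EuclideanSpace ℝ (Fin q)) | ν Set.univ < ∞}ᶜ.indicator
      (1 : Measure (EuclideanSpace ℝ (Fin q)) → ℝ≥0∞) (ν + config y) = 0 := hν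
    rw [← hν0]
    refine (Set.indicator_of_mem (s := {ν : Measure (EuclideanSpace ℝ (Fin q)) |
      ν Set.univ < ∞}ᶜ) (fun h : (ν + config y) Set.univ < ∞ => hνt ?_) 1).symm
    rw [Measure.add_apply] at h
    exact lt_of_le_of_lt le_self_add h
  set D := detWeight C y with hD
  have hD0 : D ≠ 0 := by
    have h1 := Complex.le_def.1 (det_kernelMatrix_nonneg hC hy)
    have h2 : (kernelMatrix C y).det.re ≠ 0 := fun h => hCdet (Complex.ext h h1.2.symm)
    exact (ENNReal.ofReal_pos.2 (lt_of_le_of_ne h1.1 (Ne.symm h2))).ne'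
  have hDt : D ≠ ∞ := ENNReal.ofReal_ne_top
  have key : ∀ l, Z⁻¹ * (D * ENNReal.ofReal (laplaceTest A l (config y)) *
      ∫⁻ ν, ENNReal.ofReal (laplaceTest A l ν) ∂(detLaw ω (cutKernel R (schurKernel C y)))) =
      detWeight (cutKernel R K) y * (ENNReal.ofReal (laplaceTest A l (config y)) *
        ∫⁻ ν, ENNReal.ofReal (laplaceTest A l ν) ∂(Pal y)) := by
    intro l
    have h1 : ∫⁻ ν, ENNReal.ofReal (laplaceTest A l (ν + config y)) ∂(Pal y) =
        ENNReal.ofReal (laplaceTest A l (config y)) *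
          ∫⁻ ν, ENNReal.ofReal (laplaceTest A l ν) ∂(Pal y) := by
      rw [← lintegral_const_mul _ (hV l)]
      refine lintegral_congr_ae ?_
      filter_upwards [hfinite] with ν hν
      have : IsFiniteMeasure ν := ⟨hν⟩
      rw [laplaceTest_add, mul_comm, ENNReal.ofReal_mul (laplaceTest_nonneg _ _ _)]
    rw [← h1, ← hl l, lintegral_detLaw hMS.measurable_kernel (hV l), ← ENNReal.tsum_mul_left]
    congr 1
    refine tsum_congr fun m => ?_
    rw [mul_left_comm]
    congr 1
    rw [← lintegral_const_mul' _ _ (ENNReal.mul_ne_top hDt ENNReal.ofReal_ne_top)]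
    refine lintegral_congr_ae ?_
    filter_upwards [ae_pi_restrict_mem hRm m] with z hz
    have h2 : detWeight (cutKernel R C) (Sum.elim y z) = detWeight C (Sum.elim y z) := by
      refine detWeight_congr fun i j => cutKernel_apply ?_ ?_
      · rcases i with i | i
        exacts [hy i, hz i]
      · rcases j with j | j
        exacts [hy j, hz j]
    have h3 : detWeight (cutKernel R (schurKernel C y)) z = detWeight (schurKernel C y) z :=
      detWeight_congr fun i j => cutKernel_apply (hz i) (hz j)
    rw [h2, h3, detWeight_sumElim C hunit (det_kernelMatrix_nonneg hC hy), laplaceTest_add,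
      ENNReal.ofReal_mul (laplaceTest_nonneg _ _ _)]
    ring
  -- The test functional of the empty list is one, which identifies the normalising constant.
  have hnorm : detWeight (cutKernel R K) y = Z⁻¹ * (D * Z') := by
    have h1 := key []
    simp only [laplaceTest, List.map_nil, List.sum_nil, neg_zero, Real.exp_zero,
      ENNReal.ofReal_one, mul_one, lintegral_one, measure_univ,
      detLaw_univ hMS.measurable_kernel] at h1
    exact h1.symm
  have hprob := isProbabilityMeasure_detProcess hRm hS
  refine hA.ext_of_lintegral_laplaceTest hfinite
    (Measure.ae_smul_measure (ae_detLaw_lt_top hMS.measurable_kernel) _) fun l => ?_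
  rw [detProcess, lintegral_smul_measure, smul_eq_mul]
  have h1 := key l
  rw [hnorm] at h1
  set T := ∫⁻ ν, ENNReal.ofReal (laplaceTest A l ν) ∂(detLaw ω (cutKernel R (schurKernel C y)))
  set I := ∫⁻ ν, ENNReal.ofReal (laplaceTest A l ν) ∂(Pal y)
  set v := ENNReal.ofReal (laplaceTest A l (config y)) with hv
  have hvt : v ≠ ∞ := ENNReal.ofReal_ne_top
  have h2 : (Z⁻¹ * D * v) * T = (Z⁻¹ * D * v) * (Z' * I) := by
    calc (Z⁻¹ * D * v) * T = Z⁻¹ * (D * v * T) := by ring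
      _ = Z⁻¹ * (D * Z') * (v * I) := h1
      _ = (Z⁻¹ * D * v) * (Z' * I) := by ring
  have h3 : T = Z' * I := (ENNReal.mul_right_inj
    (mul_ne_zero (mul_ne_zero (ENNReal.inv_ne_zero.2 hZt) hD0) (hV0 l _))
    (ENNReal.mul_ne_top (ENNReal.mul_ne_top (ENNReal.inv_ne_top.2 hZ0) hDt) hvt)).1 h2
  change I = Z'⁻¹ * T
  rw [h3, ← mul_assoc, ENNReal.inv_mul_cancel hZ'0 hZ't, one_mul]

end DetPalm

/-! ### Exponential tilting and the residual law -/

section Tilt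

variable {H : Measure ℝ}

theorem isProbabilityMeasure_expTilt [IsProbabilityMeasure H] (hH : ∀ᵐ s ∂H, 0 < s) {u : ℝ}
    (hu : 0 ≤ u) : IsProbabilityMeasure (expTilt H u) :=
  isProbabilityMeasure_tilted (integrable_exp_neg_mul hH hu)

theorem ae_expTilt_pos (hH : ∀ᵐ s ∂H, 0 < s) (u : ℝ) : ∀ᵐ s ∂(expTilt H u), 0 < s :=
  (tilted_absolutelyContinuous H fun s => -(u * s)).ae_le hH

theorem psi_expTilt (H : Measure ℝ) (u a : ℝ) :
    psi (expTilt H u) a = psi H (a + u) / psi H u := by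
  rw [psi, expTilt, integral_tilted, psi, psi, ← integral_div]
  refine integral_congr_ae (Filter.Eventually.of_forall fun s => ?_)
  change Real.exp (-(u * s)) / _ * Real.exp (-(a * s)) = _
  rw [div_mul_eq_mul_div, ← Real.exp_add]
  congr 2
  ring

variable {E : Type*} [MeasurableSpace E] {ω : Measure E} {C : E → E → ℂ}

/-- The generating functional of the measure `detLaw ω C`. -/
theorem lintegral_exp_neg_log_detLaw (hC : Measurable fun p : E × E => C p.1 p.2) {g : E → ℝ}
    (hg : Measurable g) (hg0 : ∀ z, 0 < g z) (hg1 : ∀ z, g z ≤ 1) :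
    ∫⁻ ν, ENNReal.ofReal (Real.exp (-∫ z, -Real.log (g z) ∂ν)) ∂(detLaw ω C) =
      ∑' n : ℕ, (n.factorial : ℝ≥0∞)⁻¹ * ∫⁻ x : Fin n → E,
        detWeight C x * ∏ j, ENNReal.ofReal (g (x j)) ∂(Measure.pi fun _ => ω) := by
  have hlog : Measurable fun z => -Real.log (g z) := (Real.measurable_log.comp hg).neg
  rw [lintegral_detLaw hC (measurable_exp_neg_integral hlog fun z =>
    neg_nonneg.2 (Real.log_nonpos (hg0 z).le (hg1 z)))]
  refine tsum_congr fun n => ?_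
  congr 1
  refine lintegral_congr fun x => ?_
  rw [integral_config x hlog, ← Finset.sum_neg_distrib, Real.exp_sum,
    ENNReal.ofReal_prod_of_nonneg fun j _ => (Real.exp_pos _).le]
  congr 1
  refine Finset.prod_congr rfl fun j _ => ?_
  rw [neg_neg, Real.exp_log (hg0 _)]

/-- A constant factor of the argument of the generating functional can be moved into the kernel. -/
theorem lintegral_exp_neg_log_detLaw_const_mul (hC : Measurable fun p : E × E => C p.1 p.2) {t : ℝ}
    (ht : 0 < t) {g g' : E → ℝ} (hg : Measurable g) (hg0 : ∀ z, 0 < g z) (hg1 : ∀ z, g z ≤ 1)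
    (hg' : Measurable g') (hg'1 : ∀ z, g' z ≤ 1) (h : ∀ z, g' z = t * g z) :
    ∫⁻ ν, ENNReal.ofReal (Real.exp (-∫ z, -Real.log (g' z) ∂ν)) ∂(detLaw ω C) =
      ∫⁻ ν, ENNReal.ofReal (Real.exp (-∫ z, -Real.log (g z) ∂ν))
        ∂(detLaw ω fun a b => (t : ℂ) * C a b) := by
  have hg'0 : ∀ z, 0 < g' z := fun z => by
    rw [h]
    exact mul_pos ht (hg0 z)
  rw [lintegral_exp_neg_log_detLaw hC hg' hg'0 hg'1,
    lintegral_exp_neg_log_detLaw (hC.const_mul _) hg hg0 hg1]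
  refine tsum_congr fun n => ?_
  congr 1
  refine lintegral_congr fun x => ?_
  rw [detWeight_const_mul C ht.le, mul_comm (_ ^ n), mul_assoc]
  congr 1
  simp_rw [h, ENNReal.ofReal_mul ht.le]
  rw [Finset.prod_mul_distrib, Finset.prod_const, Finset.card_univ, Fintype.card_fin]

theorem lintegral_exp_neg_log_psi_zero (H' : Measure ℝ) [IsProbabilityMeasure H']
    (L : Measure (Measure E)) :
    ∫⁻ ν, ENNReal.ofReal (Real.exp (-∫ _, -Real.log (psi H' 0) ∂ν)) ∂L = L Set.univ := by
  simp [psi]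

end Tilt

section Residual

theorem isBounded_support_testFun {E : Type*} [Bornology E] {A : ℕ → Set E}
    (hA : ∀ i, Bornology.IsBounded (A i)) (l : List ℕ) :
    Bornology.IsBounded (Function.support (testFun A l)) := by
  induction l with
  | nil =>
    have h : Function.support (testFun A []) = ∅ := by
      simp [Set.eq_empty_iff_forall_notMem, testFun]
    rw [h]
    exact Bornology.isBounded_empty
  | cons i l ih =>
    refine ((hA i).union ih).subset fun z hz => ?_
    by_contra hz'
    rw [Set.mem_union, not_or] at hz'
    refine hz ?_
    rw [testFun_cons, Set.indicator_of_notMem hz'.1, zero_add]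
    exact Function.notMem_support.1 hz'.2

/-- The law of a finite random measure is determined by its Laplace functional on bounded
functions of bounded support. -/
theorem ext_of_laplaceFunctional {q : ℕ} {P Q : Measure (Measure (EuclideanSpace ℝ (Fin q)))}
    [IsProbabilityMeasure P] [IsProbabilityMeasure Q] (hP : ∀ᵐ ν ∂P, ν Set.univ < ∞)
    (hQ : ∀ᵐ ν ∂Q, ν Set.univ < ∞)
    (h : ∀ f : EuclideanSpace ℝ (Fin q) → ℝ, Measurable f → (∀ z, 0 ≤ f z) →
      (∃ b, ∀ z, f z ≤ b) → Bornology.IsBounded (Function.support f) →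
      laplaceFunctional P f = laplaceFunctional Q f) : P = Q := by
  obtain ⟨A, hA, hAb⟩ := exists_isTestSystem_isBounded (EuclideanSpace ℝ (Fin q))
  have hAm := hA.measurableSet
  refine hA.ext_of_lintegral_laplaceTest hP hQ fun l => ?_
  have h1 : ∀ L : Measure (Measure (EuclideanSpace ℝ (Fin q))), (∀ᵐ ν ∂L, ν Set.univ < ∞) →
      ∫⁻ ν, ENNReal.ofReal (laplaceTest A l ν) ∂L =
        ∫⁻ ν, ENNReal.ofReal (Real.exp (-∫ z, testFun A l z ∂ν)) ∂L := by
    intro L hL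
    refine lintegral_congr_ae ?_
    filter_upwards [hL] with ν hν
    have : IsFiniteMeasure ν := ⟨hν⟩
    rw [laplaceTest_eq_exp_integral hAm]
  have h2 : ∀ L : Measure (Measure (EuclideanSpace ℝ (Fin q))), IsProbabilityMeasure L →
      ∫⁻ ν, ENNReal.ofReal (laplaceTest A l ν) ∂L ≠ ∞ := by
    intro L _
    refine ne_top_of_le_ne_top ENNReal.one_ne_top ?_
    calc ∫⁻ ν, ENNReal.ofReal (laplaceTest A l ν) ∂L ≤ ∫⁻ _, 1 ∂L :=
          lintegral_mono fun ν => ENNReal.ofReal_le_one.2 (laplaceTest_le_one A l ν)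
      _ = 1 := by rw [lintegral_one, measure_univ]
  have h3 := h (testFun A l) (measurable_testFun hAm l) (testFun_nonneg A l)
    ⟨_, testFun_le A l⟩ (isBounded_support_testFun hAb l)
  rw [laplaceFunctional_eq_toReal (measurable_testFun hAm l) (testFun_nonneg A l),
    laplaceFunctional_eq_toReal (measurable_testFun hAm l) (testFun_nonneg A l),
    ← h1 P hP, ← h1 Q hQ] at h3
  exact (ENNReal.toReal_eq_toReal_iff' (h2 P inferInstance) (h2 Q inferInstance)).1 h3

variable {q : ℕ} {R : Set (EuclideanSpace ℝ (Fin q))}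
  {S : EuclideanSpace ℝ (Fin q) → EuclideanSpace ℝ (Fin q) → ℂ}
  {c : ℕ → ℝ} {φ : ℕ → EuclideanSpace ℝ (Fin q) → ℂ} {H : Measure ℝ} [IsProbabilityMeasure H]

theorem exists_isRMLaw_detProcess (hR : MeasurableSet R) (hS : HasSpectralRepresentation R S c φ)
    (H : Measure ℝ) [IsProbabilityMeasure H] : ∃ Q, IsRMLaw (detProcess R S) H Q := by
  have hprob := isProbabilityMeasure_detProcess hR hS
  refine exists_isRMLaw (fun n => ((fredholmDet (volume.restrict R) (cutKernel R S))⁻¹ *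
    (n.factorial : ℝ≥0∞)⁻¹) • (Measure.pi fun _ : Fin n => volume.restrict R).withDensity
      (detWeight (cutKernel R S))) ?_ H
  refine Measure.ext fun s hs => ?_
  rw [detProcess, detLaw, Measure.smul_apply, Measure.sum_apply _ hs, Measure.sum_apply _ hs,
    smul_eq_mul, ← ENNReal.tsum_mul_left]
  refine tsum_congr fun n => ?_
  rw [Measure.map_smul, Measure.smul_apply, Measure.smul_apply, smul_eq_mul, smul_eq_mul, mul_assoc]

/-- Tilting the Laplace functional of a marked determinantal process by `exp (-u * mass)` amounts
to tilting the marks and multiplying the kernel of the density by `ψ(u)`. -/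
theorem laplaceFunctional_tilt (hR : MeasurableSet R) (hS : HasSpectralRepresentation R S c φ)
    (hH : ∀ᵐ s ∂H, 0 < s) {u : ℝ} (hu : 0 < u)
    {Qpal Q : Measure (Measure (EuclideanSpace ℝ (Fin q)))}
    (hQpal : IsRMLaw (detProcess R S) H Qpal)
    (hQ : IsRMLaw (detProcess R fun x z => (psi H u : ℂ) * S x z) (expTilt H u) Q)
    {f : EuclideanSpace ℝ (Fin q) → ℝ} (hf : Measurable f) (hf0 : ∀ z, 0 ≤ f z) :
    laplaceFunctional Q f =
      laplaceFunctional Qpal (fun z => f z + u) / laplaceFunctional Qpal (fun _ => u) := by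
  have hprob := isProbabilityMeasure_expTilt hH hu.le
  have hH' := ae_expTilt_pos hH u
  have hM := (hS.isMercerKernel hR).measurable_kernel
  have hψ := psi_pos hH hu.le
  have hcut : cutKernel R (fun x z => (psi H u : ℂ) * S x z) =
      fun a b => (psi H u : ℂ) * cutKernel R S a b := by
    funext a b
    rw [cutKernel, cutKernel]
    split_ifs
    · rfl
    · rw [mul_zero]
  set ω := volume.restrict R with hω
  set Z := fredholmDet ω (cutKernel R S) with hZ
  set Z' := fredholmDet ω (fun a b => (psi H u : ℂ) * cutKernel R S a b) with hZ'
  have hZ0 : Z ≠ 0 := fredholmDet_ne_zero _ _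
  have hZt : Z ≠ ∞ := fredholmDet_ne_top (hS.isMercerKernel hR)
  -- The Laplace functional of the marked process at `g + u`, for the two test functions needed.
  have key : ∀ g : EuclideanSpace ℝ (Fin q) → ℝ, Measurable g → (∀ z, 0 ≤ g z) →
      laplaceFunctional Qpal (fun z => g z + u) = Z⁻¹.toReal *
        (∫⁻ ν, ENNReal.ofReal (Real.exp (-∫ z, -Real.log (psi (expTilt H u) (g z)) ∂ν))
          ∂(detLaw ω fun a b => (psi H u : ℂ) * cutKernel R S a b)).toReal := by
    intro g hg hg0
    have hgu : ∀ z, 0 ≤ g z + u := fun z => add_nonneg (hg0 z) hu.le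
    rw [laplaceFunctional_eq_toReal (hg.add_const u) hgu,
      hQpal.lintegral_exp_neg hH (hg.add_const u) hgu, detProcess, lintegral_smul_measure,
      smul_eq_mul, ENNReal.toReal_mul]
    have hm : Measurable fun z => psi (expTilt H u) (g z) := (measurable_psi _).comp hg
    have hm' : Measurable fun z => psi H (g z + u) := (measurable_psi H).comp (hg.add_const u)
    have hmul : ∀ z, psi H (g z + u) = psi H u * psi (expTilt H u) (g z) := fun z => by
      rw [psi_expTilt, mul_div_cancel₀ _ hψ.ne']
    have h1 := lintegral_exp_neg_log_detLaw_const_mul (ω := ω) (C := cutKernel R S)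
      (g := fun z => psi (expTilt H u) (g z)) (g' := fun z => psi H (g z + u)) hM hψ hm
      (fun z => psi_pos hH' (hg0 z)) (fun z => psi_le_one hH' (hg0 z)) hm'
      (fun z => psi_le_one hH (hgu z)) hmul
    rw [h1]
  have hden : laplaceFunctional Qpal (fun _ => u) = Z⁻¹.toReal * Z'.toReal := by
    have h1 := key (fun _ => 0) measurable_const fun _ => le_rfl
    simp_rw [zero_add] at h1
    rw [h1, lintegral_exp_neg_log_psi_zero, detLaw_univ (hM.const_mul _)]
  have hZr : Z⁻¹.toReal ≠ 0 :=
    (ENNReal.toReal_pos (ENNReal.inv_ne_zero.2 hZt) (ENNReal.inv_ne_top.2 hZ0)).ne'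
  rw [key f hf hf0, hden, mul_div_mul_left _ _ hZr, laplaceFunctional_eq_toReal hf hf0,
    hQ.lintegral_exp_neg hH' hf hf0, detProcess, lintegral_smul_measure, smul_eq_mul,
    ENNReal.toReal_mul, hcut, ENNReal.toReal_inv, inv_mul_eq_div]

end Residual

theorem mainTheorem10 {q : ℕ} (R : Set (EuclideanSpace ℝ (Fin q))) (hR : IsCompact R)
    (K : EuclideanSpace ℝ (Fin q) → EuclideanSpace ℝ (Fin q) → ℂ)
    (lam : ℕ → ℝ) (φ : ℕ → EuclideanSpace ℝ (Fin q) → ℂ)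
    (hK : HasSpectralRepresentation R K lam φ) (hlam : ∀ h, lam h < 1)
    (P : Measure (Measure (EuclideanSpace ℝ (Fin q)))) (hP : IsDPP R K P)
    (H : Measure ℝ) [IsProbabilityMeasure H] (hH : ∀ᵐ s ∂H, 0 < s)
    (k : ℕ) (Pal : Kernel (Fin k → EuclideanSpace ℝ (Fin q)) (Measure (EuclideanSpace ℝ (Fin q))))
    (hPal : IsReducedPalm k P Pal) :
    ∀ᵐ y ∂(momentMeasure k P), ∀ u : ℝ, 0 < u →
      IsUnit (kernelMatrix (cKernel lam φ) y).det ∧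
      ∃ P' Q : Measure (Measure (EuclideanSpace ℝ (Fin q))),
        HasDetDensity R (cPrime H u (cKernel lam φ) y) P' ∧
        (∃ (K' : EuclideanSpace ℝ (Fin q) → EuclideanSpace ℝ (Fin q) → ℂ)
            (lam' : ℕ → ℝ) (φ' : ℕ → EuclideanSpace ℝ (Fin q) → ℂ),
          HasSpectralRepresentation R K' lam' φ' ∧ (∀ h, lam' h < 1) ∧
          (∀ x ∈ R, ∀ z ∈ R, cPrime H u (cKernel lam φ) y x z = cKernel lam' φ' x z) ∧
          IsDPP R K' P') ∧
        IsRMLaw P' (expTilt H u) Q ∧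
        ∀ Q' : Measure (Measure (EuclideanSpace ℝ (Fin q))),
          IsResidualLaw (Pal y) H u Q' ↔ Q' = Q := by
  have hRm := hR.measurableSet
  have hC := hK.cKernel hlam
  have hlam' : (fun h => lam h / (1 - lam h) / (1 + lam h / (1 - lam h))) = lam :=
    funext fun h => div_one_sub_div_one_add (hlam h)
  have hK1 : HasSpectralRepresentation R K
      (fun h => lam h / (1 - lam h) / (1 + lam h / (1 - lam h))) φ := by rwa [hlam']
  obtain rfl := hP.eq_detProcess hRm hC hK1
  filter_upwards [ae_reducedPalm_eq_detProcess hR hC hK1 hPal] with y ⟨hy, hdet, hPaly⟩ u hu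
  refine ⟨hdet, ?_⟩
  rw [hPaly]
  have hψ := psi_pos hH hu.le
  have hprob := isProbabilityMeasure_expTilt hH hu.le
  obtain ⟨c, χ, hS⟩ := hC.exists_schurKernel hRm hy hdet
  obtain ⟨c', φ', hC'⟩ := hC.exists_schurComplement hRm hy hdet hψ.le
  have hC'' : HasSpectralRepresentation R (cPrime H u (cKernel lam φ) y) c' φ' := hC'
  obtain ⟨Qpal, hQpal⟩ := exists_isRMLaw_detProcess hRm hS H
  obtain ⟨Q, hQ⟩ := exists_isRMLaw_detProcess hRm hC'' (expTilt H u)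
  have hQprob := hQ.isProbabilityMeasure
  refine ⟨_, Q, hasDetDensity_detProcess hR hC'', ⟨_, _, φ', hC''.div_one_add,
    fun h => div_one_add_lt_one (hC''.nonneg h), fun x hx z hz =>
      (hC''.cKernel_div_one_add hx hz).symm, isDPP_detProcess hRm hC'' hC''.div_one_add⟩, hQ,
    fun Q' => ⟨?_, ?_⟩⟩
  · rintro ⟨hQ'prob, hfin, Qpal', hQpal', h⟩
    refine ext_of_laplaceFunctional (hfin.mono fun μ hμ => hμ.measure_univ_lt_top) hQ.ae_lt_top
      fun f hf hf0 hfb hfs => ?_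
    rw [h f hf hf0 hfb hfs, laplaceFunctional_tilt hRm hS hH hu hQpal' hQ hf hf0]
  · rintro rfl
    exact ⟨hQprob, hQ.ae_lt_top.mono fun μ hμ => ⟨hμ⟩, Qpal, hQpal, fun f hf hf0 _ _ =>
      laplaceFunctional_tilt hRm hS hH hu hQpal hQ hf hf0⟩
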